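/- **Setting.** ZH-diagrams are the string diagrams (finite open graphs) built from white spiders ($Z$-spiders) and H-boxes with a label $a\in\mathbb C$ and any number of legs, by placing diagrams side by side and joining wire ends; unlabelled H-boxes have $a=-1$. Derived generators: the grey spider is a white spider with an unlabelled binary H-box on each leg (and the scalar $\tfrac12$); the NOT gate is the binary grey spider whose central white spider carries one more, unlabelled unary H-box; the exponentiated H-box with label $\alpha\in\mathbb C$ is the H-box with label $e^{i\alpha}$; the white phase spider with label $\alpha$ is a white spider with an exponentiated unary H-box $\alpha$ attached. Two diagrams are *equal in the ZH-calculus* if one can be transformed into the other by topological deformations and by applying, to any part of a diagram, the rules (ZS1), (ZS2), (HS1), (HS2), (BA1), (BA2), (M), (U), (I), (A), (O) of the ZH-calculus of Backens and Kissinger (fusion of white spiders, white binary spider is a wire, fusion of H-boxes, cancellation of two H-boxes, the two bialgebra rules, multiply, unit, intro, average, ortho). As usual, nonzero scalar factors are ignored: *equal up to a scalar* means that $D$ equals $E$ together with a legless H-box of some label $\lambda\ne0$. For $\vec b,\vec c\in\mathbb B^n=\{0,1\}^n$ let $$\Omega(\vec b,\vec c)=b_1c_1\oplus\dots\oplus b_nc_n\in\{0,1\},\qquad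 \chi(\vec b,\vec c)=(-1)^{\vec b\cdot\vec c},\quad \vec b\cdot\vec c=\sum_i b_ic_i .$$ Both diagrams below have $n$ outputs and start from $n$ white spiders with one output each. * $\mathrm{NF}(\alpha)$: for every $\vec b\in\mathbb B^n$ there is one exponentiated H-box with label $\alpha_{\vec b}$ and $n$ legs, whose $i$-th leg is connected to the $i$-th white spider by a bare wire if $b_i=1$ and through a NOT gate if $b_i=0$. * $\mathrm{PG}(\widetilde\alpha)$: for every $\vec c\in\mathbb B^n$ there is one phase gadget, that is, a grey spider with $n+1$ legs, one of which is joined to a unary white phase spider with label $\widetilde\alpha_{\vec c}$; its $i$-th remaining leg is connected to the $i$-th white spider by a bare wire if $c_i=1$ and disconnected from it if $c_i=0$ (the wire is replaced by a unary white spider on the white spider's side and a unary grey spider on the grey spider's side). **Theorem.** Let $n\ge 0$ and let $(\alpha_{\vec b})_{\vec b\in\mathbb B^n}$ and $(\widetilde\alpha_{\vec c})_{\vec c\in\mathbb B^n}$ be complex numbers. Consider the relations $$\text{(1)}\quad \alpha_{\vec b}=\sum_{\vec c\in\mathbb B^n}\widetilde\alpha_{\vec c}\,\Omega(\vec b,\vec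 c)\ \text{ for all }\vec b,\qquad\qquad \text{(2)}\quad \widetilde\alpha_{\vec c}=\frac{-1}{2^{n-1}}\sum_{\vec b\in\mathbb B^n}\alpha_{\vec b}\,\chi(\vec b,\vec c)\ \text{ for all }\vec c .$$ If (1) or (2) holds, then $\mathrm{NF}(\alpha)$ and $\mathrm{PG}(\widetilde\alpha)$ are equal up to a scalar in the ZH-calculus. Moreover, the two relations are inverse to each other up to the two coefficients that only affect scalars: (1) implies $\widetilde\alpha_{\vec c}=\frac{-1}{2^{n-1}}\sum_{\vec b}\alpha_{\vec b}\,\chi(\vec b,\vec c)$ for all $\vec c\neq\vec 0$, and (2) implies $\alpha_{\vec b}=\alpha_{\vec 0}+\sum_{\vec c}\widetilde\alpha_{\vec c}\,\Omega(\vec b,\vec c)$ for all $\vec b$. -/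

import Mathlib

namespace ZHCalculus

/-- ZH-diagrams.  `ZH B` is the type of diagrams whose open wire ends (inputs and outputs) are
labelled by `B`.  Since only the topology of a diagram matters, no difference is made between
inputs and outputs: a diagram with inputs `A` and outputs `B` is a term of `ZH (A ⊕ B)`.

* `Z L` is the white spider with set of legs `L`;
* `H a L` is the H-box with label `a` and set of legs `L`;
* `strand` is a bare piece of wire, with its two ends `false` and `true`;
* `net D e` places the finitely many diagrams `D i` next to each other and joins some of their
  open ends by the wires `W`: the equivalence `e` says for each open end of each `D i` whether it
  becomes an open end of the new diagram, or one of the two ends of a wire in `W`. -/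
inductive ZH : Type → Type 1
  | Z (L : Type) [Finite L] : ZH L
  | H (a : ℂ) (L : Type) [Finite L] : ZH L
  | strand : ZH Bool
  | net {ι B W : Type} {L : ι → Type} [Finite ι] [Finite W]
      (D : (i : ι) → ZH (L i)) (e : (Σ i, L i) ≃ B ⊕ W × Bool) : ZH B

open ZH

/-! ### Composition of diagrams -/

/-- Renaming of the open ends. -/
def relabel {A B : Type} (g : A ≃ B) (D : ZH A) : ZH B :=
  net (ι := Unit) (W := Empty) (L := fun _ => A) (fun _ => D)
    ((Equiv.uniqueSigma fun _ : Unit => A).trans (g.trans (Equiv.sumEmpty B (Empty × Bool)).symm))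

/-- A family of diagrams placed side by side. -/
def sideBySide {ι : Type} {L : ι → Type} [Finite ι] (D : (i : ι) → ZH (L i)) : ZH (Σ i, L i) :=
  net (W := Empty) D (Equiv.sumEmpty (Σ i, L i) (Empty × Bool)).symm

/-- The two-element family of leg sets `A`, `B`. -/
def pairLegs (A B : Type) : Bool → Type
  | false => A
  | true => B

/-- The two-element family of diagrams `D`, `E`. -/
def pair {A B : Type} (D : ZH A) (E : ZH B) : (t : Bool) → ZH (pairLegs A B t)
  | false => D
  | true => E

/-- Two diagrams side by side. -/
def tensor {A B : Type} (D : ZH A) (E : ZH B) : ZH (A ⊕ B) :=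
  net (W := Empty) (pair D E)
    { toFun := fun
        | ⟨false, a⟩ => Sum.inl (Sum.inl a)
        | ⟨true, b⟩ => Sum.inl (Sum.inr b)
      invFun := fun
        | Sum.inl (Sum.inl a) => ⟨false, a⟩
        | Sum.inl (Sum.inr b) => ⟨true, b⟩
      left_inv := by rintro ⟨_ | _, _⟩ <;> rfl
      right_inv := by rintro ((_ | _) | ⟨⟨⟩, _⟩) <;> rfl }

/-- Stacking: the outputs `C` of `D` are joined to the inputs `C` of `E`. -/
def stack {A B C : Type} [Finite C] (D : ZH (A ⊕ C)) (E : ZH (C ⊕ B)) : ZH (A ⊕ B) :=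
  net (W := C) (pair D E)
    { toFun := fun
        | ⟨false, Sum.inl a⟩ => Sum.inl (Sum.inl a)
        | ⟨false, Sum.inr c⟩ => Sum.inr (c, false)
        | ⟨true, Sum.inl c⟩ => Sum.inr (c, true)
        | ⟨true, Sum.inr b⟩ => Sum.inl (Sum.inr b)
      invFun := fun
        | Sum.inl (Sum.inl a) => ⟨false, Sum.inl a⟩
        | Sum.inr (c, false) => ⟨false, Sum.inr c⟩
        | Sum.inr (c, true) => ⟨true, Sum.inl c⟩
        | Sum.inl (Sum.inr b) => ⟨true, Sum.inr b⟩
      left_inv := by rintro ⟨_ | _, _ | _⟩ <;> rfl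
      right_inv := by rintro ((_ | _) | ⟨_, _ | _⟩) <;> rfl }

/-- The identity diagram on one wire. -/
def idWire : ZH (Unit ⊕ Unit) :=
  relabel Equiv.boolEquivPUnitSumPUnit strand

/-- The scalar `a` placed next to `D`; the scalar `a` is the H-box with label `a` and no legs. -/
def scale {B : Type} (a : ℂ) (D : ZH B) : ZH B :=
  relabel (Equiv.sumEmpty B Empty) (tensor D (H a Empty))

/-- A type of node: a diagram for each finite set of legs. -/
abbrev Spider : Type 1 := (L : Type) → [Finite L] → ZH L

/-- The diagram given by a finite multigraph: it has nodes `ι` of the types `node`, a wire from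
`src w` to `tgt w` for each `w : W`, and the open end `b : B` is a leg of the node `bdry b`.
The legs of a node `i` are all the ends that the node `i` owns. -/
def graph {ι B W : Type} [Finite ι] [Finite B] [Finite W] (node : ι → Spider)
    (bdry : B → ι) (src tgt : W → ι) : ZH B :=
  let owner : B ⊕ W × Bool → ι := Sum.elim bdry fun p => bif p.2 then tgt p.1 else src p.1
  net (fun i => node i {p // owner p = i}) (Equiv.sigmaFiberEquiv owner)

/-! ### Generators as nodes, and derived generators -/

/-- The white spider. -/
def zSp : Spider := fun L _ => Z L

/-- The H-box with label `a`. -/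
def hSp (a : ℂ) : Spider := fun L _ => H a L

/-- The grey spider: a white spider with an unlabelled H-box on each leg, and the scalar `1/2`. -/
noncomputable def xSp : Spider := fun L _ =>
  graph (ι := L ⊕ Bool) (W := L)
    (Sum.elim (fun _ => hSp (-1)) fun t => bif t then zSp else hSp (1 / 2))
    (fun l => Sum.inl l) (fun _ => Sum.inr true) (fun l => Sum.inl l)

/-- The grey spider labelled `¬`: as the grey spider, but an additional unlabelled H-box
is attached to the white spider in the middle. With two legs this is the NOT gate. -/
noncomputable def notSp : Spider := fun L _ =>
  graph (ι := L ⊕ Fin 3) (W := Option L)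
    (Sum.elim (fun _ => hSp (-1)) ![zSp, hSp (-1), hSp (1 / 2)])
    (fun l => Sum.inl l) (fun _ => Sum.inr 0)
    (fun w => w.elim (Sum.inr 1) fun l => Sum.inl l)

/-- The NOT gate. -/
noncomputable def notGate : ZH Bool := notSp Bool

/-- The exponentiated H-box, with complex label `α`. -/
noncomputable def expH (α : ℂ) : Spider := hSp (Complex.exp (Complex.I * α))

/-- The white phase spider: a white spider with an exponentiated H-box attached. -/
noncomputable def zPhase (α : ℂ) : Spider := fun L _ =>
  graph (ι := Bool) (W := Unit) (fun t => bif t then expH α else zSp)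
    (fun _ : L => false) (fun _ => false) (fun _ => true)

/-! ### The rules of the ZH-calculus -/

/-- The rules of the ZH-calculus, with their scalars. -/
inductive Rule : {B : Type} → ZH B → ZH B → Prop
  /-- White spiders that are joined by at least one wire fuse. -/
  | ZS1 {B W : Type} [Finite B] [Finite W] [Nonempty W] (s : B → Bool) :
      Rule (graph (fun _ => zSp) s (fun _ : W => false) (fun _ : W => true)) (Z B)
  /-- A white spider with two legs is a wire. -/
  | ZS2 : Rule (Z Bool) strand
  /-- H-boxes, one of them unlabelled, that are joined through an unlabelled H-box fuse. -/
  | HS1 {B : Type} [Finite B] (a : ℂ) (s : B → Bool) :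
      Rule
        (graph (ι := Fin 3) ![hSp a, hSp (-1), hSp (-1)] (fun b => bif s b then 2 else 0)
          (![0, 1] : Fin 2 → Fin 3) ![1, 2])
        (scale 2 (H a B))
  /-- Two unlabelled binary H-boxes cancel. -/
  | HS2 :
      Rule (graph (ι := Bool) (fun _ => hSp (-1)) id (fun _ : Unit => false) (fun _ => true))
        (scale 2 strand)
  /-- The bialgebra rule for grey and white spiders. -/
  | BA1 (M N : Type) [Finite M] [Finite N] :
      Rule
        (graph (ι := Bool) (fun t => bif t then zSp else xSp)
          (Sum.elim (fun _ : M => false) (fun _ : N => true))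
          (fun _ : Unit => false) (fun _ => true))
        (graph (Sum.elim (fun _ : M => zSp) (fun _ : N => xSp)) id
          (fun p : M × N => Sum.inl p.1) (fun p => Sum.inr p.2))
  /-- The bialgebra rule for H-boxes and white spiders. -/
  | BA2 (M N : Type) [Finite M] [Finite N] :
      Rule
        (graph (ι := Bool) (fun t => bif t then xSp else hSp (-1))
          (Sum.elim (fun _ : M => false) (fun _ : N => true))
          (fun _ : Unit => false) (fun _ => true))
        (graph (Sum.elim (fun _ : M => zSp) (fun _ : N => hSp (-1))) id
          (fun p : M × N => Sum.inl p.1) (fun p => Sum.inr p.2))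
  /-- Multiply. -/
  | M (a b : ℂ) :
      Rule
        (graph (ι := Fin 3) ![zSp, hSp a, hSp b] (fun _ : Unit => 0)
          (![0, 0] : Fin 2 → Fin 3) ![1, 2])
        (H (a * b) Unit)
  /-- Unit. -/
  | U : Rule (H 1 Unit) (Z Unit)
  /-- Intro: nodes `0`, `1` are the white spiders that carry the two open ends, the H-boxes
  `2` and `3` connect them, the latter through the NOT gate `4`. -/
  | I (a : ℂ) :
      Rule
        (graph (ι := Fin 2) ![hSp a, zSp] (id : Fin 2 → Fin 2)
          (Empty.elim : Empty → Fin 2) Empty.elim)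
        (graph (ι := Fin 5) ![zSp, zSp, hSp a, hSp a, notSp] (![0, 1] : Fin 2 → Fin 5)
          (![0, 1, 0, 1, 4] : Fin 5 → Fin 5) ![2, 2, 3, 4, 3])
  /-- Average: node `0` is the white spider that carries the open end; the H-boxes `1` and `2`
  are attached to it and are joined to each other through the NOT gate `3`. -/
  | A (a b : ℂ) :
      Rule
        (graph (ι := Fin 4) ![zSp, hSp a, hSp b, notSp] (fun _ : Unit => 0)
          (![0, 0, 1, 3] : Fin 4 → Fin 4) ![1, 2, 3, 2])
        (scale 2 (H ((a + b) / 2) Unit))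
  /-- Ortho: the unlabelled H-boxes `1` and `2` carry one open end each and are attached to the
  white spider `0`, the latter through the NOT gate `3`, so that at most one of them can be active;
  hence the white spider `4` which they share can be split in two. -/
  | O :
      Rule
        (graph (ι := Fin 5) ![zSp, hSp (-1), hSp (-1), notSp, zSp] (![0, 1, 2] : Fin 3 → Fin 5)
          (![0, 0, 3, 4, 4] : Fin 5 → Fin 5) ![1, 3, 2, 1, 2])
        (scale (1 / 2)
          (graph (ι := Fin 6) ![zSp, hSp (-1), hSp (-1), notSp, zSp, zSp]
            (![0, 1, 2] : Fin 3 → Fin 6)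
            (![0, 0, 3, 4, 5] : Fin 5 → Fin 6) ![1, 3, 2, 1, 2]))

/-! ### Equality in the ZH-calculus -/

/-- Renaming of wires, where the two ends of the wire `w` are exchanged if `s w = true`. -/
def rewire {W V : Type} (ω : W ≃ V) (s : W → Bool) : W × Bool ≃ V × Bool where
  toFun p := (ω p.1, xor (s p.1) p.2)
  invFun p := (ω.symm p.1, xor (s (ω.symm p.1)) p.2)
  left_inv := by rintro ⟨w, t⟩; simp
  right_inv := by rintro ⟨v, t⟩; simp

/-- The wiring of a network of networks, regarded as one network. -/
def flattenWiring {ι B W : Type} {L V κ : ι → Type} {K : (i : ι) → κ i → Type}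
    (e : (i : ι) → (Σ j, K i j) ≃ L i ⊕ V i × Bool) (f : (Σ i, L i) ≃ B ⊕ W × Bool) :
    (Σ p : (Σ i, κ i), K p.1 p.2) ≃ B ⊕ (W ⊕ Σ i, V i) × Bool :=
  calc (Σ p : (Σ i, κ i), K p.1 p.2)
    _ ≃ Σ i, Σ j, K i j := Equiv.sigmaAssoc K
    _ ≃ Σ i, (L i ⊕ V i × Bool) := Equiv.sigmaCongrRight e
    _ ≃ (Σ i, L i) ⊕ (Σ i, V i × Bool) := Equiv.sigmaSumDistrib _ _
    _ ≃ (B ⊕ W × Bool) ⊕ (Σ i, V i) × Bool :=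
        Equiv.sumCongr f (Equiv.sigmaProdDistrib V Bool).symm
    _ ≃ B ⊕ (W × Bool ⊕ (Σ i, V i) × Bool) := Equiv.sumAssoc _ _ _
    _ ≃ B ⊕ (W ⊕ Σ i, V i) × Bool :=
        Equiv.sumCongr (Equiv.refl B) (Equiv.sumProdDistrib _ _ _).symm

/-- Equality in the ZH-calculus: two diagrams are equal when one can be transformed into the other
by topological deformations and by the rules, applied to any part of a diagram. -/
inductive ZHEq : {B : Type} → ZH B → ZH B → Prop
  | rule {B : Type} {D E : ZH B} : Rule D E → ZHEq D E
  | refl {B : Type} (D : ZH B) : ZHEq D D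
  | symm {B : Type} {D E : ZH B} : ZHEq D E → ZHEq E D
  | trans {B : Type} {D E F : ZH B} : ZHEq D E → ZHEq E F → ZHEq D F
  /-- Parts of a diagram can be replaced by equal ones. -/
  | congr {ι B W : Type} {L : ι → Type} [Finite ι] [Finite W] {D E : (i : ι) → ZH (L i)}
      (e : (Σ i, L i) ≃ B ⊕ W × Bool) : (∀ i, ZHEq (D i) (E i)) → ZHEq (net D e) (net E e)
  /-- Deformation: a network consisting of just one diagram is this diagram. -/
  | single {B : Type} (D : ZH B) : ZHEq (relabel (Equiv.refl B) D) D
  /-- Deformation: a network of networks is a network. -/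
  | flatten {ι B W : Type} {L V κ : ι → Type} {K : (i : ι) → κ i → Type} [Finite ι] [Finite W]
      [∀ i, Finite (V i)] [∀ i, Finite (κ i)] (D : (i : ι) → (j : κ i) → ZH (K i j))
      (e : (i : ι) → (Σ j, K i j) ≃ L i ⊕ V i × Bool) (f : (Σ i, L i) ≃ B ⊕ W × Bool) :
      ZHEq (net (fun i => net (D i) (e i)) f)
        (net (fun p : (Σ i, κ i) => D p.1 p.2) (flattenWiring e f))
  /-- Deformation: the names of parts and of wires, and the directions of wires, are irrelevant. -/
  | reindex {ι κ B W V : Type} {L : κ → Type} [Finite ι] [Finite κ] [Finite W] [Finite V]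
      (D : (k : κ) → ZH (L k)) (e : (Σ k, L k) ≃ B ⊕ W × Bool) (σ : ι ≃ κ) (ω : W ≃ V)
      (s : W → Bool) :
      ZHEq (net D e)
        (net (fun i => D (σ i))
          ((Equiv.sigmaCongrLeft (β := L) σ).trans
            (e.trans (Equiv.sumCongr (Equiv.refl B) (rewire ω s)))))
  /-- Deformation: the legs of a white spider can be permuted. -/
  | legsZ {L K : Type} [Finite L] [Finite K] (g : L ≃ K) : ZHEq (relabel g (Z L)) (Z K)
  /-- Deformation: the legs of an H-box can be permuted. -/
  | legsH {L K : Type} [Finite L] [Finite K] (a : ℂ) (g : L ≃ K) :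
      ZHEq (relabel g (H a L)) (H a K)
  /-- Deformation: a piece of wire can be turned around. -/
  | turn : ZHEq (relabel Equiv.boolNot strand) strand
  /-- Deformation: a piece of wire attached to an open end can be shrunk. -/
  | yank {B : Type} (D : ZH (B ⊕ Unit)) : ZHEq (stack D idWire) D

/-- Equality in the ZH-calculus, where nonzero scalar factors are ignored. -/
def ZHEqUpToScalar {B : Type} (D E : ZH B) : Prop :=
  ∃ c : ℂ, c ≠ 0 ∧ ZHEq D (scale c E)

/-! ### The two diagrams of the Fourier transform -/

/-- The expression `(D)^x`: the identity for `x = 0`, and `D` for `x = 1`. -/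
def power (D : ZH Bool) (x : Bool) : ZH Bool := bif x then D else strand

/-- The indexing box with label `b`: a NOT gate on the `i`-th wire if `b i = 0`, a bare wire
otherwise. The ends of the `i`-th wire are `⟨i, false⟩` (bottom) and `⟨i, true⟩` (top). -/
noncomputable def indexingBox {n : ℕ} (b : Fin n → Bool) : ZH (Σ _ : Fin n, Bool) :=
  sideBySide fun i => power notGate (!b i)

/-- The piece that disconnects a white spider (at the end `false`) from a grey spider
(at the end `true`): a white and a grey spider with one leg each. -/
noncomputable def disconnectPiece : ZH Bool :=
  graph (ι := Bool) (fun t => bif t then xSp else zSp) id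
    (Empty.elim : Empty → Bool) Empty.elim

/-- The grey disconnect box with label `c`: a bare wire if `c i = 1`, disconnected otherwise. -/
noncomputable def disconnectBox {n : ℕ} (c : Fin n → Bool) : ZH (Σ _ : Fin n, Bool) :=
  sideBySide fun i => power disconnectPiece (!c i)

/-- The legs of the parts of `bangBox`: `n` white spiders, each with an open leg and one leg for
each `s : S`; and for each `s : S` a box with `n` wires through it, and a diagram with `n` legs. -/
def bangLegs (n : ℕ) (S : Type) : Fin n ⊕ (S ⊕ S) → Type
  | Sum.inl _ => Option S
  | Sum.inr (Sum.inl _) => Σ _ : Fin n, Bool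
  | Sum.inr (Sum.inr _) => Fin n

/-- The wiring of `bangBox`. The wire `((s, i), false)` joins the white spider `i` to the box `s`,
and the wire `((s, i), true)` joins the box `s` to the diagram `s`. -/
def bangWiring (n : ℕ) (S : Type) :
    (Σ j, bangLegs n S j) ≃ Fin n ⊕ ((S × Fin n) × Bool) × Bool where
  toFun
    | ⟨Sum.inl i, none⟩ => Sum.inl i
    | ⟨Sum.inl i, some s⟩ => Sum.inr (((s, i), false), false)
    | ⟨Sum.inr (Sum.inl s), ⟨i, t⟩⟩ => Sum.inr (((s, i), t), true)
    | ⟨Sum.inr (Sum.inr s), i⟩ => Sum.inr (((s, i), true), false)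
  invFun
    | Sum.inl i => ⟨Sum.inl i, none⟩
    | Sum.inr (((s, i), false), false) => ⟨Sum.inl i, some s⟩
    | Sum.inr (((s, i), t), true) => ⟨Sum.inr (Sum.inl s), ⟨i, t⟩⟩
    | Sum.inr (((s, i), true), false) => ⟨Sum.inr (Sum.inr s), i⟩
  left_inv := by
    rintro ⟨_ | _ | _, x⟩
    · cases x <;> rfl
    · obtain ⟨_, _ | _⟩ := x <;> rfl
    · rfl
  right_inv := by rintro (_ | ⟨⟨⟨_, _⟩, _ | _⟩, _ | _⟩) <;> rfl

/-- The diagram with `n` outputs, consisting of `n` white spiders with one output each, and of a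
!-box indexed by the finite set `S`: for each `s : S`, the diagram `top s` is connected to the `n`
white spiders through the box `box s`. -/
def bangBox {n : ℕ} {S : Type} [Finite S] (box : S → ZH (Σ _ : Fin n, Bool))
    (top : S → ZH (Fin n)) : ZH (Fin n) :=
  net (L := bangLegs n S)
    (fun
      | Sum.inl _ => Z (Option S)
      | Sum.inr (Sum.inl s) => box s
      | Sum.inr (Sum.inr s) => top s)
    (bangWiring n S)

/-- The phase gadget with label `α`, up to its connections: a grey spider joined to
a white phase spider with label `α`. -/
noncomputable def phaseGadget (n : ℕ) (α : ℂ) : ZH (Fin n) :=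
  graph (ι := Bool) (fun t => bif t then zPhase α else xSp)
    (fun _ : Fin n => false) (fun _ : Unit => false) (fun _ => true)

/-- The ZH normal form with exponentiated H-boxes with labels `α b`, for all bit-strings `b`. -/
noncomputable def expNormalForm {n : ℕ} (α : (Fin n → Bool) → ℂ) : ZH (Fin n) :=
  bangBox indexingBox fun b => expH (α b) (Fin n)

/-- The diagram of phase gadgets with labels `β c`, for all bit-strings `c`. -/
noncomputable def gadgetForm {n : ℕ} (β : (Fin n → Bool) → ℂ) : ZH (Fin n) :=
  bangBox disconnectBox fun c => phaseGadget n (β c)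

/-! ### The coefficients -/

/-- `b₁c₁ ⊕ ⋯ ⊕ bₙcₙ` -/
def Omega {n : ℕ} (b c : Fin n → Bool) : Bool :=
  (List.ofFn fun i => b i && c i).foldr Bool.xor false

/-- `(-1)^(b·c)` -/
def chi {n : ℕ} (b c : Fin n → Bool) : ℂ :=
  (-1) ^ ∑ i, (b i).toNat * (c i).toNat

/-- `α` is given by its Fourier coefficients `β`. -/
def IsFourierExpansion {n : ℕ} (α β : (Fin n → Bool) → ℂ) : Prop :=
  ∀ b, α b = ∑ c, β c * ((Omega b c).toNat : ℂ)

/-- `β` is the family of the Fourier coefficients of `α`. -/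
def IsFourierTransform {n : ℕ} (α β : (Fin n → Bool) → ℂ) : Prop :=
  ∀ c, β c = -1 / (2 : ℂ) ^ ((n : ℤ) - 1) * ∑ b, α b * chi b c

end ZHCalculus

/-!
Regard the open ends of a diagram as variables. Diagrams modulo the calculus then form commutative
monoids in which joining two ends by a wire identifies and sums out variables, and a white spider
lets several legs read the same variable. Some diagrams express one variable as a function of the
others, in the sense that white spiders copy and discard their output; such *terms* can be
substituted for variables. Under exclusive or (a grey spider) and conjunction (an H-box followed by
a Hadamard transform) the terms form a Boolean ring, which is where the rules (BA1), (BA2) and (O)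
enter.

An H-box with label `a` that reads a term `t` behaves like `a ^ t`: it satisfies
`a ^ t * b ^ t = (a * b) ^ t` by (M), and `a ^ t = a ^ (t * s) * a ^ (t * (1 + s))` by (I). The
normal form is the product of `exp (i α b)` to the power of the minterm of `b`, and the diagram of
phase gadgets is the product of `exp (i β c)` to the power of the linear form of `c`. The product of
this linear form and the minterm of `b` is the minterm or zero, depending on `Omega b c`, so the
phase gadgets contribute `∑ c, β c * Omega b c` to the exponent at `b`. The relations between the
coefficients follow from the orthogonality of the characters since `2 * Omega b c = 1 - chi b c`.
-/

namespace ZHCalculus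

open ZH

/-! ### Diagrams modulo the calculus -/

section
variable {A A' B B' C U V W ι κ μ : Type}

instance diagramSetoid (B : Type) : Setoid (ZH B) :=
  ⟨ZHEq, ZHEq.refl, ZHEq.symm, ZHEq.trans⟩

/-- The diagrams with open ends `B` modulo equality in the ZH-calculus. The whole calculation takes
place in these quotients, where deformations and rules become equations. -/
abbrev Diagram (B : Type) : Type 1 := Quotient (diagramSetoid B)

/-- The operation `net` on classes of diagrams. The parts are replaced by representatives, since
the dependent family `q` of classes cannot be lifted by `Quotient.map`; see `network_mk`. -/
noncomputable def network {L : ι → Type} [Finite ι] [Finite W] (q : (i : ι) → Diagram (L i))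
    (e : (Σ i, L i) ≃ B ⊕ W × Bool) : Diagram B :=
  ⟦net (fun i => (q i).out) e⟧

lemma network_mk {L : ι → Type} [Finite ι] [Finite W] (D : (i : ι) → ZH (L i))
    (e : (Σ i, L i) ≃ B ⊕ W × Bool) : network (fun i => ⟦D i⟧) e = ⟦net D e⟧ :=
  Quotient.sound (ZHEq.congr e fun i => Quotient.exact (s := diagramSetoid _)
    (Quotient.out_eq (Quotient.mk (diagramSetoid _) (D i))))

lemma network_network {L V κ : ι → Type} {K : (i : ι) → κ i → Type} [Finite ι] [Finite W]
    [∀ i, Finite (V i)] [∀ i, Finite (κ i)] (q : (i : ι) → (j : κ i) → Diagram (K i j))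
    (e : (i : ι) → (Σ j, K i j) ≃ L i ⊕ V i × Bool) (f : (Σ i, L i) ≃ B ⊕ W × Bool) :
    network (fun i => network (q i) (e i)) f =
      network (fun p : (Σ i, κ i) => q p.1 p.2) (flattenWiring e f) := by
  have hsound := Quotient.sound (s := diagramSetoid B)
    (ZHEq.flatten (fun i j => (q i j).out) e f)
  rw [← network_mk, ← network_mk] at hsound
  simpa only [network, Quotient.out_eq] using hsound

/-- A part of a network has inner wires `V`, and its open ends `A` are wired up by `f` in the
network; `addWires f` says where the ends of its own parts are in the flattened network. -/
def addWires (f : A → B ⊕ W × Bool) : A ⊕ V × Bool → B ⊕ (W ⊕ V) × Bool :=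
  Sum.elim (fun a => Sum.map id (Prod.map Sum.inl id) (f a)) fun p => Sum.inr (Sum.inr p.1, p.2)

lemma flattenWiring_apply {L V κ : ι → Type} {K : (i : ι) → κ i → Type}
    (e : (i : ι) → (Σ j, K i j) ≃ L i ⊕ V i × Bool) (f : (Σ i, L i) ≃ B ⊕ W × Bool) (i : ι)
    (j : κ i) (k : K i j) :
    flattenWiring e f ⟨⟨i, j⟩, k⟩ =
      addWires (fun l => f ⟨i, l⟩)
        (Sum.map id (Prod.map (Sigma.mk (β := V) i) id) (e i ⟨j, k⟩)) := by
  change ((Equiv.refl B).sumCongr (Equiv.sumProdDistrib W (Σ i, V i) Bool).symm)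
    (Equiv.sumAssoc B (W × Bool) ((Σ i, V i) × Bool)
      ((f.sumCongr (Equiv.sigmaProdDistrib V Bool).symm)
        (Equiv.sigmaSumDistrib L (fun i => V i × Bool) ⟨i, e i ⟨j, k⟩⟩))) = _
  rcases e i ⟨j, k⟩ with l | ⟨v, t⟩
  · rcases hf : f ⟨i, l⟩ with b | ⟨w, t⟩ <;>
      simp [Equiv.sigmaSumDistrib, hf, addWires]
  · simp [Equiv.sigmaSumDistrib, Equiv.sigmaProdDistrib, addWires]

lemma network_reindex {L : κ → Type} [Finite ι] [Finite κ] [Finite W] [Finite V]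
    (q : (k : κ) → Diagram (L k)) (e : (Σ k, L k) ≃ B ⊕ W × Bool) (σ : ι ≃ κ) (ω : W ≃ V)
    (s : W → Bool) :
    network q e =
      network (fun i => q (σ i)) ((Equiv.sigmaCongrLeft (β := L) σ).trans
        (e.trans (Equiv.sumCongr (Equiv.refl B) (rewire ω s)))) :=
  Quotient.sound (ZHEq.reindex (fun k => (q k).out) e σ ω s)

/-- The partial trace: the open ends of a diagram that `e` sends to `W × Bool` are joined by the
wires `W`. -/
noncomputable def contract [Finite W] (e : A ≃ B ⊕ W × Bool) (q : Diagram A) : Diagram B :=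
  network (ι := Unit) (L := fun _ => A) (fun _ => q) ((Equiv.uniqueSigma fun _ : Unit => A).trans e)

/-- The operation `relabel` on classes of diagrams. -/
noncomputable def reindex (g : A ≃ B) (q : Diagram A) : Diagram B :=
  contract (g.trans (Equiv.sumEmpty B (Empty × Bool)).symm) q

lemma reindex_mk (g : A ≃ B) (D : ZH A) : reindex g ⟦D⟧ = ⟦relabel g D⟧ := network_mk _ _

@[simp] lemma reindex_refl (q : Diagram A) : reindex (Equiv.refl A) q = q := by
  induction q using Quotient.inductionOn with
  | h D => rw [reindex_mk]; exact Quotient.sound (ZHEq.single D)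

lemma network_congr {L : κ → Type} {M : ι → Type} [Finite ι] [Finite κ] [Finite W] [Finite V]
    {q : (k : κ) → Diagram (L k)} {r : (i : ι) → Diagram (M i)} {e : (Σ k, L k) ≃ B ⊕ W × Bool}
    {f : (Σ i, M i) ≃ B ⊕ V × Bool} (σ : ι ≃ κ) (τ : (i : ι) → L (σ i) ≃ M i) (ω : W ≃ V)
    (s : W → Bool) (hq : ∀ i, r i = reindex (τ i) (q (σ i)))
    (h : ∀ i l, f ⟨i, τ i l⟩ = Sum.map id (rewire ω s) (e ⟨σ i, l⟩)) :
    network q e = network r f := by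
  obtain rfl : r = fun i => reindex (τ i) (q (σ i)) := funext hq
  rw [network_reindex q e σ ω s]
  simp only [reindex, contract]
  have : IsEmpty (Σ _ : ι, Empty) := ⟨fun p => p.2.elim⟩
  rw [network_network]
  refine Eq.trans ?_ (network_reindex (L := fun p : (Σ _ : ι, Unit) => L (σ p.1))
    (fun p => q (σ p.1)) _ (Equiv.sigmaPUnit ι).symm (Equiv.sumEmpty V (Σ _ : ι, Empty))
    fun _ => false).symm
  congr 1
  ext ⟨i, l⟩ : 1
  change ((Equiv.refl B).sumCongr (rewire ω s)) (e ⟨σ i, l⟩) =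
    ((Equiv.refl B).sumCongr (rewire (Equiv.sumEmpty V (Σ _ : ι, Empty)) fun _ => false))
      (flattenWiring (fun i => (Equiv.uniqueSigma fun _ : Unit => L (σ i)).trans
        ((τ i).trans (Equiv.sumEmpty (M i) (Empty × Bool)).symm)) f ⟨⟨i, ()⟩, l⟩)
  have h' := h i l
  rw [flattenWiring_apply]
  simp only [Equiv.trans_apply, Equiv.uniqueSigma_apply, addWires,
    Equiv.sumEmpty_symm_apply, Sum.map_inl, Sum.elim_inl, id, h']
  rcases e ⟨σ i, l⟩ with b | ⟨w, t⟩ <;> simp [rewire]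

end

/-! ### Contraction and juxtaposition -/

section
variable {A A' B B' C U V W ι κ μ : Type}

/-- The operation `sideBySide` on classes of diagrams. -/
noncomputable def tensorFamily {L : ι → Type} [Finite ι] (q : (i : ι) → Diagram (L i)) :
    Diagram (Σ i, L i) :=
  network (W := Empty) q (Equiv.sumEmpty (Σ i, L i) (Empty × Bool)).symm

lemma tensorFamily_mk {L : ι → Type} [Finite ι] (D : (i : ι) → ZH (L i)) :
    tensorFamily (fun i => ⟦D i⟧) = ⟦sideBySide D⟧ := network_mk _ _

lemma network_eq_contract {L : ι → Type} [Finite ι] [Finite W] (q : (i : ι) → Diagram (L i))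
    (e : (Σ i, L i) ≃ B ⊕ W × Bool) : network q e = contract e (tensorFamily q) := by
  rw [contract, tensorFamily, network_network]
  have : IsEmpty (Σ _ : Unit, Empty) := ⟨fun p => p.2.elim⟩
  refine network_congr (Equiv.uniqueSigma fun _ : Unit => ι) (fun i => Equiv.refl (L i.2))
    (Equiv.sumEmpty W (Σ _ : Unit, Empty)).symm (fun _ => false) (fun _ => (reindex_refl _).symm) ?_
  rintro ⟨⟨⟩, i⟩ l
  erw [flattenWiring_apply]
  change Sum.map id (Prod.map Sum.inl id) (e ⟨i, l⟩) = Sum.map id _ (e ⟨i, l⟩)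
  rcases e ⟨i, l⟩ with b | ⟨w, t⟩ <;> simp [rewire]

lemma contract_contract_eq [Finite W] [Finite V] [Finite U] {e : B ≃ C ⊕ W × Bool}
    {f : A ≃ B ⊕ V × Bool} {g : A ≃ C ⊕ U × Bool} (q : Diagram A) (ω : W ⊕ V ≃ U) (s : W ⊕ V → Bool)
    (h : ∀ a, g a = Sum.map id (rewire ω s) (addWires e (f a))) :
    contract e (contract f q) = contract g q := by
  rw [contract, contract, network_network]
  refine network_congr (Equiv.uniqueSigma fun _ : Unit => Unit).symm (fun _ => Equiv.refl _)
    ((Equiv.sumCongr (Equiv.refl W) (Equiv.uniqueSigma fun _ : Unit => V)).trans ω)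
    (fun x => s ((Equiv.sumCongr (Equiv.refl W) (Equiv.uniqueSigma fun _ : Unit => V)) x))
    (fun _ => (reindex_refl _).symm) ?_
  rintro ⟨⟩ a
  have h' := h a
  erw [flattenWiring_apply]
  simp only [Equiv.trans_apply, Equiv.uniqueSigma_apply, addWires] at h' ⊢
  change g a = _
  rw [h']
  rcases f a with b | ⟨w, t⟩
  · simp only [Sum.elim_inl, Sum.map_inl, id]
    rcases e b with b | ⟨w, t⟩ <;> simp [rewire]
  · have hw : (Equiv.uniqueSigma fun _ : Unit => V) ⟨(), w⟩ = w := rfl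
    simp [rewire, hw]

lemma contract_congr [Finite W] [Finite V] {e : A ≃ B ⊕ W × Bool} {f : A ≃ B ⊕ V × Bool}
    (q : Diagram A) (ω : W ≃ V) (s : W → Bool) (h : ∀ a, f a = Sum.map id (rewire ω s) (e a)) :
    contract e q = contract f q :=
  network_congr (Equiv.refl Unit) (fun _ => Equiv.refl A) ω s (fun _ => (reindex_refl _).symm)
    fun _ a => h a

lemma contract_reindex [Finite W] (e : A' ≃ B ⊕ W × Bool) (g : A ≃ A') (q : Diagram A) :
    contract e (reindex g q) = contract (g.trans e) q := by
  refine contract_contract_eq q (Equiv.sumEmpty W Empty) (fun _ => false) fun a => ?_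
  simp only [Equiv.trans_apply, addWires, Equiv.sumEmpty_symm_apply, Sum.elim_inl]
  rcases e (g a) with b | ⟨w, t⟩ <;> simp [rewire]

lemma reindex_contract [Finite W] (e : A ≃ B ⊕ W × Bool) (g : B ≃ C) (q : Diagram A) :
    reindex g (contract e q) = contract (e.trans (Equiv.sumCongr g (Equiv.refl _))) q := by
  refine contract_contract_eq q (Equiv.emptySum Empty W) (fun _ => false) fun a => ?_
  simp only [Equiv.trans_apply, addWires]
  rcases e a with b | ⟨w, t⟩ <;> simp [rewire]

lemma reindex_reindex (g : A ≃ B) (h : B ≃ C) (q : Diagram A) :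
    reindex h (reindex g q) = reindex (g.trans h) q := contract_reindex _ _ _

lemma reindex_tensorFamily {L : κ → Type} {M : ι → Type} [Finite ι] [Finite κ]
    {q : (k : κ) → Diagram (L k)} {r : (i : ι) → Diagram (M i)} (σ : ι ≃ κ)
    (τ : (i : ι) → L (σ i) ≃ M i) (E : (Σ k, L k) ≃ Σ i, M i)
    (hq : ∀ i, r i = reindex (τ i) (q (σ i))) (h : ∀ i l, E ⟨σ i, l⟩ = ⟨i, τ i l⟩) :
    reindex E (tensorFamily q) = tensorFamily r := by
  rw [reindex, ← network_eq_contract]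
  exact network_congr σ τ (Equiv.refl _) (fun _ => false) hq fun i l => by simp [h]

lemma tensorFamily_tensorFamily {κ : ι → Type} {K : (i : ι) → κ i → Type} [Finite ι]
    [∀ i, Finite (κ i)] (q : (i : ι) → (j : κ i) → Diagram (K i j)) :
    tensorFamily (fun i => tensorFamily (q i)) =
      reindex (Equiv.sigmaAssoc K) (tensorFamily fun p : (Σ i, κ i) => q p.1 p.2) := by
  rw [reindex, ← network_eq_contract]
  simp only [tensorFamily]
  rw [network_network]
  have : IsEmpty (Σ _ : ι, Empty) := ⟨fun p => p.2.elim⟩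
  exact network_congr (Equiv.refl _) (fun _ => Equiv.refl _)
    (Equiv.sumEmpty Empty (Σ _ : ι, Empty)) (fun _ => false) (fun _ => (reindex_refl _).symm)
    fun _ _ => rfl

lemma tensorFamily_contract {A B W : ι → Type} [Finite ι] [∀ i, Finite (W i)]
    (e : (i : ι) → A i ≃ B i ⊕ W i × Bool) (q : (i : ι) → Diagram (A i))
    (f : (Σ i, A i) ≃ (Σ i, B i) ⊕ (Σ i, W i) × Bool)
    (h : ∀ i a, f ⟨i, a⟩ = Sum.map (Sigma.mk i) (Prod.map (Sigma.mk i) id) (e i a)) :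
    tensorFamily (fun i => contract (e i) (q i)) = contract f (tensorFamily q) := by
  rw [← network_eq_contract]
  simp only [tensorFamily, contract]
  rw [network_network]
  refine network_congr (Equiv.sigmaPUnit ι).symm (fun _ => Equiv.refl _) (Equiv.emptySum Empty _)
    (fun _ => false) (fun _ => (reindex_refl _).symm) ?_
  rintro i (l : A i)
  have h' := h i l
  change f ⟨i, l⟩ = Sum.map id _
    (flattenWiring (fun i => (Equiv.uniqueSigma fun _ : Unit => A i).trans (e i))
      (Equiv.sumEmpty (Σ i, B i) (Empty × Bool)).symm ⟨⟨i, ()⟩, l⟩)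
  rw [flattenWiring_apply]
  simp only [Equiv.trans_apply, Equiv.uniqueSigma_apply, h', addWires]
  rcases e i l with b | ⟨w, t⟩ <;> simp [rewire]

lemma tensorFamily_reindex {A B : ι → Type} [Finite ι] (e : (i : ι) → A i ≃ B i)
    (q : (i : ι) → Diagram (A i)) :
    tensorFamily (fun i => reindex (e i) (q i)) =
      reindex (Equiv.sigmaCongrRight e) (tensorFamily q) :=
  (reindex_tensorFamily (Equiv.refl ι) e _ (fun _ => rfl) fun _ _ => rfl).symm

/-- The operation `pair` on classes of diagrams. -/
def diagramPair (q : Diagram A) (r : Diagram B) : (t : Bool) → Diagram (pairLegs A B t)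
  | false => q
  | true => r

/-- The legs of a pair of diagrams as a disjoint union. -/
def pairLegsEquiv (A B : Type) : (Σ t, pairLegs A B t) ≃ A ⊕ B where
  toFun := fun
    | ⟨false, a⟩ => Sum.inl a
    | ⟨true, b⟩ => Sum.inr b
  invFun := fun
    | Sum.inl a => ⟨false, a⟩
    | Sum.inr b => ⟨true, b⟩
  left_inv := by rintro ⟨_ | _, _⟩ <;> rfl
  right_inv := by rintro (_ | _) <;> rfl

/-- The operation `tensor` on classes of diagrams, as a special case of `tensorFamily`. -/
noncomputable def tensorPair (q : Diagram A) (r : Diagram B) : Diagram (A ⊕ B) :=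
  reindex (pairLegsEquiv A B) (tensorFamily (diagramPair q r))

lemma diagramPair_mk (D : ZH A) (E : ZH B) :
    diagramPair ⟦D⟧ ⟦E⟧ = fun t => (⟦pair D E t⟧ : Diagram _) := by
  funext t; cases t <;> rfl

lemma tensorPair_mk (D : ZH A) (E : ZH B) : tensorPair ⟦D⟧ ⟦E⟧ = ⟦tensor D E⟧ := by
  rw [tensorPair, diagramPair_mk, reindex, ← network_eq_contract, tensor, ← network_mk]
  refine network_congr (Equiv.refl _) (fun _ => Equiv.refl _) (Equiv.refl _) (fun _ => false)
    (fun _ => (reindex_refl _).symm) ?_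
  rintro (_ | _) l <;> rfl

/-- The wiring of two diagrams side by side, where `V` and `W` are the wires of the one and of
the other. -/
def gatherWires (A V B W : Type) : (A ⊕ V × Bool) ⊕ (B ⊕ W × Bool) ≃ (A ⊕ B) ⊕ (V ⊕ W) × Bool where
  toFun := fun
    | Sum.inl (Sum.inl a) => Sum.inl (Sum.inl a)
    | Sum.inl (Sum.inr (v, t)) => Sum.inr (Sum.inl v, t)
    | Sum.inr (Sum.inl b) => Sum.inl (Sum.inr b)
    | Sum.inr (Sum.inr (w, t)) => Sum.inr (Sum.inr w, t)
  invFun := fun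
    | Sum.inl (Sum.inl a) => Sum.inl (Sum.inl a)
    | Sum.inr (Sum.inl v, t) => Sum.inl (Sum.inr (v, t))
    | Sum.inl (Sum.inr b) => Sum.inr (Sum.inl b)
    | Sum.inr (Sum.inr w, t) => Sum.inr (Sum.inr (w, t))
  left_inv := by rintro ((_ | _) | (_ | _)) <;> rfl
  right_inv := by rintro ((_ | _) | ⟨_ | _, _⟩) <;> rfl

/-- The function `addWires` for a bijective wiring `e`, as a bijection. -/
def addWiresEquiv (V : Type) (e : A ≃ B ⊕ W × Bool) : A ⊕ V × Bool ≃ B ⊕ (W ⊕ V) × Bool :=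
  (Equiv.sumCongr e (Equiv.refl _)).trans
    ((Equiv.sumAssoc _ _ _).trans (Equiv.sumCongr (Equiv.refl _) (Equiv.sumProdDistrib _ _ _).symm))

lemma addWiresEquiv_apply (e : A ≃ B ⊕ W × Bool) (x : A ⊕ V × Bool) :
    addWiresEquiv V e x = addWires e x := by
  rcases x with a | ⟨v, t⟩
  · rcases h : e a with b | ⟨w, t⟩ <;> simp [addWiresEquiv, addWires, h]
  · simp [addWiresEquiv, addWires]

lemma contract_contract [Finite W] [Finite V] (e : B ≃ C ⊕ W × Bool) (f : A ≃ B ⊕ V × Bool)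
    (q : Diagram A) : contract e (contract f q) = contract (f.trans (addWiresEquiv V e)) q :=
  contract_contract_eq q (Equiv.refl _) (fun _ => false) fun a => by
    simp only [Equiv.trans_apply, addWiresEquiv_apply]
    rcases addWires e (f a) with b | ⟨w, t⟩ <;> simp [rewire]

instance [Finite V] [Finite W] (t : Bool) : Finite (pairLegs V W t) := by
  cases t <;> assumption

lemma tensorPair_contract [Finite V] [Finite W] (e : A ≃ A' ⊕ V × Bool) (f : B ≃ B' ⊕ W × Bool)
    (q : Diagram A) (r : Diagram B) :
    tensorPair (contract e q) (contract f r) =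
      contract ((Equiv.sumCongr e f).trans (gatherWires _ _ _ _)) (tensorPair q r) := by
  let E : (t : Bool) → pairLegs A B t ≃ pairLegs A' B' t ⊕ pairLegs V W t × Bool := fun
    | false => e
    | true => f
  have hpair : diagramPair (contract e q) (contract f r) =
      fun t => contract (E t) (diagramPair q r t) := by
    funext t; cases t <;> rfl
  rw [tensorPair, hpair, tensorFamily_contract E (diagramPair q r)
    ((pairLegsEquiv A B).trans (((Equiv.sumCongr e f).trans
    (gatherWires _ _ _ _)).trans (Equiv.sumCongr (pairLegsEquiv A' B').symm
      (Equiv.prodCongr (pairLegsEquiv V W).symm (Equiv.refl _)))))]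
  · rw [tensorPair, reindex_contract, contract_reindex]
    refine contract_congr _ (pairLegsEquiv V W) (fun _ => false) ?_
    rintro ⟨_ | _, x⟩
    · change gatherWires _ _ _ _ (Sum.inl (e x)) = Sum.map id _ (Sum.map (pairLegsEquiv A' B') id
        (Sum.map (pairLegsEquiv A' B').symm (Prod.map (pairLegsEquiv V W).symm id)
          (gatherWires _ _ _ _ (Sum.inl (e x)))))
      rcases e x with b | ⟨w, t⟩ <;> simp [gatherWires, rewire]
    · change gatherWires _ _ _ _ (Sum.inr (f x)) = Sum.map id _ (Sum.map (pairLegsEquiv A' B') id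
        (Sum.map (pairLegsEquiv A' B').symm (Prod.map (pairLegsEquiv V W).symm id)
          (gatherWires _ _ _ _ (Sum.inr (f x)))))
      rcases f x with b | ⟨w, t⟩ <;> simp [gatherWires, rewire]
  · rintro (_ | _) x
    · change (Sum.map (pairLegsEquiv A' B').symm (Prod.map (pairLegsEquiv V W).symm id)
          (gatherWires _ _ _ _ (Sum.inl (e x)))) = Sum.map _ _ (e x)
      rcases e x with b | ⟨w, t⟩ <;> rfl
    · change (Sum.map (pairLegsEquiv A' B').symm (Prod.map (pairLegsEquiv V W).symm id)
          (gatherWires _ _ _ _ (Sum.inr (f x)))) = Sum.map _ _ (f x)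
      rcases f x with b | ⟨w, t⟩ <;> rfl

lemma tensorPair_reindex (e : A ≃ A') (f : B ≃ B') (q : Diagram A) (r : Diagram B) :
    tensorPair (reindex e q) (reindex f r) = reindex (Equiv.sumCongr e f) (tensorPair q r) := by
  rw [reindex, reindex, tensorPair_contract, reindex]
  refine contract_congr _ (Equiv.sumEmpty Empty Empty) (fun _ => false) ?_
  rintro (_ | _) <;> simp [gatherWires]

lemma tensorPair_contract_left [Finite V] (e : A ≃ A' ⊕ V × Bool) (q : Diagram A) (r : Diagram B) :
    tensorPair (contract e q) r =
      contract ((Equiv.sumCongr e (Equiv.refl B)).trans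
        ((Equiv.sumAssoc _ _ _).trans ((Equiv.sumCongr (Equiv.refl _) (Equiv.sumComm _ _)).trans
        (Equiv.sumAssoc _ _ _).symm))) (tensorPair q r) := by
  conv_lhs => rw [← reindex_refl r]
  rw [reindex, tensorPair_contract]
  refine contract_congr _ (Equiv.sumEmpty V Empty) (fun _ => false) ?_
  rintro (a | b)
  · rcases h : e a with x | ⟨w, t⟩ <;> simp [gatherWires, rewire, h]
  · simp [gatherWires]

lemma tensorPair_contract_right [Finite V] (e : B ≃ B' ⊕ V × Bool) (q : Diagram A) (r : Diagram B) :
    tensorPair q (contract e r) =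
      contract ((Equiv.sumCongr (Equiv.refl A) e).trans (Equiv.sumAssoc _ _ _).symm)
        (tensorPair q r) := by
  conv_lhs => rw [← reindex_refl q]
  rw [reindex, tensorPair_contract]
  refine contract_congr _ (Equiv.emptySum Empty V) (fun _ => false) ?_
  rintro (a | b)
  · simp [gatherWires]
  · rcases h : e b with x | ⟨w, t⟩ <;> simp [gatherWires, rewire, h]

/-- The disjoint union of two families of classes of diagrams. -/
def sumFamily {L : ι → Type} {M : κ → Type} (q : (i : ι) → Diagram (L i))
    (r : (j : κ) → Diagram (M j)) : (x : ι ⊕ κ) → Diagram (Sum.elim L M x)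
  | Sum.inl i => q i
  | Sum.inr j => r j

/-- The legs of the disjoint union of two families of diagrams. -/
def sumLegsEquiv (L : ι → Type) (M : κ → Type) : (Σ x, Sum.elim L M x) ≃ (Σ i, L i) ⊕ Σ j, M j :=
  Equiv.sumSigmaDistrib (Sum.elim L M)

lemma tensorPair_tensorFamily {L : ι → Type} {M : κ → Type} [Finite ι] [Finite κ]
    (q : (i : ι) → Diagram (L i)) (r : (j : κ) → Diagram (M j)) :
    tensorPair (tensorFamily q) (tensorFamily r) =
      reindex (sumLegsEquiv L M) (tensorFamily (sumFamily q r)) := by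
  let K : (t : Bool) → pairLegs ι κ t → Type := fun
    | false => L
    | true => M
  let F : (t : Bool) → (j : pairLegs ι κ t) → Diagram (K t j) := fun
    | false => q
    | true => r
  let E : (Σ t, Σ j, K t j) ≃ Σ t, pairLegs (Σ i, L i) (Σ j, M j) t :=
    Equiv.sigmaCongrRight fun
      | false => Equiv.refl _
      | true => Equiv.refl _
  have hnested : reindex E (tensorFamily (fun t => tensorFamily (F t))) =
      tensorFamily (diagramPair (tensorFamily q) (tensorFamily r)) :=
    reindex_tensorFamily (Equiv.refl _) (fun
      | false => Equiv.refl _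
      | true => Equiv.refl _) _
      (by rintro (_ | _) <;> exact (reindex_refl _).symm) (by rintro (_ | _) _ <;> rfl)
  rw [tensorPair, ← hnested, tensorFamily_tensorFamily, reindex_reindex, reindex_reindex]
  have hflat : reindex (((Equiv.sigmaAssoc K).trans (E.trans (pairLegsEquiv _ _))).trans
      (sumLegsEquiv L M).symm)
      (tensorFamily fun p : (Σ t, pairLegs ι κ t) => F p.1 p.2) = tensorFamily (sumFamily q r) :=
    reindex_tensorFamily (pairLegsEquiv ι κ).symm (fun
      | Sum.inl i => Equiv.refl (L i)
      | Sum.inr j => Equiv.refl (M j)) _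
      (by rintro (_ | _) <;> exact (reindex_refl _).symm) (by rintro (_ | _) _ <;> rfl)
  rw [← hflat, reindex_reindex]
  congr 1
  ext x : 1
  simp only [Equiv.trans_apply, Equiv.apply_symm_apply]

lemma tensorFamily_unit (q : Diagram A) :
    tensorFamily (fun _ : Unit => q) = reindex (Equiv.uniqueSigma fun _ : Unit => A).symm q := by
  rw [reindex, contract]
  rfl

lemma tensorPair_reindex_left (e : A ≃ A') (q : Diagram A) (r : Diagram B) :
    tensorPair (reindex e q) r = reindex (Equiv.sumCongr e (Equiv.refl B)) (tensorPair q r) := by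
  conv_lhs => rw [← reindex_refl r]
  exact tensorPair_reindex _ _ _ _

lemma tensorPair_reindex_right (e : B ≃ B') (q : Diagram A) (r : Diagram B) :
    tensorPair q (reindex e r) = reindex (Equiv.sumCongr (Equiv.refl A) e) (tensorPair q r) := by
  conv_lhs => rw [← reindex_refl q]
  exact tensorPair_reindex _ _ _ _

lemma reindex_injective (e : A ≃ B) {q r : Diagram A} (h : reindex e q = reindex e r) : q = r := by
  simpa [reindex_reindex] using congrArg (reindex e.symm) h

lemma tensorPair_tensorFamily_assoc {L : ι → Type} {M : κ → Type} {N : μ → Type} [Finite ι]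
    [Finite κ] [Finite μ] (q : (i : ι) → Diagram (L i)) (r : (j : κ) → Diagram (M j))
    (s : (k : μ) → Diagram (N k)) :
    reindex (Equiv.sumAssoc _ _ _)
        (tensorPair (tensorPair (tensorFamily q) (tensorFamily r)) (tensorFamily s)) =
      tensorPair (tensorFamily q) (tensorPair (tensorFamily r) (tensorFamily s)) := by
  rw [tensorPair_tensorFamily, tensorPair_tensorFamily, tensorPair_reindex_left,
    tensorPair_reindex_right, tensorPair_tensorFamily, tensorPair_tensorFamily]
  simp only [reindex_reindex]
  refine reindex_injective ((sumLegsEquiv L (Sum.elim M N)).trans (Equiv.sumCongr (Equiv.refl _)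
    (sumLegsEquiv M N))).symm ?_
  rw [reindex_reindex, reindex_reindex, Equiv.self_trans_symm, reindex_refl]
  refine reindex_tensorFamily (Equiv.sumAssoc ι κ μ).symm (fun
    | Sum.inl i => Equiv.refl (L i)
    | Sum.inr (Sum.inl j) => Equiv.refl (M j)
    | Sum.inr (Sum.inr k) => Equiv.refl (N k)) _ ?_ ?_
  · rintro (_ | _ | _) <;> exact (reindex_refl _).symm
  · rintro (_ | _ | _) _ <;> rfl

lemma tensorPair_assoc (q : Diagram A) (r : Diagram B) (s : Diagram C) :
    reindex (Equiv.sumAssoc A B C) (tensorPair (tensorPair q r) s) =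
      tensorPair q (tensorPair r s) := by
  have hassoc := tensorPair_tensorFamily_assoc (fun _ : Unit => q) (fun _ : Unit => r)
    (fun _ : Unit => s)
  simp only [tensorFamily_unit, tensorPair_reindex, reindex_reindex] at hassoc
  refine reindex_injective (Equiv.sumCongr (Equiv.uniqueSigma fun _ : Unit => A)
    (Equiv.sumCongr (Equiv.uniqueSigma fun _ : Unit => B)
      (Equiv.uniqueSigma fun _ : Unit => C))).symm ?_
  rw [reindex_reindex]
  refine Eq.trans ?_ (hassoc.trans ?_) <;> congr 1
  ext x : 1
  rcases x with (_ | _) | _ <;> rfl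

lemma tensorPair_comm (q : Diagram A) (r : Diagram B) :
    reindex (Equiv.sumComm A B) (tensorPair q r) = tensorPair r q := by
  rw [tensorPair, reindex_reindex]
  refine reindex_injective (pairLegsEquiv B A).symm ?_
  rw [tensorPair, reindex_reindex, reindex_reindex, Equiv.self_trans_symm, reindex_refl]
  refine reindex_tensorFamily Equiv.boolNot (fun
    | false => Equiv.refl B
    | true => Equiv.refl A) _ ?_ ?_
  · rintro (_ | _) <;> exact (reindex_refl _).symm
  · rintro (_ | _) _ <;> rfl

/-- The class of the empty diagram, the unit of `tensorPair`. -/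
noncomputable def emptyDiagram : Diagram Empty :=
  reindex (Equiv.equivEmpty _) (tensorFamily (ι := Empty) (L := fun _ => Empty) fun i => i.elim)

lemma tensorPair_emptyDiagram (q : Diagram A) :
    tensorPair q emptyDiagram = reindex (Equiv.sumEmpty A Empty).symm q := by
  let r : (i : Empty) → Diagram Empty := fun i => i.elim
  have hright := tensorPair_tensorFamily (fun _ : Unit => q) r
  rw [tensorFamily_unit, tensorPair_reindex_left] at hright
  let E : A ⊕ Empty ≃ Σ x : Unit ⊕ Empty, Sum.elim (fun _ => A) (fun _ => Empty) x :=
    (Equiv.sumCongr (Equiv.uniqueSigma fun _ : Unit => A).symm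
      (Equiv.equivEmpty (Σ _ : Empty, Empty)).symm).trans
      (sumLegsEquiv (fun _ : Unit => A) (fun _ : Empty => Empty)).symm
  have h' : reindex (((Equiv.uniqueSigma fun _ : Unit => A).trans
      (Equiv.sumEmpty A Empty).symm).trans E) (tensorFamily fun _ : Unit => q) =
        tensorFamily (sumFamily (fun _ : Unit => q) r) :=
    reindex_tensorFamily (Equiv.sumEmpty Unit Empty) (fun
      | Sum.inl _ => Equiv.refl A) _ (by rintro (_ | ⟨⟨⟩⟩); exact (reindex_refl _).symm)
      (by rintro (_ | ⟨⟨⟩⟩) _; rfl)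
  refine reindex_injective E ?_
  rw [emptyDiagram, tensorPair_reindex_right, reindex_reindex, reindex_reindex]
  rw [tensorFamily_unit, reindex_reindex] at h'
  refine Eq.trans ?_ (h'.symm.trans ?_)
  · refine reindex_injective (sumLegsEquiv (fun _ : Unit => A) (fun _ : Empty => Empty)) ?_
    rw [← hright, reindex_reindex]
    congr 1
    ext x : 1
    rcases x with _ | ⟨⟨⟩, _⟩
    rfl
  · congr 1

lemma tensorFamily_tensorPair {L M : ι → Type} [Finite ι] (q : (i : ι) → Diagram (L i))
    (r : (i : ι) → Diagram (M i)) :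
    tensorFamily (fun i => tensorPair (q i) (r i)) =
      reindex (Equiv.sigmaSumDistrib L M).symm (tensorPair (tensorFamily q) (tensorFamily r)) := by
  simp only [tensorPair]
  rw [tensorFamily_reindex, tensorFamily_tensorFamily]
  have hpair := tensorPair_tensorFamily q r
  rw [tensorPair] at hpair
  rw [hpair, reindex_reindex, reindex_reindex]
  refine reindex_injective ((sumLegsEquiv L M).trans (Equiv.sigmaSumDistrib L M).symm).symm ?_
  rw [reindex_reindex, reindex_reindex, Equiv.self_trans_symm, reindex_refl]
  refine reindex_tensorFamily ((Equiv.boolProdEquivSum ι).symm.trans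
    ((Equiv.prodComm _ _).trans (Equiv.sigmaEquivProd ι Bool).symm))
    (fun
    | Sum.inl i => Equiv.refl (L i)
    | Sum.inr j => Equiv.refl (M j)) _ ?_ ?_
  · rintro (_ | _) <;> exact (reindex_refl _).symm
  · rintro (_ | _) _ <;> rfl

end

/-! ### Families of white spiders -/

section
variable {A A' B B' C U V W ι κ μ : Type}

/-- White spiders indexed by `V` side by side, where the leg `p : P` belongs to the spider `g p`.
As a tensor it identifies the legs in the same fibre of `g`; spiders outside the range of `g` are
scalars. -/
noncomputable def whiteSpiders {P : Type} [Finite P] [Finite V] (g : P → V) : Diagram P :=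
  reindex (Equiv.sigmaFiberEquiv g) (tensorFamily fun v => ⟦Z {p // g p = v}⟧)

lemma reindex_Z {L K : Type} [Finite L] [Finite K] (g : L ≃ K) :
    reindex g (⟦Z L⟧ : Diagram L) = ⟦Z K⟧ := by
  rw [reindex_mk]; exact Quotient.sound (ZHEq.legsZ g)

lemma reindex_H {L K : Type} [Finite L] [Finite K] (a : ℂ) (g : L ≃ K) :
    reindex g (⟦H a L⟧ : Diagram L) = ⟦H a K⟧ := by
  rw [reindex_mk]; exact Quotient.sound (ZHEq.legsH a g)

end

section
variable {P P' Q V V' U A B W : Type} [Finite P] [Finite P'] [Finite V] [Finite V'] [Finite U]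
  [Finite Q] [Finite W]

lemma reindex_tensorFamily_Z {M : V' → Type} [∀ v, Finite (M v)] (g : P → V) (σ : V ≃ V')
    (E : (Σ v, M v) ≃ P) (h : ∀ v m, σ (g (E ⟨v, m⟩)) = v) :
    reindex E (tensorFamily fun v => (⟦Z (M v)⟧ : Diagram (M v))) = whiteSpiders g := by
  refine reindex_injective (Equiv.sigmaFiberEquiv g).symm ?_
  rw [whiteSpiders, reindex_reindex, reindex_reindex, Equiv.self_trans_symm, reindex_refl]
  refine reindex_tensorFamily σ (fun v =>
    { toFun := fun m => ⟨E ⟨σ v, m⟩, σ.injective (h _ m)⟩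
      invFun := fun p => cast (by
        have := h (E.symm p.1).1 (E.symm p.1).2
        rw [Sigma.eta, E.apply_symm_apply, p.2] at this
        rw [this]) (E.symm p.1).2
      left_inv := fun m => by
        apply eq_of_heq
        exact (cast_heq _ _).trans (Sigma.ext_iff.1 (E.symm_apply_apply ⟨σ v, m⟩)).2
      right_inv := fun p => by
        apply Subtype.ext
        have := h (E.symm p.1).1 (E.symm p.1).2
        rw [Sigma.eta, E.apply_symm_apply, p.2] at this
        apply E.symm.injective
        rw [Equiv.symm_apply_apply]
        refine Sigma.ext this (cast_heq _ _) }) _ (fun v => (reindex_Z _).symm) ?_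
  intro v m
  rw [Equiv.trans_apply, Equiv.symm_apply_eq]
  rfl

lemma reindex_whiteSpiders {g : P → V} {g' : P' → V} (τ : P ≃ P') (h : ∀ p, g' (τ p) = g p) :
    reindex τ (whiteSpiders g) = whiteSpiders g' := by
  rw [whiteSpiders, reindex_reindex]
  refine reindex_tensorFamily_Z g' (Equiv.refl _) _ ?_
  rintro v ⟨p, hp⟩
  exact (h p).trans hp

lemma whiteSpiders_equiv_comp (g : P → V) (σ : V ≃ V') :
    whiteSpiders (fun p => σ (g p)) = whiteSpiders g := by
  refine reindex_tensorFamily_Z g σ _ ?_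
  rintro v ⟨_, hp⟩
  exact hp

lemma tensorFamily_whiteSpiders {ι : Type} {P V : ι → Type} [Finite ι] [∀ i, Finite (P i)]
    [∀ i, Finite (V i)] (g : (i : ι) → P i → V i) :
    tensorFamily (fun i => whiteSpiders (g i)) =
      whiteSpiders (fun p : Σ i, P i => (⟨p.1, g p.1 p.2⟩ : Σ i, V i)) := by
  simp only [whiteSpiders]
  rw [tensorFamily_reindex, tensorFamily_tensorFamily, reindex_reindex]
  refine reindex_tensorFamily_Z (V := Σ i, V i) (V' := Σ i, V i)
    (fun p : Σ i, P i => (⟨p.1, g p.1 p.2⟩ : Σ i, V i)) (Equiv.refl _) _ ?_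
  rintro ⟨i, v⟩ ⟨p, hp⟩
  exact Sigma.ext rfl (heq_of_eq hp)

lemma tensorPair_whiteSpiders (g : P → V) (g' : P' → V') :
    tensorPair (whiteSpiders g) (whiteSpiders g') = whiteSpiders (Sum.map g g') := by
  let G : (t : Bool) → pairLegs P P' t → pairLegs V V' t := fun
    | false => g
    | true => g'
  have hpair : diagramPair (whiteSpiders g) (whiteSpiders g') = fun t => whiteSpiders (G t) := by
    funext t; cases t <;> rfl
  rw [tensorPair, hpair, tensorFamily_whiteSpiders,
    ← whiteSpiders_equiv_comp _ (pairLegsEquiv V V')]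
  refine reindex_whiteSpiders _ ?_
  rintro ⟨_ | _, p⟩ <;> rfl

lemma whiteSpiders_of_unique [Unique V] (g : P → V) : whiteSpiders g = ⟦Z P⟧ := by
  rw [← reindex_tensorFamily_Z (M := fun _ : Unit => P) g (Equiv.ofUnique V Unit)
    (Equiv.uniqueSigma fun _ : Unit => P) (fun _ _ => rfl), tensorFamily_unit, reindex_reindex,
    Equiv.symm_trans_self, reindex_refl]

lemma contract_whiteSpiders_of_fibers (f : V → V') (g : P ⊕ U × Bool → V)
    (hU : ∀ u, f (g (Sum.inr (u, true))) = f (g (Sum.inr (u, false))))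
    (hl : ∀ v', contract (Equiv.refl _) (whiteSpiders (P := {p // f (g (Sum.inl p)) = v'} ⊕
        {u // f (g (Sum.inr (u, false))) = v'} × Bool) (V := {v // f v = v'})
      (Sum.elim (fun p => ⟨g (Sum.inl p), p.2⟩)
        fun u => ⟨g (Sum.inr (u.1, u.2)), by
          obtain ⟨⟨u, hu⟩, _ | _⟩ := u
          · exact hu
          · exact (hU u).trans hu⟩)) = ⟦Z _⟧) :
    contract (Equiv.refl _) (whiteSpiders g) = whiteSpiders fun p => f (g (Sum.inl p)) := by
  conv_rhs => rw [whiteSpiders]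
  simp only [← hl]
  let F : (Σ v', {p // f (g (Sum.inl p)) = v'} ⊕ {u // f (g (Sum.inr (u, false))) = v'} × Bool) ≃
      (Σ v', {p // f (g (Sum.inl p)) = v'}) ⊕
        (Σ v', {u // f (g (Sum.inr (u, false))) = v'}) × Bool :=
    (Equiv.sigmaSumDistrib _ _).trans (Equiv.sumCongr (Equiv.refl _)
      (Equiv.sigmaProdDistrib _ _).symm)
  rw [tensorFamily_contract _ _ F, reindex_contract,
    tensorFamily_whiteSpiders, ← whiteSpiders_equiv_comp _ (Equiv.sigmaFiberEquiv f)]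
  · rw [← reindex_whiteSpiders (g := g) (F.trans (Equiv.sumCongr (Equiv.sigmaFiberEquiv _)
      (Equiv.prodCongr (Equiv.sigmaFiberEquiv _) (Equiv.refl _)))).symm, contract_reindex]
    · refine contract_congr _ (Equiv.sigmaFiberEquiv _).symm (fun _ => false) ?_
      rintro (p | ⟨u, _ | _⟩) <;> rfl
    · intro p
      obtain ⟨x, rfl⟩ := (F.trans (Equiv.sumCongr (Equiv.sigmaFiberEquiv _)
        (Equiv.prodCongr (Equiv.sigmaFiberEquiv _) (Equiv.refl _)))).surjective p
      rw [Equiv.symm_apply_apply]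
      obtain ⟨v', x | ⟨u, t⟩⟩ := x <;> rfl
  · rintro v' (p | ⟨u, t⟩) <;> rfl

lemma contract_whiteSpiders_bool [Nonempty W] (s : P → Bool) :
    contract (Equiv.refl _) (whiteSpiders (Sum.elim s fun p : W × Bool => p.2)) = ⟦Z P⟧ := by
  have hrule := Quotient.sound (s := diagramSetoid P) (ZHEq.rule (Rule.ZS1 (W := W) s))
  rw [← hrule, graph, ← network_mk, network_eq_contract, whiteSpiders, contract_reindex]
  have : (Sum.elim s fun p : W × Bool => p.2) =
      Sum.elim s fun p : W × Bool => bif p.2 then true else false := by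
    funext x; rcases x with _ | ⟨_, _ | _⟩ <;> rfl
  rw [this]
  rfl

lemma contract_whiteSpiders_of_equiv_bool [Nonempty W] (σ : V ≃ Bool) (g : P ⊕ W × Bool → V)
    (hg : ∀ w t, σ (g (Sum.inr (w, t))) = t) :
    contract (Equiv.refl _) (whiteSpiders g) = ⟦Z P⟧ := by
  rw [← whiteSpiders_equiv_comp g σ,
    ← contract_whiteSpiders_bool (W := W) fun p => σ (g (Sum.inl p))]
  congr 2
  funext x
  rcases x with p | ⟨w, t⟩
  · rfl
  · exact hg w t

lemma contract_whiteSpiders_of_isEmpty [IsEmpty W] [Unique V] (g : P ⊕ W × Bool → V) :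
    contract (Equiv.refl _) (whiteSpiders g) = ⟦Z P⟧ := by
  rw [whiteSpiders_of_unique, ← reindex_Z (Equiv.sumEmpty P (W × Bool)), reindex]
  refine contract_congr _ (Equiv.equivEmpty _) (fun _ => false) ?_
  rintro (p | ⟨w, _⟩)
  · rfl
  · exact isEmptyElim w

lemma contract_whiteSpiders_option (c : V') (g : P ⊕ Unit × Bool → Option V')
    (hfalse : g (Sum.inr ((), false)) = none) (htrue : g (Sum.inr ((), true)) = some c) :
    contract (Equiv.refl _) (whiteSpiders g) = whiteSpiders fun p => (g (Sum.inl p)).getD c := by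
  refine contract_whiteSpiders_of_fibers (fun x => x.getD c) g
    (by rintro ⟨⟩; simp [hfalse, htrue]) ?_
  intro v'
  by_cases hv : v' = c
  · subst hv
    let σ : {v : Option V' // v.getD v' = v'} ≃ Bool :=
      { toFun := fun v => v.1.isSome
        invFun := fun t => if t then ⟨some v', rfl⟩ else ⟨none, rfl⟩
        left_inv := by
          rintro ⟨_ | v, hv⟩
          · rfl
          · obtain rfl : v = v' := hv
            rfl
        right_inv := by rintro (_ | _) <;> rfl }
    have : Nonempty {u : Unit // (g (Sum.inr (u, false))).getD v' = v'} := ⟨⟨(), by simp [hfalse]⟩⟩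
    refine contract_whiteSpiders_of_equiv_bool σ _ ?_
    rintro ⟨⟨⟩, _⟩ (_ | _)
    · simp [σ, hfalse]
    · simp [σ, htrue]
  · have : IsEmpty {u : Unit // (g (Sum.inr (u, false))).getD c = v'} :=
      ⟨fun u => hv (by simpa [hfalse] using u.2.symm)⟩
    let _ : Unique {v : Option V' // v.getD c = v'} :=
      { default := ⟨some v', rfl⟩
        uniq := by
          rintro ⟨_ | v, h⟩
          · exact absurd h.symm hv
          · exact Subtype.ext (congrArg some h) }
    exact contract_whiteSpiders_of_isEmpty _

/-- Each of the white spiders `U` is joined by one wire to one of the white spiders `V`, and can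
be fused into it. As a predicate on `U`, this is proved by induction on the finite type. -/
def StarFusion (U V : Type) [Finite U] [Finite V] : Prop :=
  ∀ {P : Type} [Finite P] (h : U → V) (g : P ⊕ U × Bool → V ⊕ U),
    (∀ u, g (Sum.inr (u, false)) = Sum.inr u) → (∀ u, g (Sum.inr (u, true)) = Sum.inl (h u)) →
    contract (Equiv.refl _) (whiteSpiders g) = whiteSpiders fun p => Sum.elim id h (g (Sum.inl p))

lemma StarFusion.congr {U' : Type} [Finite U'] (k : U ≃ U') (hU : StarFusion U V) :
    StarFusion U' V := by
  intro P _ h g hfalse htrue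
  have := hU (fun u => h (k u)) (fun x => Sum.map id k.symm (g (Sum.map id (Prod.map k id) x)))
    (by simp [hfalse]) (by simp [htrue])
  simp only [Sum.map_inl, id] at this
  have hg : (fun p => Sum.elim id h (g (Sum.inl p))) =
      fun p => Sum.elim id (fun u => h (k u)) (Sum.map id k.symm (g (Sum.inl p))) := by
    funext p
    rcases g (Sum.inl p) with x | x <;> simp
  rw [hg, ← this, ← whiteSpiders_equiv_comp g (Equiv.sumCongr (Equiv.refl _) k.symm),
    ← reindex_whiteSpiders (Equiv.sumCongr (Equiv.refl P) (Equiv.prodCongr k (Equiv.refl Bool)))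
      (fun _ => rfl), contract_reindex]
  refine contract_congr _ k.symm (fun _ => false) ?_
  rintro (p | ⟨u, t⟩) <;> simp [rewire]

lemma StarFusion.pempty : StarFusion PEmpty V := by
  intro P _ h g _ _
  have hg : g = fun p => Sum.inl (Sum.elim id h (g p)) := by
    funext p
    rcases g p with x | ⟨⟨⟩⟩
    rfl
  rw [← whiteSpiders_equiv_comp (fun p => Sum.elim id h (g (Sum.inl p)))
      (Equiv.sumEmpty V PEmpty).symm,
    ← reindex_whiteSpiders (g := g) (Equiv.sumEmpty P (PEmpty × Bool)), reindex]
  · refine contract_congr _ (Equiv.equivEmpty PEmpty) (fun _ => false) ?_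
    rintro (x | ⟨⟨⟩, _⟩)
    rfl
  · rintro (x | ⟨⟨⟩, _⟩)
    conv_rhs => rw [hg]
    rfl

lemma StarFusion.option (hU : StarFusion U V) : StarFusion (Option U) V := by
  intro P _ h g hfalse htrue
  let σ : V ⊕ Option U ≃ Option (V ⊕ U) :=
    { toFun := Sum.elim (fun v => some (Sum.inl v)) fun u => u.map Sum.inr
      invFun := fun x => x.elim (Sum.inr none) (Sum.map id some)
      left_inv := by rintro (_ | _ | _) <;> rfl
      right_inv := by rintro (_ | _ | _) <;> rfl }
  let E : P ⊕ Option U × Bool ≃ (P ⊕ U × Bool) ⊕ Unit × Bool :=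
    { toFun := fun
        | Sum.inl p => Sum.inl (Sum.inl p)
        | Sum.inr (some u, t) => Sum.inl (Sum.inr (u, t))
        | Sum.inr (none, t) => Sum.inr ((), t)
      invFun := fun
        | Sum.inl (Sum.inl p) => Sum.inl p
        | Sum.inl (Sum.inr (u, t)) => Sum.inr (some u, t)
        | Sum.inr ((), t) => Sum.inr (none, t)
      left_inv := by rintro (_ | ⟨_ | _, _⟩) <;> rfl
      right_inv := by rintro ((_ | _) | _) <;> rfl }
  have hone := contract_whiteSpiders_option (Sum.inl (h none)) (fun x => σ (g (E.symm x)))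
    (by simp [E, hfalse, σ]) (by simp [E, htrue, σ])
  have hrest := hU (fun u => h (some u))
    (fun x => (σ (g (E.symm (Sum.inl x)))).getD (Sum.inl (h none)))
    (by simp [E, hfalse, σ]) (by simp [E, htrue, σ])
  have hg : (fun p => Sum.elim id h (g (Sum.inl p))) = fun p => Sum.elim id (fun u => h (some u))
      ((σ (g (E.symm (Sum.inl (Sum.inl p))))).getD (Sum.inl (h none))) := by
    funext p
    change _ = Sum.elim id (fun u => h (some u)) ((σ (g (Sum.inl p))).getD (Sum.inl (h none)))
    rcases g (Sum.inl p) with x | _ | x <;> rfl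
  rw [hg, ← hrest, ← hone, whiteSpiders_equiv_comp,
    ← reindex_whiteSpiders (g := g) E (by simp), contract_reindex, contract_contract]
  refine contract_congr _ (Equiv.optionEquivSumPUnit U) (fun _ => false) ?_
  rintro (p | ⟨_ | u, _ | _⟩) <;> rfl

lemma starFusion (U V : Type) [Finite U] [Finite V] : StarFusion U V :=
  Finite.induction_empty_option (P := fun U => ∀ [Finite U], StarFusion U V)
    (fun {U₁ _} k ih _ => have : Finite U₁ := Finite.of_equiv _ k.symm; ih.congr k)
    StarFusion.pempty (fun ih _ => ih.option) U

end

/-! ### Contractions of a diagram with white spiders -/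

/-- The diagram `r` next to the white spiders `whiteSpiders g`, with some of the ends joined by
wires. -/
noncomputable def contractSpiders {A P V B W : Type} [Finite P] [Finite V] [Finite W]
    (r : Diagram A) (g : P → V) (e : A ⊕ P ≃ B ⊕ W × Bool) : Diagram B :=
  contract e (tensorPair r (whiteSpiders g))

section
variable {A A' B C P P' V V' U W W' : Type} [Finite P] [Finite P'] [Finite V] [Finite V']
  [Finite U] [Finite W] [Finite W']

lemma contractSpiders_congr {r : Diagram A} {g : P → V} {g' : P' → V'} {e : A ⊕ P ≃ B ⊕ W × Bool}
    {e' : A ⊕ P' ≃ B ⊕ W' × Bool} (τ : P ≃ P') (σ : V ≃ V') (ω : W ≃ W') (s : W → Bool)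
    (hg : ∀ p, g' (τ p) = σ (g p))
    (he : ∀ x, e' (Sum.map id τ x) = Sum.map id (rewire ω s) (e x)) :
    contractSpiders r g e = contractSpiders r g' e' := by
  rw [contractSpiders, contractSpiders, ← reindex_whiteSpiders τ hg, whiteSpiders_equiv_comp,
    tensorPair_reindex_right, contract_reindex]
  exact contract_congr _ ω s he

lemma reindex_contractSpiders (r : Diagram A) (g : P → V) (e : A ⊕ P ≃ B ⊕ W × Bool) (k : B ≃ C) :
    reindex k (contractSpiders r g e) =
      contractSpiders r g (e.trans (Equiv.sumCongr k (Equiv.refl _))) :=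
  reindex_contract _ _ _

lemma contractSpiders_reindex (k : A ≃ A') (r : Diagram A) (g : P → V) (e : A' ⊕ P ≃ B ⊕ W × Bool) :
    contractSpiders (reindex k r) g e =
      contractSpiders r g ((Equiv.sumCongr k (Equiv.refl P)).trans e) := by
  rw [contractSpiders, contractSpiders, tensorPair_reindex_left, contract_reindex]

lemma contract_contractSpiders (r : Diagram A) (g : P → V) (e : A ⊕ P ≃ B ⊕ W × Bool)
    (e' : B ≃ C ⊕ W' × Bool) :
    contract e' (contractSpiders r g e) = contractSpiders r g (e.trans (addWiresEquiv W e')) :=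
  contract_contract _ _ _

lemma contractSpiders_tensorPair_whiteSpiders (r : Diagram A) (k : P' → V') (g : P → V)
    (e : (A ⊕ P') ⊕ P ≃ B ⊕ W × Bool) :
    contractSpiders (tensorPair r (whiteSpiders k)) g e =
      contractSpiders r (Sum.map k g) ((Equiv.sumAssoc A P' P).symm.trans e) := by
  rw [contractSpiders, contractSpiders, ← tensorPair_whiteSpiders, ← tensorPair_assoc,
    contract_reindex]
  congr 1
  ext x : 1
  simp

lemma contractSpiders_contractSpiders (r : Diagram A) (g : P → V) (e : A ⊕ P ≃ B ⊕ W × Bool)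
    (g' : P' → V') (e' : B ⊕ P' ≃ C ⊕ W' × Bool) :
    contractSpiders (contractSpiders r g e) g' e' =
      contractSpiders r (Sum.map g g') ((Equiv.sumAssoc A P P').symm.trans
        (((Equiv.sumCongr e (Equiv.refl P')).trans
        ((Equiv.sumAssoc _ _ _).trans ((Equiv.sumCongr (Equiv.refl _) (Equiv.sumComm _ _)).trans
        (Equiv.sumAssoc _ _ _).symm))).trans (addWiresEquiv W e'))) := by
  rw [contractSpiders, contractSpiders, tensorPair_contract_left, contract_contract,
    contractSpiders, ← tensorPair_whiteSpiders, ← tensorPair_assoc, contract_reindex]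
  congr 1
  ext x : 1
  simp

lemma contractSpiders_star {Q Vb Wb : Type} [Finite Q] [Finite Vb] [Finite Wb] {r : Diagram A}
    {G : Q → Vb} {E : A ⊕ Q ≃ B ⊕ Wb × Bool} {G' : P → V'} {e : A ⊕ P ≃ B ⊕ W × Bool}
    (τ : Q ≃ P ⊕ U × Bool) (σ : Vb ≃ V' ⊕ U) (ω : Wb ≃ W ⊕ U) (s : Wb → Bool) (h : U → V')
    (hfalse : ∀ u, σ (G (τ.symm (Sum.inr (u, false)))) = Sum.inr u)
    (htrue : ∀ u, σ (G (τ.symm (Sum.inr (u, true)))) = Sum.inl (h u))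
    (hG : ∀ p, G' p = Sum.elim id h (σ (G (τ.symm (Sum.inl p)))))
    (he : ∀ x, addWiresEquiv U e ((Equiv.sumAssoc A P (U × Bool)).symm (Sum.map id τ x)) =
    Sum.map id (rewire ω s) (E x)) : contractSpiders r G E = contractSpiders r G' e := by
  have hcongr : contractSpiders r G E = contractSpiders r (fun x => σ (G (τ.symm x)))
      ((Equiv.sumAssoc A P (U × Bool)).symm.trans (addWiresEquiv U e)) :=
    contractSpiders_congr τ σ ω s (by simp) he
  rw [hcongr, show G' = _ from funext hG, contractSpiders, contractSpiders,
    ← starFusion _ _ h (fun x => σ (G (τ.symm x))) hfalse htrue, tensorPair_contract_right,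
      contract_contract]
  congr 1
  ext x : 1
  simp

lemma contract_whiteSpiders_congr_star {Q Vb Wb : Type} [Finite Q] [Finite Vb] [Finite Wb]
    {G : Q → Vb} {E : Q ≃ B ⊕ Wb × Bool} {G' : P → V'} {e : P ≃ B ⊕ W × Bool} (τ : Q ≃ P ⊕ U × Bool)
    (σ : Vb ≃ V' ⊕ U) (ω : Wb ≃ W ⊕ U) (s : Wb → Bool) (h : U → V')
    (hfalse : ∀ u, σ (G (τ.symm (Sum.inr (u, false)))) = Sum.inr u)
    (htrue : ∀ u, σ (G (τ.symm (Sum.inr (u, true)))) = Sum.inl (h u))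
    (hG : ∀ p, G' p = Sum.elim id h (σ (G (τ.symm (Sum.inl p)))))
    (he : ∀ x, addWiresEquiv U e (τ x) = Sum.map id (rewire ω s) (E x)) :
    contract E (whiteSpiders G) = contract e (whiteSpiders G') := by
  rw [show G' = _ from funext hG, ← starFusion _ _ h (fun x => σ (G (τ.symm x))) hfalse htrue,
    contract_contract,
    ← whiteSpiders_equiv_comp G σ, ← reindex_whiteSpiders (g := fun p => σ (G p)) τ (by simp),
      contract_reindex]
  exact contract_congr _ ω s he

/-- The wiring of `alongCospan`: each leg `a : A` of the diagram is joined by a wire to the leg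
`a` of the white spiders, whose legs `B` stay open. -/
def cospanWiring (A B : Type) : A ⊕ (B ⊕ A) ≃ B ⊕ A × Bool where
  toFun := fun
    | Sum.inl a => Sum.inr (a, false)
    | Sum.inr (Sum.inl b) => Sum.inl b
    | Sum.inr (Sum.inr a) => Sum.inr (a, true)
  invFun := fun
    | Sum.inr (a, false) => Sum.inl a
    | Sum.inl b => Sum.inr (Sum.inl b)
    | Sum.inr (a, true) => Sum.inr (Sum.inr a)
  left_inv := by rintro (_ | _ | _) <;> rfl
  right_inv := by rintro (_ | ⟨_, _ | _⟩) <;> rfl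

/-- The action of the cospan `att : A → X ← B : bd` on diagrams: there is a white spider for each
`x : X`, the leg `a` of `r` is attached to the spider `att a`, and the open end `b` to the spider
`bd b`. Renaming, identifying and summing over variables are special cases. -/
noncomputable def alongCospan {A B X : Type} [Finite A] [Finite B] [Finite X] (bd : B → X)
    (att : A → X) (r : Diagram A) : Diagram B :=
  contractSpiders r (Sum.elim bd att) (cospanWiring A B)

end

section
variable {A A' B B' K X X' : Type} [Finite A] [Finite A'] [Finite B] [Finite B'] [Finite K]
  [Finite X] [Finite X']

lemma alongCospan_equiv_comp (σ : X ≃ X') (bd : B → X) (att : A → X) (r : Diagram A) :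
    alongCospan (fun b => σ (bd b)) (fun a => σ (att a)) r = alongCospan bd att r :=
  (contractSpiders_congr (Equiv.refl _) σ (Equiv.refl _) (fun _ => false)
    (by rintro (_ | _) <;> rfl) (by rintro (_ | _ | _) <;> rfl)).symm

lemma alongCospan_reindex (k : A ≃ A') (bd : B → X) (att : A' → X) (r : Diagram A) :
    alongCospan bd att (reindex k r) = alongCospan bd (fun a => att (k a)) r := by
  rw [alongCospan, contractSpiders_reindex]
  exact contractSpiders_congr (Equiv.sumCongr (Equiv.refl _) k.symm) (Equiv.refl _) k.symm
    (fun _ => false)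
    (by rintro (_ | _) <;> simp) (by rintro (_ | _ | _) <;> simp [rewire, cospanWiring])

lemma reindex_alongCospan (k : B ≃ B') (bd : B → X) (att : A → X) (r : Diagram A) :
    reindex k (alongCospan bd att r) = alongCospan (fun b => bd (k.symm b)) att r := by
  rw [alongCospan, reindex_contractSpiders]
  exact contractSpiders_congr (Equiv.sumCongr k (Equiv.refl _)) (Equiv.refl _) (Equiv.refl _)
    (fun _ => false)
    (by rintro (_ | _) <;> simp) (by rintro (_ | _ | _) <;> simp [rewire, cospanWiring])

lemma alongCospan_alongCospan_inl (bd : B → X) (att : A → X) (att' : A' → A ⊕ K) (r : Diagram A') :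
    alongCospan bd att (alongCospan Sum.inl att' r) =
      alongCospan (fun b => (Sum.inl (bd b) : X ⊕ K)) (fun a => Sum.map att id (att' a)) r := by
  rw [alongCospan, alongCospan, contractSpiders_contractSpiders]
  let τ : (A ⊕ A') ⊕ (B ⊕ A) ≃ (B ⊕ A') ⊕ A × Bool :=
    { toFun := fun
        | Sum.inl (Sum.inl a) => Sum.inr (a, false)
        | Sum.inl (Sum.inr a) => Sum.inl (Sum.inr a)
        | Sum.inr (Sum.inl b) => Sum.inl (Sum.inl b)
        | Sum.inr (Sum.inr a) => Sum.inr (a, true)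
      invFun := fun
        | Sum.inr (a, false) => Sum.inl (Sum.inl a)
        | Sum.inl (Sum.inr a) => Sum.inl (Sum.inr a)
        | Sum.inl (Sum.inl b) => Sum.inr (Sum.inl b)
        | Sum.inr (a, true) => Sum.inr (Sum.inr a)
      left_inv := by rintro ((_ | _) | (_ | _)) <;> rfl
      right_inv := by rintro ((_ | _) | ⟨_, _ | _⟩) <;> rfl }
  let σ : (A ⊕ K) ⊕ X ≃ (X ⊕ K) ⊕ A :=
    { toFun := fun
        | Sum.inl (Sum.inl a) => Sum.inr a
        | Sum.inl (Sum.inr k) => Sum.inl (Sum.inr k)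
        | Sum.inr x => Sum.inl (Sum.inl x)
      invFun := fun
        | Sum.inr a => Sum.inl (Sum.inl a)
        | Sum.inl (Sum.inr k) => Sum.inl (Sum.inr k)
        | Sum.inl (Sum.inl x) => Sum.inr x
      left_inv := by rintro ((_ | _) | _) <;> rfl
      right_inv := by rintro ((_ | _) | _) <;> rfl }
  refine contractSpiders_star τ σ (Equiv.sumComm A A') (fun _ => false) (fun a => Sum.inl (att a))
    (fun _ => rfl) (fun _ => rfl) ?_ ?_
  · rintro (b | a)
    · rfl
    · change Sum.map att id (att' a) = Sum.elim id _ (σ (Sum.inl (att' a)))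
      rcases att' a with x | x <;> rfl
  · rintro (_ | (_ | _) | (_ | _)) <;> rfl

lemma alongCospan_id_alongCospan (bd : B → A) (bd' : A → X) (att' : A' → X) (r : Diagram A') :
    alongCospan bd id (alongCospan bd' att' r) = alongCospan (fun b => bd' (bd b)) att' r := by
  rw [alongCospan, alongCospan, contractSpiders_contractSpiders]
  let τ : (A ⊕ A') ⊕ (B ⊕ A) ≃ (B ⊕ A') ⊕ A × Bool :=
    { toFun := fun
        | Sum.inl (Sum.inl a) => Sum.inr (a, true)
        | Sum.inl (Sum.inr a) => Sum.inl (Sum.inr a)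
        | Sum.inr (Sum.inl b) => Sum.inl (Sum.inl b)
        | Sum.inr (Sum.inr a) => Sum.inr (a, false)
      invFun := fun
        | Sum.inr (a, true) => Sum.inl (Sum.inl a)
        | Sum.inl (Sum.inr a) => Sum.inl (Sum.inr a)
        | Sum.inl (Sum.inl b) => Sum.inr (Sum.inl b)
        | Sum.inr (a, false) => Sum.inr (Sum.inr a)
      left_inv := by rintro ((_ | _) | (_ | _)) <;> rfl
      right_inv := by rintro ((_ | _) | ⟨_, _ | _⟩) <;> rfl }
  refine contractSpiders_star τ (Equiv.refl _) (Equiv.sumComm A A')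
    (Sum.elim (fun _ => true) fun _ => false) bd'
    (fun _ => rfl) (fun _ => rfl) ?_ ?_
  · rintro (b | a) <;> rfl
  · rintro (_ | (_ | _) | (_ | _)) <;> rfl

lemma alongCospan_tensorPair_whiteSpiders (k : A → X) (q : Diagram A) :
    alongCospan id (Sum.elim id id) (tensorPair q (whiteSpiders k)) = alongCospan k k q := by
  rw [alongCospan, contractSpiders_tensorPair_whiteSpiders]
  let τ : A ⊕ (A ⊕ (A ⊕ A)) ≃ (A ⊕ A) ⊕ A × Bool :=
    { toFun := fun
        | Sum.inl a => Sum.inr (a, true)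
        | Sum.inr (Sum.inl a) => Sum.inl (Sum.inl a)
        | Sum.inr (Sum.inr (Sum.inl a)) => Sum.inl (Sum.inr a)
        | Sum.inr (Sum.inr (Sum.inr a)) => Sum.inr (a, false)
      invFun := fun
        | Sum.inr (a, true) => Sum.inl a
        | Sum.inl (Sum.inl a) => Sum.inr (Sum.inl a)
        | Sum.inl (Sum.inr a) => Sum.inr (Sum.inr (Sum.inl a))
        | Sum.inr (a, false) => Sum.inr (Sum.inr (Sum.inr a))
      left_inv := by rintro (_ | _ | _ | _) <;> rfl
      right_inv := by rintro ((_ | _) | ⟨_, _ | _⟩) <;> rfl }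
  refine contractSpiders_star τ (Equiv.refl _) (Equiv.refl _)
    (Sum.elim (fun _ => false) fun _ => true) k (fun _ => rfl) (fun _ => rfl) ?_ ?_
  · rintro (b | a) <;> rfl
  · rintro (_ | _ | _ | _ | _) <;> rfl

lemma whiteSpiders_unit :
    (whiteSpiders (fun _ : Unit ⊕ Unit => ()) : Diagram (Unit ⊕ Unit)) = ⟦idWire⟧ := by
  have hstrand : (⟦Z Bool⟧ : Diagram Bool) = ⟦strand⟧ := Quotient.sound (ZHEq.rule Rule.ZS2)
  rw [idWire, ← reindex_mk, ← hstrand, reindex_Z, whiteSpiders_of_unique]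

lemma whiteSpiders_empty (g : Empty → Empty) : whiteSpiders g = emptyDiagram := by
  have hfamily : (fun i : Empty => (i.elim : Diagram Empty)) = fun _ => ⟦Z Empty⟧ := funext fun i =>
    i.elim
  rw [emptyDiagram, hfamily]
  exact (reindex_tensorFamily_Z (M := fun _ => Empty) g (Equiv.refl _) _ fun v => v.elim).symm

/-- The wiring that prolongs the open ends `C` of a diagram with open ends `B ⊕ C` by binary
white spiders. -/
def wiresWiring (B C : Type) : (B ⊕ C) ⊕ (C ⊕ C) ≃ (B ⊕ C) ⊕ C × Bool where
  toFun := fun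
    | Sum.inl (Sum.inl b) => Sum.inl (Sum.inl b)
    | Sum.inl (Sum.inr c) => Sum.inr (c, false)
    | Sum.inr (Sum.inl c) => Sum.inr (c, true)
    | Sum.inr (Sum.inr c) => Sum.inl (Sum.inr c)
  invFun := fun
    | Sum.inl (Sum.inl b) => Sum.inl (Sum.inl b)
    | Sum.inr (c, false) => Sum.inl (Sum.inr c)
    | Sum.inr (c, true) => Sum.inr (Sum.inl c)
    | Sum.inl (Sum.inr c) => Sum.inr (Sum.inr c)
  left_inv := by rintro ((_ | _) | (_ | _)) <;> rfl
  right_inv := by rintro ((_ | _) | ⟨_, _ | _⟩) <;> rfl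

lemma contractSpiders_wire {B : Type} (q : Diagram (B ⊕ Unit)) :
    contractSpiders q (Sum.elim id id) (wiresWiring B Unit) = q := by
  induction q using Quotient.inductionOn with
  | h D =>
    have hyank := Quotient.sound (s := diagramSetoid _) (ZHEq.yank D)
    conv_rhs => rw [← hyank, stack, ← network_mk, ← diagramPair_mk,
      network_eq_contract, ← whiteSpiders_unit]
    rw [contractSpiders, tensorPair, contract_reindex]
    have : (Sum.elim id id : Unit ⊕ Unit → Unit) = fun _ => () := rfl
    rw [this]
    refine contract_congr _ (Equiv.refl _) (fun _ => false) ?_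
    rintro ⟨_ | _, _ | _⟩ <;> rfl

lemma whiteSpiders_pempty :
    whiteSpiders (Sum.elim id id : PEmpty ⊕ PEmpty → PEmpty) =
      reindex (Equiv.equivEmpty (PEmpty ⊕ PEmpty)).symm emptyDiagram := by
  rw [← whiteSpiders_empty id, reindex_whiteSpiders
    (g' := fun x => (Equiv.equivEmpty PEmpty) ((Sum.elim id id : PEmpty ⊕ PEmpty → PEmpty) x))
    (Equiv.equivEmpty (PEmpty ⊕ PEmpty)).symm (fun x => x.elim), whiteSpiders_equiv_comp]

lemma contractSpiders_wires_equiv {B C C' : Type} [Finite C] [Finite C'] (k : C ≃ C')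
    (q : Diagram (B ⊕ C'))
    (ih : ∀ r : Diagram (B ⊕ C), contractSpiders r (Sum.elim id id) (wiresWiring B C) = r) :
    contractSpiders q (Sum.elim id id) (wiresWiring B C') = q := by
  have hmoved := ih (reindex (Equiv.sumCongr (Equiv.refl B) k.symm) q)
  rw [contractSpiders_reindex] at hmoved
  apply reindex_injective (Equiv.sumCongr (Equiv.refl B) k.symm)
  refine Eq.trans ?_ hmoved
  rw [reindex_contractSpiders]
  refine contractSpiders_congr (Equiv.sumCongr k.symm k.symm) k.symm k.symm (fun _ => false) ?_ ?_
  · rintro (_ | _) <;> rfl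
  · rintro ((_ | _) | (_ | _)) <;> simp [rewire, wiresWiring]

lemma contractSpiders_wires_pempty {B : Type} (q : Diagram (B ⊕ PEmpty)) :
    contractSpiders q (Sum.elim id id) (wiresWiring B PEmpty) = q := by
  rw [contractSpiders, whiteSpiders_pempty, tensorPair_reindex_right, tensorPair_emptyDiagram,
    reindex_reindex, contract_reindex]
  conv_rhs => rw [← reindex_refl q]
  refine contract_congr _ (Equiv.equivEmpty PEmpty) (fun _ => false) ?_
  rintro (x | ⟨⟨⟩⟩)
  rfl

lemma contractSpiders_wires_option {B C : Type} [Finite C] (q : Diagram (B ⊕ Option C))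
    (ih : ∀ r : Diagram ((B ⊕ Unit) ⊕ C),
      contractSpiders r (Sum.elim id id) (wiresWiring (B ⊕ Unit) C) = r) :
    contractSpiders q (Sum.elim id id) (wiresWiring B (Option C)) = q := by
  let k : B ⊕ Option C ≃ (B ⊕ C) ⊕ Unit :=
    (Equiv.sumCongr (Equiv.refl B) (Equiv.optionEquivSumPUnit C)).trans (Equiv.sumAssoc _ _ _).symm
  let k' : (B ⊕ C) ⊕ Unit ≃ (B ⊕ Unit) ⊕ C :=
    (Equiv.sumAssoc _ _ _).trans ((Equiv.sumCongr (Equiv.refl _) (Equiv.sumComm _ _)).trans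
      (Equiv.sumAssoc _ _ _).symm)
  have htwoSteps : contractSpiders (reindex k'
        (contractSpiders (reindex k q) (Sum.elim id id) (wiresWiring (B ⊕ C) Unit)))
      (Sum.elim id id) (wiresWiring (B ⊕ Unit) C) = reindex k' (reindex k q) := by
    rw [contractSpiders_wire, ih]
  apply reindex_injective (k.trans k')
  rw [← reindex_reindex k k' q, ← htwoSteps, reindex_contractSpiders, reindex_contractSpiders,
    contractSpiders_contractSpiders, contractSpiders_reindex]
  let τ : Option C ⊕ Option C ≃ (Unit ⊕ Unit) ⊕ (C ⊕ C) :=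
    { toFun := fun
        | Sum.inl none => Sum.inl (Sum.inl ())
        | Sum.inr none => Sum.inl (Sum.inr ())
        | Sum.inl (some c) => Sum.inr (Sum.inl c)
        | Sum.inr (some c) => Sum.inr (Sum.inr c)
      invFun := fun
        | Sum.inl (Sum.inl ()) => Sum.inl none
        | Sum.inl (Sum.inr ()) => Sum.inr none
        | Sum.inr (Sum.inl c) => Sum.inl (some c)
        | Sum.inr (Sum.inr c) => Sum.inr (some c)
      left_inv := by rintro ((_ | _) | (_ | _)) <;> rfl
      right_inv := by rintro ((_ | _) | (_ | _)) <;> rfl }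
  refine contractSpiders_congr τ ((Equiv.optionEquivSumPUnit C).trans (Equiv.sumComm _ _))
    (Equiv.optionEquivSumPUnit C) (fun _ => false) ?_ ?_
  · rintro ((_ | _) | (_ | _)) <;> rfl
  · rintro ((_ | _ | _) | ((_ | _) | (_ | _))) <;> rfl

lemma contractSpiders_wires {B : Type} (C : Type) [Finite C] (q : Diagram (B ⊕ C)) :
    contractSpiders q (Sum.elim id id) (wiresWiring B C) = q := by
  revert B
  refine Finite.induction_empty_option (P := fun C => ∀ [Finite C] {B : Type}
    (q : Diagram (B ⊕ C)), contractSpiders q (Sum.elim id id) (wiresWiring B C) = q)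
    ?_ (fun q => contractSpiders_wires_pempty q)
    (fun ih _ _ q => contractSpiders_wires_option q ih) C
  intro C₁ C₂ k ih _ B q
  have : Finite C₁ := Finite.of_equiv _ k.symm
  exact contractSpiders_wires_equiv k q ih

lemma alongCospan_id_id (q : Diagram A) : alongCospan id id q = q := by
  have hwires := contractSpiders_wires A (reindex (Equiv.emptySum Empty A).symm q)
  rw [contractSpiders_reindex] at hwires
  apply reindex_injective (Equiv.emptySum Empty A).symm
  rw [← hwires, alongCospan, reindex_contractSpiders]
  exact contractSpiders_congr (Equiv.sumComm A A) (Equiv.refl A) (Equiv.refl A) (fun _ => false)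
    (by rintro (_ | _) <;> rfl) (by rintro (_ | _ | _) <;> rfl)

lemma contract_eq_alongCospan (e : A ≃ B ⊕ K × Bool) (q : Diagram A) :
    contract e q = alongCospan (Sum.inl : B → B ⊕ K) (fun a => Sum.map id Prod.fst (e a)) q := by
  conv_lhs => rw [← alongCospan_id_id q]
  rw [alongCospan, contract_contractSpiders]
  let τ : A ⊕ A ≃ (B ⊕ A) ⊕ K × Bool :=
    (Equiv.sumCongr e (Equiv.refl A)).trans ((Equiv.sumAssoc _ _ _).trans
      ((Equiv.sumCongr (Equiv.refl _) (Equiv.sumComm _ _)).trans (Equiv.sumAssoc _ _ _).symm))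
  let σ : B ⊕ K × Bool ≃ (B ⊕ K) ⊕ K :=
    { toFun := fun
        | Sum.inl b => Sum.inl (Sum.inl b)
        | Sum.inr (k, false) => Sum.inr k
        | Sum.inr (k, true) => Sum.inl (Sum.inr k)
      invFun := fun
        | Sum.inl (Sum.inl b) => Sum.inl b
        | Sum.inr k => Sum.inr (k, false)
        | Sum.inl (Sum.inr k) => Sum.inr (k, true)
      left_inv := by rintro (_ | ⟨_, _ | _⟩) <;> rfl
      right_inv := by rintro ((_ | _) | _) <;> rfl }
  refine contractSpiders_star τ (e.trans σ) (Equiv.sumComm K A) (fun _ => false) Sum.inr ?_ ?_ ?_ ?_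
  · intro u; simp [τ, σ]
  · intro u; simp [τ, σ]
  · rintro (b | a)
    · simp [τ, σ]
    · change Sum.map id Prod.fst (e a) = Sum.elim id _ (σ (e a))
      rcases e a with b | ⟨k, _ | _⟩ <;> rfl
  · rintro (a | a | a)
    · rfl
    · rcases h : e a with b | ⟨k, t⟩ <;> simp [τ, cospanWiring, rewire, h, addWires,
        addWiresEquiv_apply]
    · rfl

lemma tensorFamily_alongCospan {ι : Type} {A B X : ι → Type} [Finite ι] [∀ i, Finite (A i)]
    [∀ i, Finite (B i)] [∀ i, Finite (X i)] (bd : (i : ι) → B i → X i) (att : (i : ι) → A i → X i)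
    (r : (i : ι) → Diagram (A i)) :
    tensorFamily (fun i => alongCospan (bd i) (att i) (r i)) =
      alongCospan (fun p : Σ i, B i => (⟨p.1, bd p.1 p.2⟩ : Σ i, X i)) (fun p => ⟨p.1, att p.1 p.2⟩)
        (tensorFamily r) := by
  let F : (Σ i, A i ⊕ (B i ⊕ A i)) ≃ (Σ i, B i) ⊕ (Σ i, A i) × Bool :=
    { toFun := fun
        | ⟨i, Sum.inl a⟩ => Sum.inr (⟨i, a⟩, false)
        | ⟨i, Sum.inr (Sum.inl b)⟩ => Sum.inl ⟨i, b⟩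
        | ⟨i, Sum.inr (Sum.inr a)⟩ => Sum.inr (⟨i, a⟩, true)
      invFun := fun
        | Sum.inr (⟨i, a⟩, false) => ⟨i, Sum.inl a⟩
        | Sum.inl ⟨i, b⟩ => ⟨i, Sum.inr (Sum.inl b)⟩
        | Sum.inr (⟨i, a⟩, true) => ⟨i, Sum.inr (Sum.inr a)⟩
      left_inv := by rintro ⟨_, _ | _ | _⟩ <;> rfl
      right_inv := by rintro (_ | ⟨_, _ | _⟩) <;> rfl }
  simp only [alongCospan, contractSpiders]
  rw [tensorFamily_contract (fun i => cospanWiring (A i) (B i)) _ F, tensorFamily_tensorPair,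
    tensorFamily_whiteSpiders, contract_reindex]
  · change contractSpiders _ _ _ = contractSpiders _ _ _
    refine contractSpiders_congr (Equiv.sigmaSumDistrib B A) (Equiv.refl _) (Equiv.refl _)
      (fun _ => false) ?_ ?_
    · rintro ⟨i, _ | _⟩ <;> rfl
    · rintro (_ | ⟨_, _ | _⟩) <;> rfl
  · rintro i (_ | _ | _) <;> rfl

lemma tensorPair_alongCospan {A₁ A₂ B₁ B₂ X₁ X₂ : Type} [Finite A₁] [Finite A₂] [Finite B₁]
    [Finite B₂] [Finite X₁] [Finite X₂] (bd₁ : B₁ → X₁) (bd₂ : B₂ → X₂) (att₁ : A₁ → X₁)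
    (att₂ : A₂ → X₂) (q : Diagram A₁) (r : Diagram A₂) :
    tensorPair (alongCospan bd₁ att₁ q) (alongCospan bd₂ att₂ r) =
      alongCospan (Sum.map bd₁ bd₂) (Sum.map att₁ att₂) (tensorPair q r) := by
  let bd : (t : Bool) → pairLegs B₁ B₂ t → pairLegs X₁ X₂ t := fun
    | false => bd₁
    | true => bd₂
  let att : (t : Bool) → pairLegs A₁ A₂ t → pairLegs X₁ X₂ t := fun
    | false => att₁
    | true => att₂
  have hpair : diagramPair (alongCospan bd₁ att₁ q) (alongCospan bd₂ att₂ r) = fun t => alongCospan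
    (bd t) (att t) (diagramPair q r t) := by
    funext t; cases t <;> rfl
  rw [tensorPair, hpair, tensorFamily_alongCospan, tensorPair, alongCospan_reindex,
    reindex_alongCospan, ← alongCospan_equiv_comp (pairLegsEquiv X₁ X₂)]
  congr 1
  · funext x; rcases x with _ | _ <;> rfl
  · funext x; rcases x with ⟨_ | _, _⟩ <;> rfl

lemma alongCospan_whiteSpiders_pairs (h : K → B) :
    alongCospan id (Sum.elim (Sum.inl ∘ h) Sum.inr : K ⊕ K → B ⊕ K)
      (whiteSpiders (Sum.elim id id : K ⊕ K → K)) = whiteSpiders (Sum.elim id h) := by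
  let τ₁ : (K ⊕ K) ⊕ ((B ⊕ K) ⊕ (K ⊕ K)) ≃ (K ⊕ ((B ⊕ K) ⊕ K)) ⊕ K × Bool :=
    { toFun := fun
        | Sum.inl (Sum.inl k) => Sum.inl (Sum.inl k)
        | Sum.inl (Sum.inr k) => Sum.inr (k, true)
        | Sum.inr (Sum.inl x) => Sum.inl (Sum.inr (Sum.inl x))
        | Sum.inr (Sum.inr (Sum.inl k)) => Sum.inl (Sum.inr (Sum.inr k))
        | Sum.inr (Sum.inr (Sum.inr k)) => Sum.inr (k, false)
      invFun := fun
        | Sum.inl (Sum.inl k) => Sum.inl (Sum.inl k)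
        | Sum.inr (k, true) => Sum.inl (Sum.inr k)
        | Sum.inl (Sum.inr (Sum.inl x)) => Sum.inr (Sum.inl x)
        | Sum.inl (Sum.inr (Sum.inr k)) => Sum.inr (Sum.inr (Sum.inl k))
        | Sum.inr (k, false) => Sum.inr (Sum.inr (Sum.inr k))
      left_inv := by rintro ((_ | _) | _ | _ | _) <;> rfl
      right_inv := by rintro ((_ | _ | _) | ⟨_, _ | _⟩) <;> rfl }
  let G₁ : K ⊕ ((B ⊕ K) ⊕ K) → K ⊕ B :=
    Sum.elim Sum.inl (Sum.elim (Sum.elim Sum.inr Sum.inl) fun k => Sum.inr (h k))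
  have hcontract : alongCospan id (Sum.elim (Sum.inl ∘ h) Sum.inr : K ⊕ K → B ⊕ K)
      (whiteSpiders (Sum.elim id id : K ⊕ K → K)) = contract (cospanWiring K (B ⊕ K))
        (whiteSpiders G₁) := by
    rw [alongCospan, contractSpiders, tensorPair_whiteSpiders]
    refine contract_whiteSpiders_congr_star τ₁ (Equiv.sumAssoc K B K).symm (Equiv.refl _)
      (Sum.elim (fun _ => false) fun _ => true) Sum.inl (fun _ => rfl) (fun _ => rfl) ?_ ?_
    · rintro (_ | (_ | _) | _) <;> rfl
    · rintro ((_ | _) | _ | _ | _) <;> rfl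
  let τ₂ : K ⊕ ((B ⊕ K) ⊕ K) ≃ (B ⊕ K) ⊕ K × Bool := cospanWiring K (B ⊕ K)
  rw [hcontract]
  conv_rhs => rw [← reindex_refl (whiteSpiders (Sum.elim id h))]
  refine contract_whiteSpiders_congr_star τ₂ (Equiv.sumComm K B) (Equiv.emptySum Empty K).symm
    (fun _ => false) h
    (fun _ => rfl) (fun _ => rfl) ?_ ?_
  · rintro (_ | _) <;> rfl
  · rintro (_ | (_ | _) | _) <;> rfl

end

/-! ### Substitution, products and sums -/

section
variable {A A' B B' C K K' X : Type} [Finite A] [Finite A'] [Finite B] [Finite B'] [Finite C]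
  [Finite K] [Finite K'] [Finite X]

/-- The diagram `q` with its leg `a` attached to the variable `g a`. The open ends of a diagram are
thought of as variables, a white spider lets several legs read the same variable, and `rename` acts
on diagrams like the substitution of variables for variables. -/
noncomputable def rename (g : A → B) (q : Diagram A) : Diagram B := alongCospan id g q

/-- The sum of a diagram over the variables in `K`: each of them is a white spider with no open
end. -/
noncomputable def sumOut (K : Type) [Finite K] (q : Diagram (B ⊕ K)) : Diagram B :=
  alongCospan Sum.inl id q

lemma alongCospan_inl_eq_sumOut_rename (att : A → B ⊕ K) (q : Diagram A) :
    alongCospan Sum.inl att q = sumOut K (rename att q) := by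
  rw [sumOut, rename, alongCospan_id_alongCospan]; rfl

lemma alongCospan_rename (bd : B → X) (att : A → X) (f : A' → A) (q : Diagram A') :
    alongCospan bd att (rename f q) = alongCospan bd (fun a => att (f a)) q := by
  have hrename : rename f q = alongCospan (Sum.inl : A → A ⊕ Empty) (fun a => Sum.inl (f a)) q :=
    (alongCospan_equiv_comp (Equiv.sumEmpty A Empty).symm id f q).symm
  have hcospan : alongCospan bd (fun a => att (f a)) q =
      alongCospan (fun b => (Sum.inl (bd b) : X ⊕ Empty)) (fun a => Sum.inl (att (f a))) q :=
    (alongCospan_equiv_comp (Equiv.sumEmpty X Empty).symm bd (fun a => att (f a)) q).symm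
  rw [hrename, hcospan]
  exact alongCospan_alongCospan_inl bd att _ q

lemma alongCospan_sumOut (bd : B → X) (att : A → X) (q : Diagram (A ⊕ K)) :
    alongCospan bd att (sumOut K q) =
      alongCospan (fun b => Sum.inl (bd b)) (Sum.map att (id : K → K)) q :=
  alongCospan_alongCospan_inl bd att id q

lemma rename_rename (g : B → C) (f : A → B) (q : Diagram A) :
    rename g (rename f q) = rename (fun a => g (f a)) q := alongCospan_rename _ _ _ _

@[simp] lemma rename_id (q : Diagram A) : rename id q = q := alongCospan_id_id q

@[simp] lemma rename_id' (q : Diagram A) : rename (fun a => a) q = q := alongCospan_id_id q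

lemma reindex_eq_rename (g : A ≃ B) (q : Diagram A) : reindex g q = rename g q := by
  conv_lhs => rw [← alongCospan_id_id q, reindex_alongCospan, ← alongCospan_equiv_comp g]
  simp [rename]
  rfl

lemma rename_sumOut (g : B → C) (q : Diagram (B ⊕ K)) :
    rename g (sumOut K q) = sumOut K (rename (Sum.map g id) q) := by
  rw [← alongCospan_inl_eq_sumOut_rename]; exact alongCospan_sumOut id g q

lemma sumOut_sumOut (q : Diagram ((B ⊕ K) ⊕ K')) :
    sumOut K (sumOut K' q) = sumOut (K ⊕ K') (rename (Equiv.sumAssoc B K K') q) := by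
  rw [← alongCospan_inl_eq_sumOut_rename]
  conv_lhs => rw [sumOut, sumOut, alongCospan_id_alongCospan, ← alongCospan_equiv_comp
    (Equiv.sumAssoc B K K')]
  rfl

lemma sumOut_equiv (e : K ≃ K') (q : Diagram (B ⊕ K)) :
    sumOut K' (rename (Sum.map id e) q) = sumOut K q := by
  rw [← alongCospan_inl_eq_sumOut_rename, sumOut, ← alongCospan_equiv_comp
    (Equiv.sumCongr (Equiv.refl B) e)]
  rfl

lemma tensorPair_rename (f : A → B) (g : A' → B') (q : Diagram A) (r : Diagram A') :
    tensorPair (rename f q) (rename g r) = rename (Sum.map f g) (tensorPair q r) := by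
  rw [rename, rename, tensorPair_alongCospan, Sum.map_id_id]; rfl

/-- The product of two diagrams joins the open ends with the same name by white spiders. In terms of
the linear maps that diagrams stand for, it is the pointwise product of functions of `B`. -/
noncomputable instance : CommMonoid (Diagram B) where
  mul q r := rename (Sum.elim id id) (tensorPair q r)
  one := rename Empty.elim emptyDiagram
  mul_assoc q r s := by
    change rename _ (tensorPair (rename _ (tensorPair q r)) s) =
      rename _ (tensorPair q (rename _ (tensorPair r s)))
    conv_lhs => rw [← rename_id s]
    conv_rhs => rw [← rename_id q]
    rw [tensorPair_rename, tensorPair_rename, rename_rename, rename_rename, ← tensorPair_assoc,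
      reindex_eq_rename, rename_rename]
    congr 1
    funext x
    rcases x with (_ | _) | _ <;> rfl
  mul_comm q r := by
    change rename _ (tensorPair q r) = rename _ (tensorPair r q)
    rw [← tensorPair_comm q r, reindex_eq_rename, rename_rename]
    congr 1
    funext x
    rcases x with _ | _ <;> rfl
  mul_one q := by
    change rename _ (tensorPair q (rename _ emptyDiagram)) = q
    conv_lhs => rw [← rename_id q]
    rw [tensorPair_rename, rename_rename, tensorPair_emptyDiagram, reindex_eq_rename, rename_rename]
    exact rename_id q
  one_mul q := by
    change rename _ (tensorPair (rename _ emptyDiagram) q) = q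
    rw [← tensorPair_comm, reindex_eq_rename, rename_rename]
    conv_lhs => rw [← rename_id q]
    rw [tensorPair_rename, rename_rename, tensorPair_emptyDiagram, reindex_eq_rename, rename_rename]
    exact rename_id q

lemma mul_eq_rename_tensorPair (q r : Diagram B) :
    q * r = rename (Sum.elim id id) (tensorPair q r) := rfl

lemma one_eq_rename_emptyDiagram : (1 : Diagram B) = rename Empty.elim emptyDiagram := rfl

lemma rename_mul (g : A → B) (q r : Diagram A) : rename g (q * r) = rename g q * rename g r := by
  rw [mul_eq_rename_tensorPair, mul_eq_rename_tensorPair, tensorPair_rename, rename_rename,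
    rename_rename]
  congr 1
  funext x
  rcases x with _ | _ <;> rfl

lemma rename_one (g : A → B) : rename g (1 : Diagram A) = 1 := by
  rw [one_eq_rename_emptyDiagram, one_eq_rename_emptyDiagram, rename_rename]
  congr 1
  funext x
  exact x.elim

/-- The substitution of variables `rename` as a homomorphism of monoids. -/
noncomputable def renameHom (g : A → B) : Diagram A →* Diagram B where
  toFun := rename g
  map_one' := rename_one g
  map_mul' := rename_mul g

lemma rename_prod {ι : Type} [Fintype ι] (g : A → B) (q : ι → Diagram A) :
    rename g (∏ i, q i) = ∏ i, rename g (q i) :=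
  map_prod (renameHom g) _ _

lemma sumOut_mul (q : Diagram (B ⊕ K)) (r : Diagram B) :
    sumOut K q * r = sumOut K (q * rename Sum.inl r) := by
  have hcospan : tensorPair (sumOut K q) r =
      alongCospan (Sum.map Sum.inl id : B ⊕ B → (B ⊕ K) ⊕ B) id (tensorPair q r) := by
    conv_lhs => rw [← alongCospan_id_id r]
    rw [sumOut, tensorPair_alongCospan, Sum.map_id_id]
  let E : (B ⊕ K) ⊕ B ≃ (B ⊕ B) ⊕ K :=
    { toFun := fun
        | Sum.inl (Sum.inl b) => Sum.inl (Sum.inl b)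
        | Sum.inl (Sum.inr k) => Sum.inr k
        | Sum.inr b => Sum.inl (Sum.inr b)
      invFun := fun
        | Sum.inl (Sum.inl b) => Sum.inl (Sum.inl b)
        | Sum.inr k => Sum.inl (Sum.inr k)
        | Sum.inl (Sum.inr b) => Sum.inr b
      left_inv := by rintro ((_ | _) | _) <;> rfl
      right_inv := by rintro ((_ | _) | _) <;> rfl }
  have hsumOut : tensorPair (sumOut K q) r = sumOut K (rename E (tensorPair q r)) := by
    rw [hcospan, ← alongCospan_equiv_comp E, ← alongCospan_inl_eq_sumOut_rename]
    congr 1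
    funext x
    rcases x with _ | _ <;> rfl
  rw [mul_eq_rename_tensorPair, hsumOut, rename_sumOut, rename_rename, mul_eq_rename_tensorPair]
  conv_rhs => rw [← rename_id q]
  rw [tensorPair_rename, rename_rename]
  congr 2
  funext x
  rcases x with (_ | _) | _ <;> rfl

/-- The legs of a family of diagrams indexed by `Option ι`, with those of the first one apart. -/
def sigmaOptionEquiv {ι : Type} (L : Option ι → Type) :
    (Σ i, L i) ≃ L none ⊕ Σ i, L (some i) where
  toFun
    | ⟨none, l⟩ => Sum.inl l
    | ⟨some i, l⟩ => Sum.inr ⟨i, l⟩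
  invFun
    | Sum.inl l => ⟨none, l⟩
    | Sum.inr ⟨i, l⟩ => ⟨some i, l⟩
  left_inv := by rintro ⟨_ | _, _⟩ <;> rfl
  right_inv := by rintro (_ | ⟨_, _⟩) <;> rfl

lemma reindex_tensorFamily_option {ι : Type} [Finite ι] {L : Option ι → Type}
    (q : (i : Option ι) → Diagram (L i)) :
    reindex (sigmaOptionEquiv L) (tensorFamily q) =
      tensorPair (q none) (tensorFamily fun i => q (some i)) := by
  let F : (Σ i, L i) ≃ Σ x : Unit ⊕ ι, Sum.elim (fun _ => L none) (fun i => L (some i)) x :=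
    { toFun := fun
        | ⟨none, l⟩ => ⟨Sum.inl (), l⟩
        | ⟨some i, l⟩ => ⟨Sum.inr i, l⟩
      invFun := fun
        | ⟨Sum.inl (), l⟩ => ⟨none, l⟩
        | ⟨Sum.inr i, l⟩ => ⟨some i, l⟩
      left_inv := by rintro ⟨_ | _, _⟩ <;> rfl
      right_inv := by rintro ⟨_ | _, _⟩ <;> rfl }
  have hsum : reindex F (tensorFamily q) =
      tensorFamily (sumFamily (fun _ : Unit => q none) fun i => q (some i)) :=
    reindex_tensorFamily ((Equiv.sumComm _ _).trans (Equiv.optionEquivSumPUnit ι).symm) (fun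
      | Sum.inl _ => Equiv.refl (L none)
      | Sum.inr i => Equiv.refl (L (some i))) _
      (by rintro (_ | _) <;> exact (reindex_refl _).symm) (by rintro (_ | _) _ <;> rfl)
  have hpair := tensorPair_tensorFamily (fun _ : Unit => q none) (fun i => q (some i))
  rw [tensorFamily_unit, tensorPair_reindex_left, ← hsum, reindex_reindex] at hpair
  apply reindex_injective
    (Equiv.sumCongr (Equiv.uniqueSigma fun _ : Unit => L none) (Equiv.refl (Σ i, L (some i)))).symm
  refine Eq.trans ?_ hpair.symm
  rw [reindex_reindex]
  congr 1
  ext ⟨_ | _, _⟩ <;> rfl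

lemma rename_tensorFamily_of_isEmpty {ι : Type} [Finite ι] [IsEmpty ι] {L : ι → Type}
    [∀ i, Finite (L i)] (f : (Σ i, L i) → B) (q : (i : ι) → Diagram (L i)) :
    rename f (tensorFamily q) = 1 := by
  rw [one_eq_rename_emptyDiagram, emptyDiagram, reindex_eq_rename, rename_rename,
    ← reindex_tensorFamily (q := q) (r := fun i : Empty => (i.elim : Diagram Empty))
      (Equiv.equivOfIsEmpty Empty ι) (fun i => i.elim) (Equiv.equivOfIsEmpty _ _)
      (fun i => i.elim) (fun i => i.elim), reindex_eq_rename, rename_rename]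
  congr 1
  funext p
  exact isEmptyElim p.1

lemma rename_tensorFamily_comp_equiv {ι κ : Type} [Finite ι] [Finite κ] (e : ι ≃ κ)
    {L : κ → Type} [∀ k, Finite (L k)] (f : (Σ k, L k) → B) (q : (k : κ) → Diagram (L k)) :
    rename (fun p => f ⟨e p.1, p.2⟩) (tensorFamily fun i => q (e i)) =
      rename f (tensorFamily q) := by
  rw [← reindex_tensorFamily (q := q) (r := fun i => q (e i)) e (fun _ => Equiv.refl _)
    (Equiv.sigmaCongrLeft (β := L) e).symm (fun _ => (reindex_refl _).symm)
    (fun i l => (Equiv.symm_apply_eq _).2 rfl), reindex_eq_rename, rename_rename]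
  congr 1
  funext p
  exact congrArg f ((Equiv.sigmaCongrLeft (β := L) e).apply_symm_apply p)

lemma prod_rename {ι : Type} [Fintype ι] {L : ι → Type} [∀ i, Finite (L i)]
    (g : (i : ι) → L i → B) (q : (i : ι) → Diagram (L i)) :
    ∏ i, rename (g i) (q i) = rename (fun p : Σ i, L i => g p.1 p.2) (tensorFamily q) := by
  revert L
  refine Fintype.induction_empty_option (P := fun ι _ => ∀ {L : ι → Type} [∀ i, Finite (L i)]
    (g : (i : ι) → L i → B) (q : (i : ι) → Diagram (L i)), ∏ i, rename (g i) (q i) =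
      rename (fun p : Σ i, L i => g p.1 p.2) (tensorFamily q)) ?_ ?_ ?_ ι
  · intro ι κ _ e ih L _ g q
    let _ : Fintype ι := Fintype.ofEquiv κ e.symm
    rw [← Equiv.prod_comp e, ih (fun i => g (e i)) (fun i => q (e i)),
      ← rename_tensorFamily_comp_equiv e]
  · intro L _ g q
    rw [Finset.univ_eq_empty, Finset.prod_empty, rename_tensorFamily_of_isEmpty]
  · intro ι _ ih L _ g q
    have hmoved := congrArg (rename (Sum.elim (g none) fun p => g (some p.1) p.2))
      (reindex_tensorFamily_option q)
    rw [reindex_eq_rename, rename_rename] at hmoved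
    rw [Fintype.prod_option, ih, mul_eq_rename_tensorPair, tensorPair_rename, rename_rename]
    refine Eq.trans ?_ (hmoved.symm.trans ?_)
    · congr 1
      funext x
      rcases x with _ | _ <;> rfl
    · congr 1
      funext x
      rcases x with ⟨_ | _, _⟩ <;> rfl

lemma prod_sumOut {ι : Type} [Fintype ι] {K : ι → Type} [∀ i, Finite (K i)]
    (q : (i : ι) → Diagram (B ⊕ K i)) :
    ∏ i, sumOut (K i) (q i) = sumOut (Σ i, K i) (∏ i, rename (Sum.map id (Sigma.mk i)) (q i)) := by
  have hprod : ∏ i, sumOut (K i) (q i) = rename (fun p : Σ _ : ι, B => p.2)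
    (tensorFamily fun i => sumOut (K i) (q i)) := by
    have hprod := prod_rename (fun (_ : ι) (b : B) => b) fun i => sumOut (K i) (q i)
    simpa only [rename_id'] using hprod
  rw [hprod, prod_rename]
  simp only [sumOut]
  rw [tensorFamily_alongCospan, ← alongCospan_equiv_comp (Equiv.sigmaSumDistrib (fun _ : ι => B) K)]
  change rename _ (alongCospan Sum.inl _ _) = _
  rw [alongCospan_inl_eq_sumOut_rename, rename_sumOut, rename_rename]
  change sumOut _ _ = sumOut _ _
  congr 2
  funext x
  obtain ⟨i, b | k⟩ := x <;> rfl

/-! ### Equality of variables -/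

/-- The constraint that the variables `a` and `b` are equal, given by a wire between them. -/
noncomputable def delta (a b : B) : Diagram B := rename (fun t => bif t then b else a) ⟦strand⟧

lemma rename_delta (g : B → C) (a b : B) : rename g (delta a b) = delta (g a) (g b) := by
  rw [delta, rename_rename, delta]
  congr 1
  funext t
  cases t <;> rfl

lemma strand_eq_Z : (⟦strand⟧ : Diagram Bool) = ⟦Z Bool⟧ :=
  (Quotient.sound (ZHEq.rule Rule.ZS2)).symm

lemma delta_comm (a b : B) : delta a b = delta b a := by
  rw [delta, strand_eq_Z, ← reindex_Z Equiv.boolNot, reindex_eq_rename, rename_rename, delta,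
    strand_eq_Z]
  congr 1
  funext t
  cases t <;> rfl

lemma prod_delta [Fintype K] (h : K → B) :
    ∏ k, delta (Sum.inl (h k)) (Sum.inr k) = whiteSpiders (Sum.elim id h : B ⊕ K → B) := by
  simp only [delta]
  rw [prod_rename (fun (k : K) (t : Bool) => bif t then (Sum.inr k : B ⊕ K) else Sum.inl (h k)),
    ← alongCospan_whiteSpiders_pairs]
  simp only [strand_eq_Z]
  have hpairs : whiteSpiders (Sum.elim id id : K ⊕ K → K) =
      reindex ((Equiv.sigmaEquivProd K Bool).trans ((Equiv.prodComm _ _).trans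
        (Equiv.boolProdEquivSum K))) (tensorFamily fun _ : K => ⟦Z Bool⟧) := by
    refine (reindex_tensorFamily_Z (M := fun _ => Bool) _ (Equiv.refl _) _ ?_).symm
    rintro k (_ | _) <;> rfl
  rw [hpairs, reindex_eq_rename]
  change _ = rename _ _
  rw [rename_rename]
  congr 1
  funext x
  obtain ⟨k, _ | _⟩ := x <;> rfl

lemma sumOut_mul_prod_delta [Fintype K] (h : K → B) (q : Diagram (B ⊕ K)) :
    sumOut K (q * ∏ k, delta (Sum.inl (h k)) (Sum.inr k)) = rename (Sum.elim id h) q := by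
  rw [prod_delta, sumOut, mul_eq_rename_tensorPair, rename, alongCospan_tensorPair_whiteSpiders,
    alongCospan_id_alongCospan]
  rfl

lemma mul_whiteSpiders (k : A → X) (q : Diagram A) : q * whiteSpiders k = alongCospan k k q :=
  alongCospan_tensorPair_whiteSpiders k q

lemma whiteSpiders_eq_alongCospan (k : A → X) :
    whiteSpiders k = alongCospan k Empty.elim emptyDiagram := by
  rw [← one_mul (whiteSpiders k), mul_whiteSpiders, one_eq_rename_emptyDiagram, alongCospan_rename]
  congr 1
  funext x
  exact x.elim

lemma sumOut_whiteSpiders (k : B ⊕ K → X) :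
    sumOut K (whiteSpiders k) = whiteSpiders fun b => k (Sum.inl b) := by
  rw [whiteSpiders_eq_alongCospan, whiteSpiders_eq_alongCospan, sumOut, alongCospan_id_alongCospan]

lemma Z_eq_sumOut_prod_delta (L : Type) [Fintype L] :
    (⟦Z L⟧ : Diagram L) = sumOut Unit (∏ l, delta (Sum.inr ()) (Sum.inl l)) := by
  have hpairs := congrArg (reindex (Equiv.sumComm Unit L)) (prod_delta fun _ : L => ())
  rw [reindex_eq_rename, rename_prod] at hpairs
  simp only [rename_delta] at hpairs
  change ∏ l, delta (Sum.inr ()) (Sum.inl l) = _ at hpairs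
  rw [hpairs, reindex_whiteSpiders (g' := fun _ : L ⊕ Unit => ()) _ (fun _ => rfl),
    sumOut_whiteSpiders, whiteSpiders_of_unique]

lemma net_eq_sumOut_prod {ι W : Type} {L : ι → Type} [Fintype ι] [∀ i, Finite (L i)] [Finite W]
    (D : (i : ι) → ZH (L i)) (e : (Σ i, L i) ≃ B ⊕ W × Bool) :
    (⟦net D e⟧ : Diagram B) =
      sumOut W (∏ i, rename (fun l => Sum.map id Prod.fst (e ⟨i, l⟩)) (⟦D i⟧ : Diagram (L i))) := by
  rw [← network_mk, network_eq_contract, prod_rename, ← alongCospan_inl_eq_sumOut_rename]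
  exact contract_eq_alongCospan e _

lemma graph_eq_sumOut_prod {ι W : Type} [Fintype ι] [Finite W] (node : ι → Spider)
    (bdry : B → ι) (src tgt : W → ι) :
    (⟦graph node bdry src tgt⟧ : Diagram B) =
      sumOut W (∏ i, rename (fun l : {p // Sum.elim bdry (fun p : W × Bool =>
        bif p.2 then tgt p.1 else src p.1) p = i} => Sum.map id Prod.fst l.1)
        (⟦node i _⟧ : Diagram _)) := by
  rw [graph, net_eq_sumOut_prod]
  rfl
lemma one_eq_Z_unit : (1 : Diagram Unit) = ⟦Z Unit⟧ := by
  have hsubst := sumOut_mul_prod_delta (B := Unit) (fun _ : Unit => ()) 1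
  rw [one_mul, prod_delta, sumOut_whiteSpiders, rename_one, whiteSpiders_of_unique] at hsubst
  exact hsubst.symm

lemma delta_self (a : X) : delta a a = 1 := by
  have hloop : rename (fun _ => ()) (⟦Z Bool⟧ : Diagram Bool) = (1 : Diagram Unit) := by
    rw [one_eq_Z_unit, rename, ← whiteSpiders_of_unique (V := Unit) (fun _ => ()), alongCospan,
      contractSpiders, tensorPair_whiteSpiders,
      ← contract_whiteSpiders_bool (W := Bool) fun _ => true,
      ← whiteSpiders_equiv_comp _ (Equiv.boolEquivPUnitSumPUnit).symm,
      ← reindex_whiteSpiders (g := fun p => (Equiv.boolEquivPUnitSumPUnit).symm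
        (Sum.map (fun _ => ()) (Sum.elim id fun _ => ()) p)) (cospanWiring Bool Unit),
      contract_reindex]
    · rfl
    · rintro (_ | _ | _) <;> rfl
  rw [delta, strand_eq_Z, ← rename_one fun _ : Unit => a, ← hloop, rename_rename]
  congr 1
  funext t
  cases t <;> rfl

lemma rename_Z_three (f : Unit ⊕ Bool → X) : rename f (⟦Z (Unit ⊕ Bool)⟧ : Diagram _) =
    delta (f (Sum.inl ())) (f (Sum.inr false)) * delta (f (Sum.inl ())) (f (Sum.inr true)) := by
  have hpairs := prod_delta fun _ : Bool => ()
  rw [whiteSpiders_of_unique, Fintype.prod_bool] at hpairs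
  rw [← hpairs, rename_mul, rename_delta, rename_delta, mul_comm]

lemma delta_mul_delta_trans (a b c : X) : delta a b * delta b c = delta a b * delta a c := by
  let E : Unit ⊕ Bool ≃ Unit ⊕ Bool := Equiv.swap (Sum.inl ()) (Sum.inr false)
  have hthree := rename_Z_three fun x => Sum.elim (fun _ => a) (fun t => bif t then c else b) (E x)
  have hswap :=
    congrArg (rename (Sum.elim (fun _ => a) (fun t => bif t then c else b))) (reindex_Z E)
  rw [reindex_eq_rename, rename_rename, hthree, rename_Z_three] at hswap
  have hE_inl : E (Sum.inl ()) = Sum.inr false := by simp [E]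
  have hE_false : E (Sum.inr false) = Sum.inl () := by simp [E]
  have hE_true : E (Sum.inr true) = Sum.inr true := by simp [E, Equiv.swap_apply_of_ne_of_ne]
  rw [hE_inl, hE_false, hE_true] at hswap
  simpa [delta_comm b a] using hswap

lemma sumOut_comm (q : Diagram ((B ⊕ K) ⊕ K')) :
    sumOut K (sumOut K' q) =
      sumOut K' (sumOut K (rename (Sum.elim (Sum.map Sum.inl id) fun k => Sum.inl (Sum.inr k))
        q)) := by
  rw [sumOut_sumOut, sumOut_sumOut, ← sumOut_equiv (Equiv.sumComm K K'), rename_rename,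
    rename_rename]
  congr 2
  funext x
  rcases x with (_ | _) | _ <;> rfl

lemma sumOut_sum (q : Diagram (B ⊕ (C ⊕ K))) :
    sumOut (C ⊕ K) q = sumOut C (sumOut K (rename (Equiv.sumAssoc B C K).symm q)) := by
  rw [sumOut_sumOut, rename_rename]
  simp

lemma sumOut_delta (b : B) : sumOut Unit (delta (Sum.inl b) (Sum.inr ())) = 1 := by
  have hsubst := sumOut_mul_prod_delta (K := Unit) (fun _ => b) 1
  simpa [rename_one] using hsubst

end

/-! ### Terms -/

section
variable {A A' B C K V X : Type} [Fintype A] [Fintype A'] [Finite B] [Fintype C] [Fintype K]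
  [Finite V] [Finite X]

variable (V) in
/-- A term: a diagram that expresses one variable as a function of the variables in `V`. The two
axioms say that a copy of the function can be replaced by a copy of its value, and that a value that
is not used can be discarded. They make it possible to substitute terms for variables. -/
@[ext]
structure Term where
  val : Diagram (V ⊕ Unit)
  copy : rename (Sum.map id fun _ => false) val * rename (Sum.map id fun _ => true) val =
    rename (Sum.map id fun _ => false) val * delta (Sum.inr false : V ⊕ Bool) (Sum.inr true)
  discard : sumOut Unit val = 1

/-- The constraint that the variable `y` is given by the term `t`. -/
noncomputable def Term.equation (t : Term V) (f : V → X) (y : X) : Diagram X :=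
  rename (Sum.elim f fun _ => y) t.val

lemma Term.equation_self (t : Term V) : t.equation Sum.inl (Sum.inr ()) = t.val := by
  rw [Term.equation]
  conv_rhs => rw [← rename_id t.val]
  congr 1
  funext x
  rcases x with _ | _ <;> rfl

lemma Term.rename_equation (t : Term V) (f : V → X) (y : X) (g : X → B) :
    rename g (t.equation f y) = t.equation (fun v => g (f v)) (g y) := by
  rw [Term.equation, rename_rename, Term.equation]
  congr 1
  funext x
  rcases x with _ | _ <;> rfl

lemma Term.equation_mul_equation (t : Term V) (f : V → X) (y z : X) :
    t.equation f y * t.equation f z = t.equation f y * delta y z := by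
  have hcopy := congrArg (rename (Sum.elim f fun t => bif t then z else y)) t.copy
  rw [rename_mul, rename_mul, rename_rename, rename_rename, rename_delta] at hcopy
  have hrename : ∀ b : Bool, rename (fun a => Sum.elim f (fun t => bif t then z else y)
      (Sum.map id (fun _ : Unit => b) a)) t.val = t.equation f (bif b then z else y) := by
    intro b
    rw [Term.equation]
    congr 1
    funext x
    rcases x with _ | _ <;> rfl
  rw [hrename, hrename] at hcopy
  exact hcopy

lemma Term.sumOut_equation (t : Term V) (f : V → X) :
    sumOut Unit (t.equation (fun v => Sum.inl (f v)) (Sum.inr ())) = 1 := by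
  have hdiscard := congrArg (rename f) t.discard
  rw [rename_sumOut, rename_one] at hdiscard
  rw [← hdiscard, Term.equation]
  congr 2

/-- The variable `v` as a term, which is a wire. -/
noncomputable def var (v : V) : Term V where
  val := delta (Sum.inl v) (Sum.inr ())
  copy := by
    rw [rename_delta, rename_delta]
    exact (delta_mul_delta_trans _ _ _).symm
  discard := sumOut_delta v

lemma var_equation (v : V) (f : V → X) (y : X) : (var v).equation f y = delta (f v) y :=
  rename_delta _ _ _

/-- The term `t` with the variable `g v` in place of each variable `v`. -/
noncomputable def Term.map (g : V → X) (t : Term V) : Term X where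
  val := t.equation (fun v => Sum.inl (g v)) (Sum.inr ())
  copy := by
    rw [Term.rename_equation, Term.rename_equation]
    exact t.equation_mul_equation _ _ _
  discard := t.sumOut_equation g

lemma Term.map_equation (t : Term V) (g : V → X) (f : X → B) (y : B) :
    (t.map g).equation f y = t.equation (fun v => f (g v)) y := Term.rename_equation _ _ _ _

lemma Term.map_var (g : V → X) (v : V) : (var v).map g = var (g v) :=
  Term.ext (var_equation _ _ _)

lemma Term.map_map (t : Term V) (g : V → X) (f : X → B) :
    (t.map g).map f = t.map fun v => f (g v) :=
  Term.ext (Term.map_equation _ _ _ _)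

/-- The constraints that the variables in `A` are given by the terms `t`. -/
noncomputable def equations (t : A → Term V) : Diagram (V ⊕ A) :=
  ∏ a, (t a).equation Sum.inl (Sum.inr a)

lemma rename_equations (t : A → Term V) (g : V ⊕ A → X) :
    rename g (equations t) = ∏ a, (t a).equation (fun v => g (Sum.inl v)) (g (Sum.inr a)) := by
  rw [equations, rename_prod]
  simp only [Term.rename_equation]

lemma sumOut_equations (t : A → Term V) : sumOut A (equations t) = 1 := by
  have hsumOut := prod_sumOut fun a => (t a).val
  simp only [Term.discard, Finset.prod_const_one] at hsumOut
  rw [hsumOut, ← sumOut_equiv (Equiv.sigmaPUnit A), rename_prod, equations]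
  simp only [rename_rename, Term.equation]
  congr 1
  refine Finset.prod_congr rfl fun a _ => ?_
  congr 1
  funext x
  rcases x with _ | _ <;> rfl

/-- The diagram `q` with the terms `t` substituted for its variables. -/
noncomputable def substitute (q : Diagram A) (t : A → Term V) : Diagram V :=
  sumOut A (rename Sum.inr q * equations t)

lemma substitute_mul (q r : Diagram A) (t : A → Term V) :
    substitute (q * r) t = substitute q t * substitute r t := by
  rw [substitute, substitute, sumOut_mul, substitute, rename_sumOut, mul_comm _ (sumOut _ _),
    sumOut_mul, rename_mul, rename_mul Sum.inl, rename_mul (Sum.map Sum.inl id), rename_equations,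
    rename_rename, rename_equations, rename_rename, mul_comm (_ * _) (_ * _)]
  have hcopy : (∏ a, (t a).equation (fun v => (Sum.inl (Sum.inl v) : (V ⊕ A) ⊕ A))
    (Sum.inl (Sum.inr a))) *
      (∏ a, (t a).equation (fun v => (Sum.inl (Sum.inl v) : (V ⊕ A) ⊕ A)) (Sum.inr a)) =
      (∏ a, (t a).equation (fun v => (Sum.inl (Sum.inl v) : (V ⊕ A) ⊕ A)) (Sum.inl (Sum.inr a))) *
        ∏ a, delta (Sum.inl (Sum.inr a)) (Sum.inr a) := by
    rw [← Finset.prod_mul_distrib, ← Finset.prod_mul_distrib]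
    exact Finset.prod_congr rfl fun a _ => Term.equation_mul_equation _ _ _ _
  simp only [Sum.map_inl, Sum.map_inr, id]
  rw [mul_mul_mul_comm, hcopy, ← mul_assoc, sumOut_mul_prod_delta, rename_mul, rename_mul,
    rename_rename, rename_rename, rename_prod]
  simp only [Term.rename_equation, id, Sum.elim_inl, Sum.elim_inr]
  rfl

lemma substitute_one (t : A → Term V) : substitute 1 t = 1 := by
  rw [substitute, rename_one, one_mul, sumOut_equations]

lemma substitute_var (q : Diagram A) (g : A → V) :
    substitute q (fun a => var (g a)) = rename g q := by
  rw [substitute, equations]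
  simp only [var_equation]
  rw [sumOut_mul_prod_delta, rename_rename]
  rfl

lemma rename_substitute (g : V → X) (q : Diagram A) (t : A → Term V) :
    rename g (substitute q t) = substitute q fun a => (t a).map g := by
  rw [substitute, rename_sumOut, rename_mul, rename_rename, rename_equations, substitute, equations]
  simp only [Term.map_equation]
  rfl

lemma prod_mul_eq_prod_mul {ι M : Type*} [CommMonoid M] (s : Finset ι) {p q : ι → M} {c : M}
    (h : ∀ i, p i * c = q i * c) : (∏ i ∈ s, p i) * c = (∏ i ∈ s, q i) * c := by
  classical
  induction s using Finset.induction_on with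
  | empty => simp
  | insert i s hi ih =>
    rw [Finset.prod_insert hi, Finset.prod_insert hi, mul_assoc, ih, mul_left_comm, h,
      mul_left_comm, mul_assoc]

lemma delta_mul_prod_equation (t : A → Term V) (f : V → X) (y : A → X) (a : A) (z : X) :
    delta (y a) z * ∏ a, (t a).equation f (y a) =
      (t a).equation f z * ∏ a, (t a).equation f (y a) := by
  classical
  rw [← Finset.mul_prod_erase _ _ (Finset.mem_univ a), ← mul_assoc, ← mul_assoc,
    mul_comm (delta _ _), ← Term.equation_mul_equation, mul_comm (Term.equation _ _ z)]

lemma sumOut_mul_mul_equations {K : Type} [Finite K] (q r : Diagram (V ⊕ K)) (t : A → Term V) :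
    sumOut A (rename Sum.inl q * (rename Sum.inl r * rename (Sum.map Sum.inl id) (equations t))) =
      q * r := by
  rw [← mul_assoc, ← rename_mul, mul_comm, ← sumOut_mul, ← rename_sumOut, sumOut_equations,
    rename_one, one_mul]

lemma substitute_rename (g : A' → A) (q : Diagram A') (t : A → Term V) :
    substitute (rename g q) t = substitute q fun a => t (g a) := by
  have hcopy : rename (Sum.inr : A → V ⊕ A) (rename g q) =
      sumOut A' (rename Sum.inr q * ∏ a, delta (Sum.inl (Sum.inr (g a))) (Sum.inr a)) := by
    rw [sumOut_mul_prod_delta, rename_rename, rename_rename]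
    rfl
  have hsubst : (∏ a, delta (Sum.inl (Sum.inr (g a)) : (V ⊕ A) ⊕ A') (Sum.inr a)) *
      (∏ a, (t a).equation (fun v => Sum.inl (Sum.inl v)) (Sum.inl (Sum.inr a))) =
      (∏ a, (t (g a)).equation (fun v => Sum.inl (Sum.inl v)) (Sum.inr a)) *
        (∏ a, (t a).equation (fun v => Sum.inl (Sum.inl v)) (Sum.inl (Sum.inr a))) :=
    prod_mul_eq_prod_mul _ fun a => delta_mul_prod_equation t (fun v => Sum.inl (Sum.inl v))
      (fun a => Sum.inl (Sum.inr a)) (g a) (Sum.inr a)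
  have hswap : rename (Sum.map Sum.inl id) (equations t) =
      ∏ a, (t a).equation (fun v => (Sum.inl (Sum.inl v) : (V ⊕ A') ⊕ A)) (Sum.inr a) :=
    rename_equations _ _
  rw [substitute, hcopy, sumOut_mul, mul_assoc, rename_equations, hsubst, sumOut_comm, substitute,
    rename_mul, rename_mul, rename_rename, rename_prod, rename_prod]
  simp only [Term.rename_equation]
  rw [← sumOut_mul_mul_equations _ _ t, hswap, rename_rename, rename_equations]
  rfl

/-- The substitution `t` in the presence of further variables `K`, which it leaves unchanged. -/
noncomputable def liftTerms {K : Type} [Finite K] (t : C → Term V) : C ⊕ K → Term (V ⊕ K) :=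
  Sum.elim (fun c => (t c).map Sum.inl) fun k => var (Sum.inr k)

lemma substitute_liftTerms (q : Diagram (C ⊕ K)) (t : C → Term V) :
    substitute q (liftTerms t) =
      sumOut C (rename (Sum.elim Sum.inr fun k => Sum.inl (Sum.inr k)) q *
        rename (Sum.map Sum.inl id) (equations t)) := by
  have hequations : equations (liftTerms (K := K) t) =
    (∏ c, (t c).equation (fun v => Sum.inl (Sum.inl v)) (Sum.inr (Sum.inl c))) *
      ∏ k, delta (Sum.inl (Sum.inr k) : (V ⊕ K) ⊕ (C ⊕ K)) (Sum.inr (Sum.inr k)) := by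
    rw [equations, Fintype.prod_sum_type]
    simp only [liftTerms, Sum.elim_inl, Sum.elim_inr, Term.map_equation, var_equation]
  rw [substitute, hequations, sumOut_sum, ← mul_assoc, rename_mul, rename_prod]
  simp only [rename_delta]
  refine (congrArg (sumOut C) (sumOut_mul_prod_delta
    (fun k : K => (Sum.inl (Sum.inr k) : (V ⊕ K) ⊕ C)) _)).trans ?_
  rw [rename_rename, rename_mul, rename_rename, rename_prod, rename_equations]
  simp only [Term.rename_equation]
  congr 3
  funext x
  rcases x with _ | _ <;> rfl

lemma substitute_elim (q : Diagram (C ⊕ K)) (t : C → Term V) (s : K → Term V) :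
    substitute q (Sum.elim t s) = sumOut K (substitute q (liftTerms t) * equations s) := by
  have hequations : equations (Sum.elim t s) = (∏ c, (t c).equation Sum.inl (Sum.inr (Sum.inl c))) *
      ∏ k, (s k).equation Sum.inl (Sum.inr (Sum.inr k)) := by
    rw [equations, Fintype.prod_sum_type]
    simp only [Sum.elim_inl, Sum.elim_inr]
  rw [substitute, hequations, sumOut_sum, sumOut_comm, substitute_liftTerms]
  simp only [sumOut_mul, rename_equations, rename_mul, rename_prod, Term.rename_equation,
    rename_rename, mul_assoc]
  congr 3
  congr 1
  funext x
  rcases x with _ | _ <;> rfl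

lemma substitute_sumOut (q : Diagram (C ⊕ K)) (t : C → Term V) :
    substitute (sumOut K q) t = sumOut K (substitute q (liftTerms t)) := by
  simp only [substitute_liftTerms]
  rw [substitute, rename_sumOut, sumOut_mul, sumOut_comm]
  simp only [rename_equations, rename_mul, rename_prod, Term.rename_equation, rename_rename]
  congr 4
  funext x
  rcases x with _ | _ <;> rfl

lemma liftTerms_var {K : Type} [Finite K] : liftTerms (K := K) (var : V → Term V) = var := by
  funext x
  rcases x with _ | _
  · exact Term.map_var _ _
  · rfl

lemma sumOut_mul_equations [Fintype V] (q : Diagram (V ⊕ K)) (s : K → Term V) :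
    sumOut K (q * equations s) = substitute q (Sum.elim var s) := by
  rw [substitute_elim, liftTerms_var]
  congr 2
  exact (rename_id q).symm.trans (substitute_var q id).symm

lemma rename_substitute_liftTerms (f : Term A) (t : A → Term V) (g : V → X) (y : X) :
    rename (Sum.elim g fun _ => y) (substitute f.val (liftTerms t)) =
      substitute f.val (Sum.elim (fun a => (t a).map g) fun _ => var y) := by
  rw [rename_substitute]
  congr 1
  funext x
  rcases x with a | _
  · exact Term.map_map _ _ _
  · exact Term.map_var _ _

/-- The term `f` with the terms `t` substituted for its variables. -/
noncomputable def Term.comp (f : Term A) (t : A → Term V) : Term V where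
  val := substitute f.val (liftTerms t)
  copy := by
    have hrename : ∀ b : Bool, rename (Sum.map id fun _ => b) (substitute f.val (liftTerms t)) =
        substitute (rename (Sum.map id fun _ => b) f.val) (liftTerms t) := by
      intro b
      have hmap : (Sum.map id fun _ : Unit => b) =
          Sum.elim (Sum.inl : V → V ⊕ Bool) fun _ => Sum.inr b := by
        funext x; rcases x with _ | _ <;> rfl
      rw [hmap, rename_substitute_liftTerms, substitute_rename]
      congr 1
      funext x
      rcases x with _ | _ <;> rfl
    have hdelta : delta (Sum.inr false : V ⊕ Bool) (Sum.inr true) =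
        substitute (delta (Sum.inr false : A ⊕ Bool) (Sum.inr true)) (liftTerms t) := by
      rw [delta, delta, substitute_rename, ← substitute_var]
      congr 1
      funext x
      cases x <;> rfl
    rw [hrename, hrename, ← substitute_mul, f.copy, substitute_mul, hdelta]
  discard := by rw [← substitute_sumOut, f.discard, substitute_one]

lemma Term.comp_equation (f : Term A) (t : A → Term V) (g : V → X) (y : X) :
    (f.comp t).equation g y = substitute f.val (Sum.elim (fun a => (t a).map g) fun _ => var y) :=
  rename_substitute_liftTerms f t g y

lemma substitute_elim_comp (q : Diagram (C ⊕ Unit)) (s : C → Term V) (f : Term A) (t : A → Term V) :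
    substitute q (Sum.elim s fun _ => f.comp t) =
      substitute (sumOut Unit (rename (Sum.map Sum.inl id) q * rename (Sum.map Sum.inr id) f.val))
        (Sum.elim s t) := by
  have hequations : equations (fun _ : Unit => f.comp t) = substitute f.val (liftTerms t) := by
    rw [equations, Fintype.prod_unique]
    exact Term.equation_self _
  rw [substitute_elim, hequations, substitute_sumOut, substitute_mul, substitute_rename,
    substitute_rename]
  congr 3 <;> (funext x; rcases x with _ | _ <;> rfl)

end

/-! ### The generators as diagrams with variables -/

section
variable {B C K L L' M T W X : Type} [Finite C] [Finite L] [Finite L'] [Finite M] [Finite T]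
  [Finite W] [Finite X] [Finite B]

/-- The H-box with label `a`, whose legs carry the variables `f`. -/
noncomputable def hBox (a : ℂ) (f : L → X) : Diagram X := rename f ⟦H a L⟧

/-- The scalar `a`, which is the legless H-box with label `a`. -/
noncomputable def scalar (a : ℂ) : Diagram X := hBox a (Empty.elim : Empty → X)

/-- The unlabelled binary H-box between the variables `x` and `y`. -/
noncomputable def hEdge (x y : X) : Diagram X := hBox (-1) fun t => bif t then y else x

lemma rename_congr {f g : L → X} (h : ∀ l, f l = g l) (q : Diagram L) :
    rename f q = rename g q := by
  rw [funext h]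

lemma hBox_congr (a : ℂ) {f g : L → X} (h : ∀ l, f l = g l) : hBox a f = hBox a g :=
  rename_congr h _

lemma rename_hBox (a : ℂ) (f : L → X) (g : X → B) : rename g (hBox a f) = hBox a fun l => g (f l) :=
  rename_rename _ _ _

lemma rename_equiv_H (a : ℂ) (e : L ≃ L') : rename e (⟦H a L⟧ : Diagram L) = ⟦H a L'⟧ := by
  rw [← reindex_eq_rename, reindex_H]

lemma hBox_equiv (a : ℂ) (e : L ≃ L') (f : L' → X) : hBox a (fun l => f (e l)) = hBox a f := by
  rw [hBox, hBox, ← rename_equiv_H a e, rename_rename]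

lemma hBox_of_isEmpty [IsEmpty L] (a : ℂ) (f : L → X) : hBox a f = scalar a := by
  rw [scalar, ← hBox_equiv a (Equiv.equivEmpty L)]
  exact hBox_congr a isEmptyElim

lemma rename_scalar (a : ℂ) (g : X → B) : rename g (scalar a) = scalar a := by
  rw [scalar, rename_hBox, hBox_of_isEmpty]

lemma rename_hEdge (x y : X) (g : X → B) : rename g (hEdge x y) = hEdge (g x) (g y) := by
  rw [hEdge, rename_hBox]
  exact hBox_congr _ fun t => by cases t <;> rfl

lemma hEdge_comm (x y : X) : hEdge x y = hEdge y x := by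
  rw [hEdge, hEdge, ← hBox_equiv _ Equiv.boolNot]
  exact hBox_congr _ fun t => by cases t <;> rfl

lemma mk_scale (a : ℂ) (D : ZH B) : (⟦scale a D⟧ : Diagram B) = ⟦D⟧ * scalar a := by
  rw [scale, ← reindex_mk, ← tensorPair_mk, reindex_eq_rename, mul_eq_rename_tensorPair, scalar,
    hBox, ← rename_id (⟦D⟧ : Diagram B), tensorPair_rename, rename_rename, rename_id]
  refine rename_congr (fun x => ?_) _
  rcases x with _ | x
  · rfl
  · exact x.elim

lemma mk_eq_of_rule {B : Type} {D E : ZH B} (h : Rule D E) : (⟦D⟧ : Diagram B) = ⟦E⟧ :=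
  Quotient.sound (ZHEq.rule h)

lemma rename_Z_option [Fintype M] (f : Option M → X) :
    rename f (⟦Z (Option M)⟧ : Diagram _) = ∏ m, delta (f none) (f (some m)) := by
  have hZ := Z_eq_sumOut_prod_delta (Option M)
  rw [Fintype.prod_option, mul_comm] at hZ
  have hsum := sumOut_mul_prod_delta (fun _ : Unit => (none : Option M))
    (∏ m : M, delta (Sum.inr () : Option M ⊕ Unit) (Sum.inl (some m)))
  rw [Fintype.prod_unique (ι := Unit), delta_comm] at hsum
  rw [hZ, hsum, rename_rename, rename_prod]
  simp only [rename_delta]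
  rfl

lemma sumOut_mul_prod_delta_subst [Fintype K] (σ : W ≃ C ⊕ K) (h : K → B ⊕ C)
    (q : Diagram (B ⊕ W)) :
    sumOut W (q * ∏ k, delta (Sum.map id (fun c => σ.symm (Sum.inl c)) (h k))
        (Sum.inr (σ.symm (Sum.inr k)))) =
      sumOut C (rename (Sum.elim Sum.inl fun w => Sum.elim Sum.inr h (σ w)) q) := by
  have : Fintype C := Fintype.ofFinite C
  rw [← sumOut_equiv σ, sumOut_sum, rename_mul, rename_mul, rename_prod, rename_prod]
  simp only [rename_delta]
  have hinl (k : K) : (Equiv.sumAssoc B C K).symm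
      (Sum.map id σ (Sum.map id (fun c => σ.symm (Sum.inl c)) (h k))) = Sum.inl (h k) := by
    rcases h k with _ | _ <;> simp
  simp only [hinl, Sum.map_inr, Equiv.apply_symm_apply, Equiv.sumAssoc_symm_apply_inr_inr]
  rw [sumOut_mul_prod_delta, rename_rename, rename_rename]
  congr 1
  refine rename_congr (fun x => ?_) _
  rcases x with _ | w
  · rfl
  · simp only [Sum.map_inr, Sum.elim_inr]
    rcases σ w with _ | _ <;> rfl

/-! ### Nodes of a graph -/

lemma mk_graph_eq_sumOut_prod {ι : Type} [Fintype ι] {node : ι → Spider} {bdry : B → ι}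
    {src tgt : W → ι} (q : ι → Diagram (B ⊕ W))
    (h : ∀ i, rename (fun l : {p // Sum.elim bdry (fun p : W × Bool =>
        bif p.2 then tgt p.1 else src p.1) p = i} => Sum.map id Prod.fst l.1)
        (⟦node i _⟧ : Diagram _) = q i) :
    (⟦graph node bdry src tgt⟧ : Diagram B) = sumOut W (∏ i, q i) := by
  rw [graph_eq_sumOut_prod]
  simp only [h]

/-- A spider is natural if its legs are interchangeable and can be relabelled by any bijection. The
legs of a node of a graph form a subtype of the ends of wires, which is thereby replaced with a
more convenient type. -/
structure Spider.IsNatural (S : Spider) : Prop where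
  rename_equiv {L L' : Type} [Finite L] [Finite L'] (e : L ≃ L') :
    rename e (⟦S L⟧ : Diagram L) = ⟦S L'⟧

lemma zSp_isNatural : zSp.IsNatural where
  rename_equiv e := by
    rw [← reindex_eq_rename]
    exact reindex_Z e

lemma hSp_isNatural (a : ℂ) : (hSp a).IsNatural := ⟨rename_equiv_H a⟩

lemma Spider.IsNatural.rename_fiber {S : Spider} (hS : S.IsNatural) {P : T → Prop} {f : T → X}
    {g : M → X} (j : M → T) (hj : Function.Injective j) (hP : ∀ t, P t ↔ ∃ m, j m = t)
    (hg : ∀ m, f (j m) = g m) :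
    rename (fun l : {t // P t} => f l.1) ⟦S {t // P t}⟧ = rename g ⟦S M⟧ := by
  let e : M ≃ {t // P t} := Equiv.ofBijective (fun m => ⟨j m, (hP _).2 ⟨m, rfl⟩⟩)
    ⟨fun _ _ h => hj (congrArg Subtype.val h), fun t => ((hP _).1 t.2).imp fun _ h => Subtype.ext h⟩
  rw [← hS.rename_equiv e, rename_rename]
  exact rename_congr hg _

lemma rename_zSp_fiber [Fintype M] {P : T → Prop} {f : T → X} {x : X} {g : M → X} (t₀ : T)
    (j : M → T) (hj : Function.Injective j) (h₀ : ∀ m, j m ≠ t₀)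
    (hP : ∀ t, P t ↔ t = t₀ ∨ ∃ m, j m = t) (hx : f t₀ = x) (hg : ∀ m, f (j m) = g m) :
    rename (fun l : {t // P t} => f l.1) ⟦zSp {t // P t}⟧ = ∏ m, delta x (g m) := by
  refine (zSp_isNatural.rename_fiber (g := fun m : Option M => m.elim x g)
    (fun m => m.elim t₀ j) ?_ (fun t => ?_) ?_).trans (rename_Z_option _)
  · rintro (_ | m) (_ | m') h
    · rfl
    · exact (h₀ _ h.symm).elim
    · exact (h₀ _ h).elim
    · exact congrArg _ (hj h)
  · rw [hP, Option.exists]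
    simp [eq_comm]
  · rintro (_ | m)
    exacts [hx, hg m]

lemma mk_graph_pair {S S' : Spider} (hS : S.IsNatural) (hS' : S'.IsNatural) (M N : Type) [Finite M]
    [Finite N] :
    (⟦graph (ι := Bool) (fun t => bif t then S' else S)
        (Sum.elim (fun _ : M => false) (fun _ : N => true))
        (fun _ : Unit => false) (fun _ => true)⟧ : Diagram (M ⊕ N)) =
      sumOut Unit (rename (Sum.elim (fun m => Sum.inl (Sum.inl m)) Sum.inr) ⟦S (M ⊕ Unit)⟧ *
        rename (Sum.elim (fun n => Sum.inl (Sum.inr n)) Sum.inr) ⟦S' (N ⊕ Unit)⟧) := by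
  rw [mk_graph_eq_sumOut_prod fun t => bif t then
      rename (Sum.elim (fun n => Sum.inl (Sum.inr n)) Sum.inr) ⟦S' (N ⊕ Unit)⟧ else
      rename (Sum.elim (fun m => Sum.inl (Sum.inl m)) Sum.inr) ⟦S (M ⊕ Unit)⟧,
    Fintype.prod_bool, cond_true, cond_false, mul_comm]
  rintro (_ | _)
  · refine hS.rename_fiber
      (Sum.elim (fun m => Sum.inl (Sum.inl m)) fun _ => Sum.inr ((), false)) ?_ ?_ ?_
    · rintro (_ | _) (_ | _) h <;> simp at h <;> simp [h]
    · rintro ((m' | n') | ⟨_, _ | _⟩) <;> simp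
    · rintro (_ | _) <;> rfl
  · refine hS'.rename_fiber
      (Sum.elim (fun n => Sum.inl (Sum.inr n)) fun _ => Sum.inr ((), true)) ?_ ?_ ?_
    · rintro (_ | _) (_ | _) h <;> simp at h <;> simp [h]
    · rintro ((m' | n') | ⟨_, _ | _⟩) <;> simp
    · rintro (_ | _) <;> rfl

lemma mk_graph_completeBipartite {S : Spider} (hS : S.IsNatural) (M N : Type) [Finite M]
    [Fintype N] :
    (⟦graph (Sum.elim (fun _ : M => zSp) (fun _ : N => S)) id
        (fun p : M × N => Sum.inl p.1) (fun p => Sum.inr p.2)⟧ : Diagram (M ⊕ N)) =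
      ∏ n : N, rename (Sum.elim Sum.inl fun _ => Sum.inr n) ⟦S (M ⊕ Unit)⟧ := by
  have := Fintype.ofFinite M
  rw [mk_graph_eq_sumOut_prod (Sum.elim
      (fun m => ∏ n, delta (Sum.inl (Sum.inl m)) (Sum.inr (m, n)))
      fun n => rename (Sum.elim (fun m => Sum.inr (m, n)) fun _ => Sum.inl (Sum.inr n))
        ⟦S (M ⊕ Unit)⟧), Fintype.prod_sum_type]
  · simp only [Sum.elim_inl, Sum.elim_inr]
    rw [← Fintype.prod_prod_type', mul_comm]
    refine (sumOut_mul_prod_delta (fun p : M × N => (Sum.inl p.1 : M ⊕ N)) _).trans ?_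
    rw [rename_prod]
    refine Finset.prod_congr rfl fun n _ => ?_
    rw [rename_rename]
    exact rename_congr (by rintro (_ | _) <;> rfl) _
  · rintro (m | n)
    · refine rename_zSp_fiber (Sum.inl (Sum.inl m)) (fun n => Sum.inr ((m, n), false)) ?_ ?_ ?_ rfl
        fun _ => rfl
      · intro n n' h
        simpa using h
      · simp
      · rintro ((m' | n') | ⟨⟨m', n'⟩, _ | _⟩) <;> simp [eq_comm]
    · refine hS.rename_fiber
        (Sum.elim (fun m => Sum.inr ((m, n), true)) fun _ => Sum.inl (Sum.inr n)) ?_ ?_ ?_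
      · rintro (_ | _) (_ | _) h <;> simp at h <;> simp [h]
      · rintro ((m' | n') | ⟨⟨m', n'⟩, _ | _⟩) <;> simp [eq_comm]
      · rintro (_ | _) <;> rfl

end

/-! ### The derived generators -/

section
variable {B L L' X : Type} [Fintype L] [Fintype L'] [Finite X] [Finite B]

/-- The grey spider, whose legs carry the variables `f`. -/
noncomputable def greySpider (f : L → X) : Diagram X :=
  scalar (1 / 2) * sumOut Unit (∏ l, hEdge (Sum.inr ()) (Sum.inl (f l)))

lemma rename_greySpider (f : L → X) (g : X → B) :
    rename g (greySpider f) = greySpider fun l => g (f l) := by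
  rw [greySpider, rename_mul, rename_scalar, rename_sumOut, rename_prod, greySpider]
  simp only [rename_hEdge]
  rfl

lemma greySpider_equiv (e : L ≃ L') (f : L' → X) :
    greySpider (fun l => f (e l)) = greySpider f := by
  rw [greySpider, Equiv.prod_comp e fun l => hEdge (Sum.inr ()) (Sum.inl (f l)), greySpider]

lemma mk_xSp_eq_sumOut_prod (L : Type) [Fintype L] :
    (⟦xSp L⟧ : Diagram L) = sumOut L ((∏ l, hEdge (Sum.inl l) (Sum.inr l)) *
      (rename Sum.inr ⟦Z L⟧ * scalar (1 / 2))) := by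
  rw [xSp, mk_graph_eq_sumOut_prod (Sum.elim (fun l => hEdge (Sum.inl l) (Sum.inr l))
    fun t => bif t then rename Sum.inr ⟦Z L⟧ else scalar (1 / 2)), Fintype.prod_sum_type,
    Fintype.prod_bool]
  · rfl
  · rintro (l | _ | _)
    · refine (hSp_isNatural (-1)).rename_fiber
        (fun t : Bool => bif t then Sum.inr (l, true) else Sum.inl l) ?_ ?_ ?_
      · rintro (_ | _) (_ | _) h <;> first | rfl | cases h
      · rintro (l' | ⟨l', _ | _⟩) <;> simp [eq_comm]
      · rintro (_ | _) <;> rfl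
    · refine (hSp_isNatural (1 / 2)).rename_fiber (Empty.elim : Empty → _) ?_ ?_ ?_
      · exact fun x => x.elim
      · rintro (l' | ⟨l', _ | _⟩) <;> simp
      · exact fun x => x.elim
    · refine zSp_isNatural.rename_fiber (fun l => Sum.inr (l, false)) ?_ ?_ fun _ => rfl
      · intro l l' h
        simpa using h
      · rintro (l' | ⟨l', _ | _⟩) <;> simp

lemma mk_xSp (L : Type) [Fintype L] : (⟦xSp L⟧ : Diagram L) = greySpider id := by
  rw [mk_xSp_eq_sumOut_prod, greySpider, ← mul_assoc, ← rename_scalar (X := L) _ Sum.inl,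
    ← sumOut_mul, mul_comm]
  congr 1
  rw [Z_eq_sumOut_prod_delta, rename_sumOut, rename_prod, mul_comm, sumOut_mul, sumOut_comm,
    rename_mul, rename_prod, rename_prod, rename_prod]
  simp only [rename_delta, rename_hEdge, Sum.map_inr, Sum.map_inl]
  rw [mul_comm]
  refine (congrArg (sumOut Unit) (sumOut_mul_prod_delta (fun _ => Sum.inr ()) _)).trans ?_
  rw [rename_prod]
  simp only [rename_hEdge]
  rw [Finset.prod_congr rfl fun l _ => hEdge_comm _ _]
  rfl

lemma rename_xSp (f : L → X) : rename f ⟦xSp L⟧ = greySpider f := by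
  rw [mk_xSp, rename_greySpider]
  rfl

lemma xSp_isNatural : xSp.IsNatural where
  rename_equiv {L L'} _ _ e := by
    have := Fintype.ofFinite L
    have := Fintype.ofFinite L'
    rw [rename_xSp, mk_xSp]
    exact greySpider_equiv e id

lemma mk_notSp_eq_sumOut_prod (L : Type) [Fintype L] :
    (⟦notSp L⟧ : Diagram L) = sumOut (Option L) ((∏ l, hEdge (Sum.inl l) (Sum.inr (some l))) *
      ((∏ l, delta (Sum.inr none) (Sum.inr (some l))) * hBox (-1) (fun _ : Unit => Sum.inr none) *
        scalar (1 / 2))) := by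
  rw [notSp, mk_graph_eq_sumOut_prod (Sum.elim (fun l => hEdge (Sum.inl l) (Sum.inr (some l)))
    ![∏ l, delta (Sum.inr none) (Sum.inr (some l)), hBox (-1) fun _ : Unit => Sum.inr none,
      scalar (1 / 2)]), Fintype.prod_sum_type, Fin.prod_univ_three]
  · rfl
  rintro (l | i)
  · refine (hSp_isNatural (-1)).rename_fiber
      (fun t : Bool => bif t then Sum.inr (some l, true) else Sum.inl l) ?_ ?_ ?_
    · rintro (_ | _) (_ | _) h <;> first | rfl | cases h
    · rintro (l' | ⟨_ | l', _ | _⟩) <;> simp [eq_comm]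
    · rintro (_ | _) <;> rfl
  fin_cases i
  · refine rename_zSp_fiber (Sum.inr (none, false)) (fun l => Sum.inr (some l, false)) ?_ ?_ ?_ rfl
      fun _ => rfl
    · intro l l' h
      simpa using h
    · simp
    · rintro (l' | ⟨_ | l', _ | _⟩) <;> simp
  · refine (hSp_isNatural (-1)).rename_fiber (fun _ : Unit => Sum.inr (none, true)) ?_ ?_
      fun _ => rfl
    · exact Function.injective_of_subsingleton _
    · rintro (l' | ⟨_ | l', _ | _⟩) <;> simp
  · refine (hSp_isNatural (1 / 2)).rename_fiber (Empty.elim : Empty → _) ?_ ?_ ?_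
    · exact fun x => x.elim
    · rintro (l' | ⟨_ | l', _ | _⟩) <;> simp
    · exact fun x => x.elim

lemma mk_notSp (L : Type) [Fintype L] : (⟦notSp L⟧ : Diagram L) =
    scalar (1 / 2) * sumOut Unit
      (hBox (-1) (fun _ : Unit => Sum.inr ()) * ∏ l, hEdge (Sum.inr ()) (Sum.inl l)) := by
  rw [mk_notSp_eq_sumOut_prod, mul_comm, mul_assoc, mul_assoc, mul_comm]
  have hsubst := sumOut_mul_prod_delta_subst (B := L)
    ((Equiv.optionEquivSumPUnit L).trans (Equiv.sumComm L Unit)) (fun _ => Sum.inr ())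
    (hBox (-1) (fun _ : Unit => Sum.inr none) *
      (scalar (1 / 2) * ∏ l, hEdge (Sum.inl l) (Sum.inr (some l))))
  simp only [Equiv.symm_trans_apply, Equiv.sumComm_symm, Equiv.sumComm_apply,
    Sum.map_inr, Sum.swap_inl, Sum.swap_inr, Equiv.optionEquivSumPUnit_symm_inl,
    Equiv.optionEquivSumPUnit_symm_inr] at hsubst
  rw [hsubst, rename_mul, rename_mul, rename_scalar, rename_hBox, rename_prod]
  simp only [rename_hEdge]
  rw [mul_left_comm, ← rename_scalar (X := L) (1 / 2) Sum.inl, mul_comm, ← sumOut_mul, mul_comm]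
  simp only [hEdge_comm]
  rfl

lemma notSp_isNatural : notSp.IsNatural where
  rename_equiv {L L'} _ _ e := by
    have := Fintype.ofFinite L
    have := Fintype.ofFinite L'
    rw [mk_notSp, mk_notSp, rename_mul, rename_scalar, rename_sumOut, rename_mul, rename_hBox,
      rename_prod, ← Equiv.prod_comp e fun l => hEdge (Sum.inr ()) (Sum.inl l)]
    simp only [rename_hEdge]
    rfl

/-- The NOT gate between the variables `x` and `y`. -/
noncomputable def notEdge (x y : X) : Diagram X := rename (fun t => bif t then y else x) ⟦notGate⟧

lemma notEdge_eq (x y : X) : notEdge x y =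
    scalar (1 / 2) * sumOut Unit (hBox (-1) (fun _ : Unit => Sum.inr ()) *
      (hEdge (Sum.inr ()) (Sum.inl x) * hEdge (Sum.inr ()) (Sum.inl y))) := by
  rw [notEdge, notGate, mk_notSp, rename_mul, rename_scalar, rename_sumOut, rename_mul, rename_hBox,
    rename_prod]
  simp only [rename_hEdge]
  rw [Fintype.prod_bool, mul_comm (hEdge _ _) (hEdge _ _)]
  rfl

lemma rename_notEdge (x y : X) (g : X → B) : rename g (notEdge x y) = notEdge (g x) (g y) := by
  rw [notEdge, rename_rename]
  exact rename_congr (fun t => by cases t <;> rfl) _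

end

/-! ### The rules as equations -/

section
variable {M N X : Type} [Finite X]

lemma bialgebra_grey [Fintype M] [Fintype N] :
    sumOut Unit (greySpider (Sum.elim (fun m : M => (Sum.inl (Sum.inl m) : (M ⊕ N) ⊕ Unit))
      Sum.inr) * ∏ n, delta (Sum.inr ()) (Sum.inl (Sum.inr n))) = ∏ n : N,
      greySpider (Sum.elim Sum.inl fun _ : Unit => Sum.inr n : M ⊕ Unit → M ⊕ N) := by
  have hrule := mk_eq_of_rule (Rule.BA1 M N)
  rw [mk_graph_pair xSp_isNatural zSp_isNatural, mk_graph_completeBipartite xSp_isNatural,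
    rename_xSp] at hrule
  simp only [rename_xSp] at hrule
  have hZ : rename (Sum.elim (fun n => Sum.inl (Sum.inr n)) Sum.inr : N ⊕ Unit → (M ⊕ N) ⊕ Unit)
      ⟦zSp (N ⊕ Unit)⟧ = ∏ n, delta (Sum.inr ()) (Sum.inl (Sum.inr n)) := by
    rw [← zSp_isNatural.rename_equiv (Equiv.optionEquivSumPUnit N), rename_rename]
    exact rename_Z_option _
  rw [← hZ, hrule]

lemma bialgebra_hBox [Finite M] [Fintype N] :
    sumOut Unit (hBox (-1) (Sum.elim (fun m : M => (Sum.inl (Sum.inl m) : (M ⊕ N) ⊕ Unit))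
      Sum.inr) * greySpider (Sum.elim (fun n : N => Sum.inl (Sum.inr n)) Sum.inr)) = ∏ n : N,
      hBox (-1) (Sum.elim Sum.inl fun _ : Unit => Sum.inr n : M ⊕ Unit → M ⊕ N) := by
  have hrule := mk_eq_of_rule (Rule.BA2 M N)
  rwa [mk_graph_pair (hSp_isNatural (-1)) xSp_isNatural,
    mk_graph_completeBipartite (hSp_isNatural (-1)), rename_xSp] at hrule

lemma hBox_fusion (a : ℂ) [Finite M] [Finite N] :
    sumOut Bool (hBox a (Sum.elim (fun m : M => (Sum.inl (Sum.inl m) : (M ⊕ N) ⊕ Bool))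
          fun _ : Unit => Sum.inr false) *
        hEdge (Sum.inr false) (Sum.inr true) *
        hBox (-1) (Sum.elim (fun n : N => (Sum.inl (Sum.inr n) : (M ⊕ N) ⊕ Bool))
          fun _ : Unit => Sum.inr true)) =
      hBox a (id : M ⊕ N → M ⊕ N) * scalar 2 := by
  have hrule := mk_eq_of_rule (Rule.HS1 (B := M ⊕ N) a (Sum.elim (fun _ => false) fun _ => true))
  rw [mk_scale, mk_graph_eq_sumOut_prod
    ![hBox a (Sum.elim (fun m : M => Sum.inl (Sum.inl m)) fun _ : Unit => Sum.inr 0),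
      hEdge (Sum.inr 0) (Sum.inr 1),
      hBox (-1) (Sum.elim (fun n : N => Sum.inl (Sum.inr n)) fun _ : Unit => Sum.inr 1)],
    Fin.prod_univ_three, ← sumOut_equiv finTwoEquiv] at hrule
  · simp only [Matrix.cons_val, rename_mul, rename_hBox, rename_hEdge] at hrule
    have hid : hBox a (id : M ⊕ N → M ⊕ N) = ⟦H a (M ⊕ N)⟧ := rename_id _
    rw [hid, ← hrule]
    congr 2
    · congr 1
      exact hBox_congr a (by rintro (_ | _) <;> rfl)
    · exact hBox_congr (-1) (by rintro (_ | _) <;> rfl)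
  · intro i
    fin_cases i
    · refine (hSp_isNatural a).rename_fiber
        (Sum.elim (fun m => Sum.inl (Sum.inl m)) fun _ : Unit => Sum.inr (0, false)) ?_ ?_ ?_
      · rintro (_ | _) (_ | _) hrule <;> simp at hrule <;> simp [hrule]
      · rintro ((m' | n') | ⟨i, _ | _⟩) <;> try fin_cases i
        all_goals simp
      · rintro (_ | _) <;> rfl
    · refine (hSp_isNatural (-1)).rename_fiber
        (fun t : Bool => bif t then Sum.inr (1, false) else Sum.inr (0, true)) ?_ ?_ ?_
      · rintro (_ | _) (_ | _) hrule <;> simp at hrule <;> simp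
      · rintro ((m' | n') | ⟨i, _ | _⟩) <;> try fin_cases i
        all_goals simp
      · rintro (_ | _) <;> rfl
    · refine (hSp_isNatural (-1)).rename_fiber
        (Sum.elim (fun n => Sum.inl (Sum.inr n)) fun _ : Unit => Sum.inr (1, true)) ?_ ?_ ?_
      · rintro (_ | _) (_ | _) hrule <;> simp at hrule <;> simp [hrule]
      · rintro ((m' | n') | ⟨i, _ | _⟩) <;> try fin_cases i
        all_goals simp
      · rintro (_ | _) <;> rfl

lemma sumOut_hEdge_mul_hEdge (x y : X) :
    sumOut Unit (hEdge (Sum.inl x) (Sum.inr ()) * hEdge (Sum.inr ()) (Sum.inl y)) =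
      delta x y * scalar 2 := by
  have hrule := mk_eq_of_rule Rule.HS2
  rw [mk_scale, mk_graph_eq_sumOut_prod fun t => bif t then hEdge (Sum.inr ()) (Sum.inl true)
    else hEdge (Sum.inl false) (Sum.inr ()), Fintype.prod_bool, mul_comm] at hrule
  · have hxy := congrArg (rename fun t : Bool => bif t then y else x) hrule
    rw [rename_sumOut, rename_mul, rename_mul, rename_scalar] at hxy
    simp only [cond_true, cond_false, rename_hEdge] at hxy
    exact hxy
  · rintro (_ | _)
    · exact (hSp_isNatural (-1)).rename_fiber
        (fun t : Bool => bif t then Sum.inr ((), false) else Sum.inl false) (by decide) (by decide)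
        (by decide)
    · exact (hSp_isNatural (-1)).rename_fiber
        (fun t : Bool => bif t then Sum.inl true else Sum.inr ((), true)) (by decide) (by decide)
        (by decide)

lemma hBox_mul (a b : ℂ) (f : Unit → X) : hBox a f * hBox b f = hBox (a * b) f := by
  have hrule := mk_eq_of_rule (Rule.M a b)
  rw [mk_graph_eq_sumOut_prod ![∏ i : Fin 2, delta (Sum.inl ()) (Sum.inr i),
    hBox a fun _ : Unit => Sum.inr 0, hBox b fun _ : Unit => Sum.inr 1], Fin.prod_univ_three,
    mul_assoc, mul_comm] at hrule
  · have hunit := (sumOut_mul_prod_delta (fun _ : Fin 2 => ())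
      (hBox a (fun _ : Unit => Sum.inr 0) * hBox b fun _ : Unit => Sum.inr 1)).symm.trans hrule
    have hf := congrArg (rename f) hunit
    rw [rename_mul, rename_mul] at hf
    simp only [rename_hBox] at hf
    exact hf
  · intro i
    fin_cases i
    · exact rename_zSp_fiber (Sum.inl ()) (fun i => Sum.inr (i, false)) (by decide) (by decide)
        (by decide) rfl fun _ => rfl
    · exact (hSp_isNatural a).rename_fiber (fun _ : Unit => Sum.inr (0, true)) (by decide)
        (by decide) fun _ => rfl
    · exact (hSp_isNatural b).rename_fiber (fun _ : Unit => Sum.inr (1, true)) (by decide)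
        (by decide) fun _ => rfl

lemma hBox_one (f : Unit → X) : hBox 1 f = 1 := by
  have hcopies := Z_eq_sumOut_prod_delta Unit
  rw [Fintype.prod_unique, delta_comm] at hcopies
  rw [hBox, mk_eq_of_rule Rule.U, hcopies, sumOut_delta (), rename_one]

end

/-! ### Intro and ortho -/

section
variable {X : Type} [Finite X]

lemma sumOut_empty {B : Type} [Finite B] (q : Diagram (B ⊕ Empty)) :
    sumOut Empty q = rename (Sum.elim id Empty.elim) q := by
  simpa using sumOut_mul_prod_delta (Empty.elim : Empty → B) q

lemma mk_intro_left (a : ℂ) :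
    (⟦graph (ι := Fin 2) ![hSp a, zSp] (id : Fin 2 → Fin 2) (Empty.elim : Empty → Fin 2)
      Empty.elim⟧ : Diagram (Fin 2)) = hBox a fun _ : Unit => 0 := by
  rw [mk_graph_eq_sumOut_prod ![hBox a fun _ : Unit => Sum.inl 0, 1], Fin.prod_univ_two,
    sumOut_empty, rename_mul]
  · simp only [Matrix.cons_val, rename_hBox, rename_one, mul_one]
    rfl
  · intro i
    fin_cases i
    · refine (hSp_isNatural a).rename_fiber (fun _ : Unit => Sum.inl 0) (by decide) ?_ fun _ => rfl
      rintro (i | i)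
      · fin_cases i <;> decide
      · exact i.1.elim
    · refine (rename_zSp_fiber (Sum.inl 1) (Empty.elim : Empty → _) (by decide) (by decide) ?_ rfl
        (g := Empty.elim) (by decide)).trans Finset.prod_empty
      rintro (i | i)
      · fin_cases i <;> decide
      · exact i.1.elim

lemma mk_intro_right_eq_sumOut (a : ℂ) :
    (⟦graph (ι := Fin 5) ![zSp, zSp, hSp a, hSp a, notSp] (![0, 1] : Fin 2 → Fin 5)
      (![0, 1, 0, 1, 4] : Fin 5 → Fin 5) ![2, 2, 3, 4, 3]⟧ : Diagram (Fin 2)) =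
      sumOut (Fin 5)
        (delta (Sum.inl 0) (Sum.inr 0) * delta (Sum.inl 0) (Sum.inr 2) *
          (delta (Sum.inl 1) (Sum.inr 1) * delta (Sum.inl 1) (Sum.inr 3)) *
          (hBox a fun t : Bool => bif t then Sum.inr 1 else Sum.inr 0) *
          (hBox a fun t : Bool => bif t then Sum.inr 4 else Sum.inr 2) *
          notEdge (Sum.inr 3) (Sum.inr 4)) := by
  rw [mk_graph_eq_sumOut_prod ![delta (Sum.inl 0) (Sum.inr 0) * delta (Sum.inl 0) (Sum.inr 2),
    delta (Sum.inl 1) (Sum.inr 1) * delta (Sum.inl 1) (Sum.inr 3),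
    hBox a fun t : Bool => bif t then Sum.inr 1 else Sum.inr 0,
    hBox a fun t : Bool => bif t then Sum.inr 4 else Sum.inr 2, notEdge (Sum.inr 3) (Sum.inr 4)],
    Fin.prod_univ_five]
  · rfl
  · intro i
    fin_cases i
    · exact (rename_zSp_fiber (Sum.inl 0) ![Sum.inr (0, false), Sum.inr (2, false)] (by decide)
        (by decide) (by decide) rfl fun _ => rfl).trans (Fin.prod_univ_two _)
    · exact (rename_zSp_fiber (Sum.inl 1) ![Sum.inr (1, false), Sum.inr (3, false)] (by decide)
        (by decide) (by decide) rfl fun _ => rfl).trans (Fin.prod_univ_two _)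
    · exact (hSp_isNatural a).rename_fiber
        (fun t : Bool => bif t then Sum.inr (1, true) else Sum.inr (0, true)) (by decide)
        (by decide) (by decide)
    · exact (hSp_isNatural a).rename_fiber
        (fun t : Bool => bif t then Sum.inr (4, true) else Sum.inr (2, true)) (by decide)
        (by decide) (by decide)
    · exact notSp_isNatural.rename_fiber
        (fun t : Bool => bif t then Sum.inr (4, false) else Sum.inr (3, true)) (by decide)
        (by decide) (by decide)

lemma mk_intro_right (a : ℂ) :
    (⟦graph (ι := Fin 5) ![zSp, zSp, hSp a, hSp a, notSp] (![0, 1] : Fin 2 → Fin 5)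
      (![0, 1, 0, 1, 4] : Fin 5 → Fin 5) ![2, 2, 3, 4, 3]⟧ : Diagram (Fin 2)) =
      hBox a (fun t : Bool => bif t then 1 else 0) *
        sumOut Unit (hBox a (fun t : Bool => bif t then Sum.inr () else Sum.inl 0) *
          notEdge (Sum.inl 1) (Sum.inr ())) := by
  let σ : Fin 5 ≃ Unit ⊕ Fin 4 :=
    { toFun := ![Sum.inr 0, Sum.inr 1, Sum.inr 2, Sum.inr 3, Sum.inl ()]
      invFun := Sum.elim (fun _ => 4) ![0, 1, 2, 3]
      left_inv := by decide
      right_inv := by decide }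
  have hsubst := sumOut_mul_prod_delta_subst σ ![Sum.inl 0, Sum.inl 1, Sum.inl 0, Sum.inl 1]
    ((hBox a fun t : Bool => bif t then Sum.inr 1 else Sum.inr 0) *
      ((hBox a fun t : Bool => bif t then Sum.inr 4 else Sum.inr 2) *
        notEdge (Sum.inr 3) (Sum.inr 4)) : Diagram (Fin 2 ⊕ Fin 5))
  rw [Fin.prod_univ_four, rename_mul, rename_mul, rename_hBox, rename_hBox,
    rename_notEdge] at hsubst
  have hcomm (p q r s t u v : Diagram (Fin 2 ⊕ Fin 5)) :
      p * q * (r * s) * t * u * v = t * (u * v) * (p * r * q * s) := by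
    ac_rfl
  rw [mk_intro_right_eq_sumOut, hcomm]
  refine hsubst.trans ?_
  rw [mul_comm (hBox a _) (sumOut _ _), sumOut_mul, mul_comm _ (rename _ (hBox a _)), rename_hBox]
  congr 2
  · exact hBox_congr a (by decide)
  · congr 1
    exact hBox_congr a (by decide)

lemma hBox_intro (a : ℂ) (x y : X) :
    hBox a (fun _ : Unit => x) = hBox a (fun t : Bool => bif t then y else x) *
      sumOut Unit (hBox a (fun t : Bool => bif t then Sum.inr () else Sum.inl x) *
        notEdge (Sum.inl y) (Sum.inr ())) := by
  have hrule := mk_eq_of_rule (Rule.I a)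
  rw [mk_intro_left, mk_intro_right] at hrule
  have hxy := congrArg (rename ![x, y]) hrule
  rw [rename_hBox, rename_mul, rename_hBox, rename_sumOut, rename_mul, rename_hBox,
    rename_notEdge] at hxy
  refine hxy.trans (congrArg₂ (· * ·) ?_ (congrArg (fun q => sumOut Unit (q * _)) ?_))
  · exact hBox_congr a fun t => by cases t <;> rfl
  · exact hBox_congr a fun t => by cases t <;> rfl

lemma mk_ortho_left :
    (⟦graph (ι := Fin 5) ![zSp, hSp (-1), hSp (-1), notSp, zSp] (![0, 1, 2] : Fin 3 → Fin 5)
      (![0, 0, 3, 4, 4] : Fin 5 → Fin 5) ![1, 3, 2, 1, 2]⟧ : Diagram (Fin 3)) =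
      sumOut (Fin 5)
        (delta (Sum.inl 0) (Sum.inr 0) * delta (Sum.inl 0) (Sum.inr 1) *
          hBox (-1) ![Sum.inl 1, Sum.inr 0, Sum.inr 3] *
          hBox (-1) ![Sum.inl 2, Sum.inr 2, Sum.inr 4] * notEdge (Sum.inr 1) (Sum.inr 2) *
          delta (Sum.inr 3) (Sum.inr 4)) := by
  rw [mk_graph_eq_sumOut_prod ![delta (Sum.inl 0) (Sum.inr 0) * delta (Sum.inl 0) (Sum.inr 1),
    hBox (-1) ![Sum.inl 1, Sum.inr 0, Sum.inr 3], hBox (-1) ![Sum.inl 2, Sum.inr 2, Sum.inr 4],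
    notEdge (Sum.inr 1) (Sum.inr 2), delta (Sum.inr 3) (Sum.inr 4)], Fin.prod_univ_five]
  · rfl
  · intro i
    fin_cases i
    · exact (rename_zSp_fiber (Sum.inl 0) ![Sum.inr (0, false), Sum.inr (1, false)] (by decide)
        (by decide) (by decide) rfl fun _ => rfl).trans (Fin.prod_univ_two _)
    · exact (hSp_isNatural (-1)).rename_fiber ![Sum.inl 1, Sum.inr (0, true), Sum.inr (3, true)]
        (by decide) (by decide) (by decide)
    · exact (hSp_isNatural (-1)).rename_fiber ![Sum.inl 2, Sum.inr (2, true), Sum.inr (4, true)]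
        (by decide) (by decide) (by decide)
    · exact notSp_isNatural.rename_fiber
        (fun t : Bool => bif t then Sum.inr (2, false) else Sum.inr (1, true)) (by decide)
        (by decide) (by decide)
    · exact (rename_zSp_fiber (Sum.inr (3, false)) (fun _ : Unit => Sum.inr (4, false)) (by decide)
        (by decide) (by decide) rfl fun _ => rfl).trans (Fintype.prod_unique _)

lemma mk_ortho_right :
    (⟦graph (ι := Fin 6) ![zSp, hSp (-1), hSp (-1), notSp, zSp, zSp] (![0, 1, 2] : Fin 3 → Fin 6)
      (![0, 0, 3, 4, 5] : Fin 5 → Fin 6) ![1, 3, 2, 1, 2]⟧ : Diagram (Fin 3)) =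
      sumOut (Fin 5)
        (delta (Sum.inl 0) (Sum.inr 0) * delta (Sum.inl 0) (Sum.inr 1) *
          hBox (-1) ![Sum.inl 1, Sum.inr 0, Sum.inr 3] *
          hBox (-1) ![Sum.inl 2, Sum.inr 2, Sum.inr 4] * notEdge (Sum.inr 1) (Sum.inr 2)) := by
  rw [mk_graph_eq_sumOut_prod ![delta (Sum.inl 0) (Sum.inr 0) * delta (Sum.inl 0) (Sum.inr 1),
    hBox (-1) ![Sum.inl 1, Sum.inr 0, Sum.inr 3], hBox (-1) ![Sum.inl 2, Sum.inr 2, Sum.inr 4],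
    notEdge (Sum.inr 1) (Sum.inr 2), 1, 1], Fin.prod_univ_six]
  · simp only [Matrix.cons_val, mul_one]
  · intro i
    fin_cases i
    · exact (rename_zSp_fiber (Sum.inl 0) ![Sum.inr (0, false), Sum.inr (1, false)] (by decide)
        (by decide) (by decide) rfl fun _ => rfl).trans (Fin.prod_univ_two _)
    · exact (hSp_isNatural (-1)).rename_fiber ![Sum.inl 1, Sum.inr (0, true), Sum.inr (3, true)]
        (by decide) (by decide) (by decide)
    · exact (hSp_isNatural (-1)).rename_fiber ![Sum.inl 2, Sum.inr (2, true), Sum.inr (4, true)]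
        (by decide) (by decide) (by decide)
    · exact notSp_isNatural.rename_fiber
        (fun t : Bool => bif t then Sum.inr (2, false) else Sum.inr (1, true)) (by decide)
        (by decide) (by decide)
    · exact (rename_zSp_fiber (Sum.inr (3, false)) (Empty.elim : Empty → _) (by decide) (by decide)
        (by decide) rfl (g := Empty.elim) (by decide)).trans Finset.prod_empty
    · exact (rename_zSp_fiber (Sum.inr (4, false)) (Empty.elim : Empty → _) (by decide) (by decide)
        (by decide) rfl (g := Empty.elim) (by decide)).trans Finset.prod_empty

lemma hBox_ortho (x p q : X) :
    sumOut Bool (hBox (-1) ![Sum.inl p, Sum.inl x, Sum.inr true] *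
        (hBox (-1) ![Sum.inl q, Sum.inr false, Sum.inr true] *
          notEdge (Sum.inl x) (Sum.inr false))) =
      sumOut (Fin 3) (hBox (-1) ![Sum.inl p, Sum.inl x, Sum.inr 1] *
        (hBox (-1) ![Sum.inl q, Sum.inr 0, Sum.inr 2] *
          notEdge (Sum.inl x) (Sum.inr 0))) * scalar (1 / 2) := by
  let σ : Fin 5 ≃ Bool ⊕ Fin 3 :=
    { toFun := ![Sum.inr 0, Sum.inr 1, Sum.inl false, Sum.inl true, Sum.inr 2]
      invFun := Sum.elim (fun t => bif t then 3 else 2) ![0, 1, 4]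
      left_inv := by decide
      right_inv := by decide }
  let τ : Fin 5 ≃ Fin 3 ⊕ Fin 2 :=
    { toFun := ![Sum.inr 0, Sum.inr 1, Sum.inl 0, Sum.inl 1, Sum.inl 2]
      invFun := Sum.elim ![2, 3, 4] ![0, 1]
      left_inv := by decide
      right_inv := by decide }
  let core : Diagram (Fin 3 ⊕ Fin 5) := hBox (-1) ![Sum.inl 1, Sum.inr 0, Sum.inr 3] *
    (hBox (-1) ![Sum.inl 2, Sum.inr 2, Sum.inr 4] * notEdge (Sum.inr 1) (Sum.inr 2))
  have hleft := sumOut_mul_prod_delta_subst σ ![Sum.inl 0, Sum.inl 0, Sum.inr true] core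
  have hright := sumOut_mul_prod_delta_subst τ ![Sum.inl 0, Sum.inl 0] core
  rw [Fin.prod_univ_three] at hleft
  rw [Fin.prod_univ_two] at hright
  have hrule := mk_eq_of_rule Rule.O
  have hcomm_right (p q t u v : Diagram (Fin 3 ⊕ Fin 5)) :
      p * q * t * u * v = t * (u * v) * (p * q) := by
    ac_rfl
  have hcomm_left (p q t u v w : Diagram (Fin 3 ⊕ Fin 5)) :
      p * q * t * u * v * w = t * (u * v) * (p * q * w) := by
    ac_rfl
  rw [mk_scale, mk_ortho_left, mk_ortho_right, hcomm_left, hcomm_right] at hrule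
  have hxpq := congrArg (rename ![x, p, q])
    (hleft.symm.trans (hrule.trans (congrArg (· * scalar (1 / 2)) hright)))
  simp only [core, rename_mul, rename_hBox, rename_notEdge, rename_sumOut, rename_scalar] at hxpq
  refine Eq.trans ?_ (hxpq.trans ?_)
  · congr 2
    · exact hBox_congr _ fun i => by fin_cases i <;> rfl
    · congr 1
      exact hBox_congr _ fun i => by fin_cases i <;> rfl
  · congr 3
    · exact hBox_congr _ fun i => by fin_cases i <;> rfl
    · congr 1
      exact hBox_congr _ fun i => by fin_cases i <;> rfl

end

/-! ### Exclusive or, and conjunction -/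

section
variable {L V X K N : Type} [Finite V] [Finite X] [Fintype L] [Fintype K] [Fintype N]

lemma prod_sumOut_unit (q : K → Diagram (X ⊕ Unit)) :
    ∏ k, sumOut Unit (q k) = sumOut K (∏ k, rename (Sum.map id fun _ => k) (q k)) := by
  rw [prod_sumOut, ← sumOut_equiv (Equiv.sigmaPUnit K), rename_prod]
  simp only [rename_rename]
  refine congrArg (sumOut K) (Finset.prod_congr rfl fun _ _ => ?_)
  exact rename_congr (by rintro (_ | _) <;> rfl) _

lemma sumOut_bool (q : Diagram (X ⊕ Bool)) :
    sumOut Bool q = sumOut Unit (sumOut Unit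
      (rename (Sum.elim (fun x => Sum.inl (Sum.inl x))
        fun b => bif b then Sum.inr () else Sum.inl (Sum.inr ())) q)) := by
  rw [← sumOut_equiv Equiv.boolEquivPUnitSumPUnit, sumOut_sumOut, rename_rename]
  congr 3
  funext x
  rcases x with _ | _ | _ <;> rfl

lemma greySpider_congr {f g : L → X} (h : ∀ l, f l = g l) : greySpider f = greySpider g :=
  congrArg greySpider (funext h)

lemma sumOut_greySpider (f : L → X) :
    sumOut Unit (greySpider (Sum.elim (fun l => Sum.inl (f l)) Sum.inr)) = 1 := by
  have hbialgebra :=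
    congrArg (rename (Sum.elim f Empty.elim)) (bialgebra_grey (M := L) (N := Empty))
  simp only [Finset.univ_eq_empty, Finset.prod_empty, mul_one] at hbialgebra
  rw [rename_one, rename_sumOut, rename_greySpider] at hbialgebra
  rw [← hbialgebra]
  congr 1
  exact greySpider_congr (by rintro (_ | _) <;> rfl)

lemma greySpider_pair (x y : X) : greySpider (Sum.elim (fun _ : Unit => x) fun _ : Unit => y) =
    delta x y * (scalar (1 / 2) * scalar 2) := by
  rw [greySpider, Fintype.prod_sum_type, Fintype.prod_unique, Fintype.prod_unique]
  simp only [Sum.elim_inl, Sum.elim_inr]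
  rw [hEdge_comm, sumOut_hEdge_mul_hEdge, mul_left_comm]

-- The equation is first derived in the presence of a variable, which is then summed out.
lemma scalar_half_mul_scalar_two : scalar (1 / 2) * scalar 2 = (1 : Diagram X) := by
  have hunit : scalar (1 / 2) * scalar 2 = (1 : Diagram Unit) := by
    have hscalar :
        sumOut Unit (greySpider (Sum.elim (fun _ => Sum.inl ()) fun _ => Sum.inr ())) = 1 :=
      sumOut_greySpider (fun _ : Unit => ())
    rwa [greySpider_pair, ← rename_scalar (X := Unit) (1 / 2) Sum.inl,
      ← rename_scalar (X := Unit) 2 Sum.inl, ← rename_mul, ← sumOut_mul, sumOut_delta,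
      one_mul] at hscalar
  have hempty : scalar (1 / 2) * scalar 2 = (1 : Diagram Empty) := by
    have hscalar := congrArg (rename (Sum.inr : Unit → Empty ⊕ Unit)) hunit
    rw [rename_mul, rename_scalar, rename_scalar, rename_one] at hscalar
    rw [← one_mul (scalar (1 / 2) * scalar 2 : Diagram Empty),
      ← sumOut_greySpider (Empty.elim : Empty → Empty), sumOut_mul, rename_mul, rename_scalar,
      rename_scalar, hscalar, mul_one]
  have hscalar := congrArg (rename (Empty.elim : Empty → X)) hempty
  rwa [rename_mul, rename_scalar, rename_scalar, rename_one] at hscalar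

lemma greySpider_copy (f : L → X) (y z : X) :
    greySpider (Sum.elim f fun _ : Unit => y) * greySpider (Sum.elim f fun _ : Unit => z) =
      greySpider (Sum.elim f fun _ : Unit => y) * delta y z := by
  have hbialg := bialgebra_grey (M := L) (N := Bool)
  have hsum := sumOut_mul_prod_delta (fun _ : Unit => (Sum.inr false : L ⊕ Bool))
    (greySpider (Sum.elim (fun l => Sum.inl (Sum.inl l)) Sum.inr) *
      delta (Sum.inr ()) (Sum.inl (Sum.inr true)))
  rw [Fintype.prod_unique, delta_comm (Sum.inl _), rename_mul, rename_greySpider,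
    rename_delta] at hsum
  rw [Fintype.prod_bool, Fintype.prod_bool, ← mul_assoc] at hbialg
  have hyz := congrArg (rename (Sum.elim f fun t => bif t then z else y)) (hsum.symm.trans hbialg)
  rw [rename_mul, rename_mul, rename_greySpider, rename_greySpider, rename_greySpider,
    rename_delta, mul_comm (greySpider _) (greySpider _)] at hyz
  refine Eq.trans ?_ (hyz.symm.trans ?_) <;> congr 1 <;>
    exact greySpider_congr (by rintro (_ | _) <;> rfl)

variable (L) in
/-- The exclusive or of the variables in `L`. -/
noncomputable def xorVars : Term L where
  val := greySpider (Sum.elim Sum.inl Sum.inr)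
  copy := by
    have hrename (t : Bool) : rename (Sum.map (id : L → L) fun _ : Unit => t)
        (greySpider (Sum.elim Sum.inl Sum.inr)) =
        greySpider (Sum.elim (Sum.inl : L → L ⊕ Bool) fun _ : Unit => Sum.inr t) := by
      rw [rename_greySpider]
      exact greySpider_congr (by rintro (_ | _) <;> rfl)
    rw [hrename, hrename, greySpider_copy]
  discard := sumOut_greySpider id

/-- The Hadamard transform with respect to the last variable. -/
noncomputable def hadamard (q : Diagram (V ⊕ Unit)) : Diagram (V ⊕ Unit) :=
  sumOut Unit (rename (Sum.map Sum.inl id) q * hEdge (Sum.inl (Sum.inr ())) (Sum.inr ()))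

lemma hadamard_hadamard (q : Diagram (V ⊕ Unit)) : hadamard (hadamard q) = q * scalar 2 := by
  rw [hadamard, hadamard, rename_sumOut, sumOut_mul, sumOut_comm]
  simp only [rename_mul, rename_rename, rename_hEdge, Sum.map_inl, Sum.map_inr, Sum.elim_inl,
    Sum.elim_inr, id]
  have hpair (q' : Diagram ((V ⊕ Unit) ⊕ Unit)) : sumOut Unit (rename Sum.inl q' *
      (hEdge (Sum.inl (Sum.inr ())) (Sum.inr ()) *
        hEdge (Sum.inr ()) (Sum.inl (Sum.inl (Sum.inr ()))))) =
      q' * scalar 2 * ∏ _i : Unit, delta (Sum.inl (Sum.inr ())) (Sum.inr ()) := by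
    rw [mul_comm, ← sumOut_mul, sumOut_hEdge_mul_hEdge, Fintype.prod_unique, delta_comm, mul_comm,
      mul_assoc, mul_comm (scalar 2)]
  have hq := hpair (rename (Sum.map Sum.inl id) q)
  rw [rename_rename] at hq
  rw [mul_assoc, hEdge_comm (Sum.inl (Sum.inl (Sum.inr ()))), hEdge_comm (Sum.inr ())]
  refine (congrArg (sumOut Unit) (Eq.trans ?_ hq)).trans ((sumOut_mul_prod_delta _ _).trans ?_)
  · congr 2
    exact rename_congr (by rintro (_ | _) <;> rfl) _
  · rw [rename_mul, rename_rename, rename_scalar]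
    conv_rhs => rw [← rename_id q]
    congr 1
    exact rename_congr (by rintro (_ | _) <;> rfl) _

lemma hadamard_injective : Function.Injective (hadamard : Diagram (V ⊕ Unit) → _) := fun q r h => by
  have hq : q * scalar 2 * scalar (1 / 2) = r * scalar 2 * scalar (1 / 2) := by
    rw [← hadamard_hadamard, h, hadamard_hadamard]
  rwa [mul_assoc, mul_assoc, mul_comm (scalar 2), scalar_half_mul_scalar_two, mul_one,
    mul_one] at hq

lemma hadamard_mul_rename (q : Diagram (V ⊕ Unit)) (r : Diagram V) :
    hadamard (q * rename Sum.inl r) = hadamard q * rename Sum.inl r := by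
  rw [hadamard, hadamard, sumOut_mul, rename_mul, rename_rename, rename_rename, mul_right_comm]
  rfl

lemma rename_hadamard (g : V → X) (q : Diagram (V ⊕ Unit)) :
    rename (Sum.map g id) (hadamard q) = hadamard (rename (Sum.map g id) q) := by
  rw [hadamard, hadamard, rename_sumOut, rename_mul, rename_hEdge, rename_rename, rename_rename]
  congr 2
  exact rename_congr (by rintro (_ | _) <;> rfl) _

lemma sumOut_hadamard_mul (q r : Diagram (V ⊕ Unit)) :
    sumOut Unit (hadamard q * r) = sumOut Unit (q * hadamard r) := by
  rw [hadamard, hadamard, sumOut_mul, mul_comm q, sumOut_mul, sumOut_comm]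
  simp only [rename_mul, rename_rename, rename_hEdge, Sum.elim_inr]
  rw [rename_congr (g := Sum.inl) (by rintro (_ | _) <;> rfl) q,
    rename_congr (g := Sum.map Sum.inl id) (by rintro (_ | _) <;> rfl) r, mul_right_comm,
    mul_comm (rename _ q), mul_right_comm, hEdge_comm]
  rfl

lemma hadamard_prod_hEdge (f : N → V) :
    hadamard (∏ n, hEdge (Sum.inr ()) (Sum.inl (f n))) * scalar (1 / 2) =
      greySpider (Sum.elim (fun n => Sum.inl (f n)) Sum.inr) := by
  rw [hadamard, rename_prod, greySpider, Fintype.prod_sum_type, Fintype.prod_unique (ι := Unit),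
    mul_comm]
  simp only [rename_hEdge, Sum.elim_inl, Sum.elim_inr]
  rw [hEdge_comm (Sum.inl (Sum.inr ()))]
  rfl

variable (L) in
/-- The diagram of the conjunction of the variables in `L`: the unlabelled H-box is `(-1)` to the
power of the conjunction of all its legs, and the Hadamard transform converts this sign into a
value. -/
noncomputable def andDiagram : Diagram (L ⊕ Unit) := hadamard (hBox (-1) id) * scalar (1 / 2)

lemma hadamard_andDiagram : hadamard (andDiagram L) = hBox (-1) id := by
  rw [andDiagram, ← rename_scalar (X := L) _ Sum.inl, hadamard_mul_rename, hadamard_hadamard,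
    rename_scalar, mul_assoc, mul_comm (scalar 2), scalar_half_mul_scalar_two, mul_one]

lemma sumOut_andDiagram :
    sumOut Unit (rename (Sum.map Sum.inl id) (andDiagram L) *
        ∏ n : N, hEdge (Sum.inr ()) (Sum.inl (Sum.inr n))) =
      ∏ n : N, hBox (-1) (Sum.elim Sum.inl fun _ : Unit => Sum.inr n : L ⊕ Unit → L ⊕ N) := by
  rw [← bialgebra_hBox, ← hadamard_prod_hEdge fun n : N => (Sum.inr n : L ⊕ N), andDiagram,
    rename_mul, rename_hadamard, rename_scalar, mul_right_comm, ← mul_assoc,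
    ← rename_scalar (X := L ⊕ N) _ Sum.inl, ← sumOut_mul, ← sumOut_mul, sumOut_hadamard_mul,
    rename_hBox]
  congr 3

lemma delta_eq_sumOut_hEdge_mul_hEdge (x y : X) :
    delta x y = sumOut Unit (hEdge (Sum.inl x) (Sum.inr ()) * hEdge (Sum.inr ()) (Sum.inl y)) *
      scalar (1 / 2) := by
  rw [sumOut_hEdge_mul_hEdge, mul_assoc, mul_comm (scalar 2), scalar_half_mul_scalar_two, mul_one]

lemma rename_andDiagram (f : L → X) (x : X) :
    rename (Sum.elim f fun _ => x) (andDiagram L) =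
      sumOut Unit (hBox (-1) (Sum.elim (fun l => Sum.inl (f l)) Sum.inr) *
        hEdge (Sum.inl x) (Sum.inr ())) * scalar (1 / 2) := by
  rw [andDiagram, hadamard, rename_mul, rename_scalar, rename_sumOut, rename_mul, rename_hEdge,
    rename_hBox, rename_hBox]
  congr 3
  exact hBox_congr _ (by rintro (_ | _) <;> rfl)

lemma prod_hBox_eq_sumOut_andDiagram (f : L → X) :
    ∏ k : K, hBox (-1) (Sum.elim (fun l => Sum.inl (f l)) fun _ : Unit => Sum.inr k) =
      sumOut Unit (rename (Sum.elim (fun l => Sum.inl (Sum.inl (f l))) Sum.inr) (andDiagram L) *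
        ∏ k : K, hEdge (Sum.inr ()) (Sum.inl (Sum.inr k))) := by
  have hrenamed := congrArg (rename (Sum.elim (fun l => Sum.inl (f l)) Sum.inr : L ⊕ K → X ⊕ K))
    (sumOut_andDiagram (L := L) (N := K))
  rw [rename_prod, rename_sumOut, rename_mul, rename_rename, rename_prod] at hrenamed
  simp only [rename_hBox, rename_hEdge] at hrenamed
  refine Eq.trans ?_ (hrenamed.symm.trans ?_)
  · exact Finset.prod_congr rfl fun k _ => hBox_congr _ (by rintro (_ | _) <;> rfl)
  · congr 2
    exact rename_congr (by rintro (_ | _) <;> rfl) _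

lemma prod_delta_eq_sumOut (s : K → X) (y : X) :
    ∏ k, delta (s k) y = sumOut K (∏ k, hEdge (Sum.inl (s k)) (Sum.inr k) *
      hEdge (Sum.inr k) (Sum.inl y)) * scalar (1 / 2) ^ Fintype.card K := by
  simp only [delta_eq_sumOut_hEdge_mul_hEdge]
  rw [Finset.prod_mul_distrib, prod_sumOut_unit, Finset.prod_const, Finset.card_univ]
  simp only [rename_mul, rename_hEdge]
  rfl

lemma prod_rename_andDiagram (s : K → X) (f : L → X) :
    ∏ k, rename (Sum.elim f fun _ : Unit => s k) (andDiagram L) =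
      sumOut Unit (rename (Sum.elim (fun l => Sum.inl (f l)) Sum.inr) (andDiagram L) *
        ∏ k, delta (Sum.inl (s k)) (Sum.inr ())) := by
  let half : Diagram X := scalar (1 / 2) ^ Fintype.card K
  have hhalf : scalar (1 / 2) ^ Fintype.card K = (rename Sum.inl half : Diagram (X ⊕ Unit)) := by
    rw [← rename_scalar (X := X) (1 / 2) (Sum.inl : X → X ⊕ Unit)]
    exact (map_pow (renameHom _) _ _).symm
  calc ∏ k, rename (Sum.elim f fun _ : Unit => s k) (andDiagram L)
      = sumOut K ((∏ k, hBox (-1) (Sum.elim (fun l => Sum.inl (f l)) fun _ : Unit => Sum.inr k)) *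
          ∏ k, hEdge (Sum.inl (s k)) (Sum.inr k)) * half := by
        simp only [rename_andDiagram]
        rw [Finset.prod_mul_distrib, prod_sumOut_unit, Finset.prod_const, Finset.card_univ,
          ← Finset.prod_mul_distrib]
        congr 2
        refine Finset.prod_congr rfl fun k _ => ?_
        rw [rename_mul, rename_hBox, rename_hEdge]
        congr 1
        exact hBox_congr _ (by rintro (_ | _) <;> rfl)
    _ = sumOut Unit (rename (Sum.elim (fun l => Sum.inl (f l)) Sum.inr) (andDiagram L) *
          ∏ k, delta (Sum.inl (s k)) (Sum.inr ())) := by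
        rw [prod_hBox_eq_sumOut_andDiagram, prod_delta_eq_sumOut, hhalf, ← mul_assoc, ← sumOut_mul]
        congr 1
        rw [sumOut_mul, sumOut_comm, mul_comm (rename _ (andDiagram L)) (sumOut _ _), sumOut_mul]
        congr 2
        simp only [rename_mul, rename_rename, rename_prod, rename_hEdge, Sum.map_inl, Sum.map_inr,
          Sum.elim_inr, Sum.elim_inl, id]
        rw [mul_assoc, ← Finset.prod_mul_distrib, mul_comm]
        congr 1
        · exact Finset.prod_congr rfl fun k _ => by rw [mul_comm, hEdge_comm (Sum.inr k)]
        · exact rename_congr (by rintro (_ | _) <;> rfl) _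

variable (L) in
/-- The conjunction of the variables in `L`. -/
noncomputable def andVars : Term L where
  val := andDiagram L
  copy := by
    have hprod := prod_rename_andDiagram (fun t : Bool => (Sum.inr t : L ⊕ Bool)) Sum.inl
    have hrename (t : Bool) : rename (Sum.map id fun _ : Unit => t) (andDiagram L) =
        rename (Sum.elim Sum.inl fun _ => Sum.inr t) (andDiagram L) :=
      rename_congr (by rintro (_ | _) <;> rfl) _
    have hsum := sumOut_mul_prod_delta (fun _ : Unit => (Sum.inr false : L ⊕ Bool))
      (rename (Sum.elim (fun l => Sum.inl (Sum.inl l)) Sum.inr) (andDiagram L) *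
        delta (Sum.inl (Sum.inr true)) (Sum.inr ()))
    rw [Fintype.prod_unique, rename_mul, rename_delta, rename_rename] at hsum
    rw [Fintype.prod_bool, Fintype.prod_bool, ← mul_assoc, hsum, mul_comm] at hprod
    rw [hrename, hrename, hprod, delta_comm]
    congr 1
    exact rename_congr (by rintro (_ | _) <;> rfl) _
  discard := by
    have hrenamed :=
      congrArg (rename (Sum.elim id Empty.elim)) (sumOut_andDiagram (L := L) (N := Empty))
    simp only [Finset.univ_eq_empty, Finset.prod_empty, mul_one] at hrenamed
    rw [rename_one, rename_sumOut, rename_rename] at hrenamed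
    rw [← hrenamed]
    congr 1
    conv_lhs => rw [← rename_id (andDiagram L)]
    exact rename_congr (by rintro (_ | _) <;> rfl) _

end

/-! ### Terms in H-boxes -/

section
variable {L V K : Type} [Finite V] [Fintype L] [Fintype K]

/-- Substitution as a homomorphism of monoids. -/
noncomputable def substituteHom (t : L → Term V) : Diagram L →* Diagram V where
  toFun q := substitute q t
  map_one' := substitute_one t
  map_mul' q r := substitute_mul q r t

lemma substitute_prod (q : K → Diagram L) (t : L → Term V) :
    substitute (∏ k, q k) t = ∏ k, substitute (q k) t := map_prod (substituteHom t) q _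

/-- The H-box with label `a`, with terms on its legs. -/
noncomputable def hBoxTerms (a : ℂ) (t : L → Term V) : Diagram V := substitute (hBox a id) t

lemma hBoxTerms_congr (a : ℂ) {t s : L → Term V} (h : ∀ l, t l = s l) :
    hBoxTerms a t = hBoxTerms a s := congrArg (hBoxTerms a) (funext h)

lemma substitute_hBox (a : ℂ) (f : L → K) (t : K → Term V) :
    substitute (hBox a f) t = hBoxTerms a fun l => t (f l) := by
  rw [hBoxTerms, ← substitute_rename f, rename_hBox]
  rfl

lemma substitute_hEdge (x y : K) (t : K → Term V) :
    substitute (hEdge x y) t = hBoxTerms (-1) fun b : Bool => bif b then t y else t x := by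
  rw [hEdge, substitute_hBox]
  exact hBoxTerms_congr _ fun b => by cases b <;> rfl

lemma hBoxTerms_var (a : ℂ) (f : L → V) : hBoxTerms a (fun l => var (f l)) = hBox a f :=
  (substitute_var _ _).trans (rename_hBox _ _ _)

lemma hBoxTerms_equiv (a : ℂ) (e : L ≃ K) (t : K → Term V) :
    hBoxTerms a (fun l => t (e l)) = hBoxTerms a t := by
  rw [← substitute_hBox, hBoxTerms, ← hBox_equiv a e]
  rfl

lemma substitute_scalar (a : ℂ) (t : L → Term V) : substitute (scalar a) t = scalar a := by
  rw [scalar, substitute_hBox, ← hBox_of_isEmpty a (Empty.elim : Empty → V), ← hBoxTerms_var]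
  exact hBoxTerms_congr _ fun x => x.elim

/-- The Hadamard transform of a term `t`. It stands for the function that sends the last variable
`y` to `(-1) ^ (y t)`, so that it turns exclusive or into multiplication. -/
noncomputable def character (t : Term V) : Diagram (V ⊕ Unit) := hadamard t.val

lemma character_injective : Function.Injective (character : Term V → _) := fun _ _ h =>
  Term.ext (hadamard_injective h)

lemma substitute_hadamard (q : Diagram (L ⊕ Unit)) (s : L → Term V) :
    substitute (hadamard q) (liftTerms s) = hadamard (substitute q (liftTerms s)) := by
  have hlift (x : L ⊕ Unit) : liftTerms (K := Unit) (liftTerms (K := Unit) s)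
      (Sum.map Sum.inl id x) = (liftTerms (K := Unit) s x).map (Sum.map Sum.inl id) := by
    rcases x with l | _
    · simp only [liftTerms, Sum.map_inl, Sum.elim_inl, Term.map_map]
    · simp only [liftTerms, Sum.map_inr, Sum.elim_inr, Term.map_var]
  have hedge : substitute (hEdge (Sum.inl (Sum.inr ())) (Sum.inr ()))
      (liftTerms (K := Unit) (liftTerms (K := Unit) s)) =
      hEdge (Sum.inl (Sum.inr ())) (Sum.inr ()) := by
    rw [substitute_hEdge, hEdge, ← hBoxTerms_var]
    refine hBoxTerms_congr _ fun b => ?_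
    cases b
    · exact Term.map_var _ _
    · rfl
  rw [hadamard, hadamard, substitute_sumOut, substitute_mul, substitute_rename, hedge]
  simp only [hlift]
  rw [← rename_substitute]

lemma character_comp (f : Term L) (s : L → Term V) :
    character (f.comp s) = substitute (character f) (liftTerms s) :=
  (substitute_hadamard f.val s).symm

lemma character_eq_hBoxTerms (t : Term V) :
    character t = hBoxTerms (-1) fun b => bif b then t.map Sum.inl else var (Sum.inr ()) := by
  have : Fintype V := Fintype.ofFinite V
  have hsumOut := sumOut_mul_equations (V := V ⊕ Unit) (K := Unit)
    (hEdge (Sum.inl (Sum.inr ())) (Sum.inr ())) fun _ => t.map Sum.inl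
  rw [substitute_hEdge, equations, Fintype.prod_unique, Term.map_equation] at hsumOut
  rw [character, hadamard, mul_comm]
  refine Eq.trans ?_ hsumOut
  congr 2

/-- The exclusive or of terms. -/
noncomputable def xorTerms (s : L → Term V) : Term V := (xorVars L).comp s

/-- The conjunction of terms. -/
noncomputable def andTerms (s : L → Term V) : Term V := (andVars L).comp s

lemma character_andTerms (s : L → Term V) :
    character (andTerms s) = hBoxTerms (-1) (liftTerms s) := by
  rw [andTerms, character_comp]
  exact congrArg (fun q => substitute q (liftTerms s)) hadamard_andDiagram

lemma character_xorVars : character (xorVars L) = ∏ l, hEdge (Sum.inr ()) (Sum.inl l) := by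
  have hval : (xorVars L).val =
      hadamard (∏ l : L, hEdge (Sum.inr ()) (Sum.inl l)) * rename Sum.inl (scalar (1 / 2)) := by
    rw [rename_scalar]
    exact (hadamard_prod_hEdge fun l : L => l).symm
  rw [character, hval, hadamard_mul_rename, hadamard_hadamard, rename_scalar, mul_assoc,
    mul_comm (scalar 2), scalar_half_mul_scalar_two, mul_one]

lemma character_xorTerms (s : L → Term V) : character (xorTerms s) = ∏ l, character (s l) := by
  rw [xorTerms, character_comp, character_xorVars, substitute_prod]
  refine Finset.prod_congr rfl fun l _ => ?_
  rw [character_eq_hBoxTerms, substitute_hEdge]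
  rfl

lemma sumOut_hBox_mul_andDiagram {K : Type} [Finite K] (a : ℂ) :
    sumOut Unit (hBox a (Sum.elim (fun k : K => Sum.inl (Sum.inl k)) Sum.inr) *
        rename (Sum.elim (fun l : L => Sum.inl (Sum.inr l)) Sum.inr) (andDiagram L)) =
      hBox a id := by
  have hfusion := hBox_fusion (M := K) (N := L) a
  rw [sumOut_bool] at hfusion
  have hand := rename_andDiagram (fun l : L => (Sum.inl (Sum.inr l) : (K ⊕ L) ⊕ Unit)) (Sum.inr ())
  rw [← mul_one (hBox a id), ← scalar_half_mul_scalar_two, mul_comm (scalar (1 / 2)), ← mul_assoc,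
    ← hfusion]
  refine (congrArg (fun q => sumOut Unit (_ * q)) hand).trans ?_
  rw [← mul_assoc, ← rename_scalar (X := K ⊕ L) (1 / 2) Sum.inl, ← sumOut_mul]
  refine congrArg (fun q : Diagram ((K ⊕ L) ⊕ Unit) => sumOut Unit q * scalar (1 / 2)) ?_
  rw [mul_comm (hBox a _), sumOut_mul]
  refine congrArg (sumOut Unit) ?_
  rw [rename_mul, rename_mul, rename_hBox, rename_hBox, rename_hBox, rename_hEdge]
  refine (mul_comm _ _).trans ?_
  rw [mul_comm (hBox (-1) _), ← mul_assoc]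
  exact congrArg₂ (· * ·) (congrArg (· * _) (hBox_congr _ (by rintro (_ | _) <;> rfl)))
    (hBox_congr _ (by rintro (_ | _) <;> rfl))

lemma hBoxTerms_elim_andTerms (a : ℂ) (t : K → Term V) (s : L → Term V) :
    hBoxTerms a (Sum.elim t fun _ : Unit => andTerms s) = hBoxTerms a (Sum.elim t s) := by
  rw [hBoxTerms, andTerms, substitute_elim_comp, rename_hBox, hBoxTerms,
    ← sumOut_hBox_mul_andDiagram]
  refine congrArg (fun q => substitute (sumOut Unit q) _) (congrArg₂ (· * ·) ?_ ?_)
  · exact hBox_congr _ (by rintro (_ | _) <;> rfl)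
  · exact rename_congr (by rintro (_ | _) <;> rfl) _

lemma hBoxTerms_elim_xorTerms (t : K → Term V) (s : L → Term V) :
    hBoxTerms (-1) (Sum.elim t fun _ : Unit => xorTerms s) =
      ∏ l, hBoxTerms (-1) (Sum.elim t fun _ : Unit => s l) := by
  have hbox : rename (Sum.map Sum.inl id) (hBox (-1) (id : K ⊕ Unit → _)) =
      hBox (-1) (Sum.elim (fun k => (Sum.inl (Sum.inl k) : (K ⊕ L) ⊕ Unit)) Sum.inr) :=
    (rename_hBox _ _ _).trans (hBox_congr _ (by rintro (_ | _) <;> rfl))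
  have hgrey : rename (Sum.map Sum.inr id : L ⊕ Unit → (K ⊕ L) ⊕ Unit) (xorVars L).val =
      greySpider (Sum.elim (fun n => Sum.inl (Sum.inr n)) Sum.inr) :=
    (rename_greySpider _ _).trans (greySpider_congr (by rintro (_ | _) <;> rfl))
  rw [hBoxTerms, xorTerms, substitute_elim_comp, hbox, hgrey, bialgebra_hBox, substitute_prod]
  refine Finset.prod_congr rfl fun l _ => ?_
  rw [substitute_hBox]
  exact hBoxTerms_congr _ (by rintro (_ | _) <;> rfl)

end

/-! ### The Boolean ring of terms -/

section
variable {L V X K : Type} [Finite V] [Finite X] [Fintype L] [Fintype K]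

lemma Term.map_comp (f : Term L) (s : L → Term V) (g : V → X) :
    (f.comp s).map g = f.comp fun l => (s l).map g := by
  refine Term.ext ((Term.comp_equation f s _ _).trans ?_)
  refine congrArg (substitute f.val) (funext fun x => ?_)
  rcases x with l | _
  · exact (Term.map_map _ _ _).symm
  · rfl

/-- The H-box with label `a`, with a term on its leg. It stands for the function `a ^ t` of a term
`t` with values `0` and `1`. -/
noncomputable def hPow (a : ℂ) (t : Term V) : Diagram V := hBoxTerms a fun _ : Unit => t

lemma hPow_andTerms (a : ℂ) (s : L → Term V) : hPow a (andTerms s) = hBoxTerms a s := by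
  have hexpand := hBoxTerms_elim_andTerms a (Empty.elim : Empty → Term V) s
  rwa [← hBoxTerms_equiv a (Equiv.emptySum Empty Unit).symm,
    ← hBoxTerms_equiv a (Equiv.emptySum Empty L).symm] at hexpand

lemma hPow_mul_hPow (a b : ℂ) (t : Term V) : hPow a t * hPow b t = hPow (a * b) t := by
  simp only [hPow, hBoxTerms, ← substitute_mul, hBox_mul]

lemma hPow_one_left (t : Term V) : hPow 1 t = 1 := by
  rw [hPow, hBoxTerms, hBox_one, substitute_one]

noncomputable instance : Zero (Term V) := ⟨xorTerms (Empty.elim : Empty → Term V)⟩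
noncomputable instance : One (Term V) := ⟨andTerms (Empty.elim : Empty → Term V)⟩
noncomputable instance : Add (Term V) := ⟨fun t s => xorTerms fun b : Bool => bif b then s else t⟩
noncomputable instance : Mul (Term V) := ⟨fun t s => andTerms fun b : Bool => bif b then s else t⟩
instance : Neg (Term V) := ⟨id⟩

lemma character_zero : character (0 : Term V) = 1 :=
  (character_xorTerms _).trans Finset.prod_empty

lemma character_add (t s : Term V) : character (t + s) = character t * character s := by
  refine (character_xorTerms _).trans ?_
  rw [Fintype.prod_bool, mul_comm]
  rfl

protected lemma Term.map_mul (t s : Term V) (g : V → X) :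
    (t * s).map g = t.map g * s.map g :=
  (Term.map_comp _ _ _).trans (congrArg (andVars Bool).comp (funext fun b => by cases b <;> rfl))

protected lemma Term.map_add (t s : Term V) (g : V → X) :
    (t + s).map g = t.map g + s.map g :=
  (Term.map_comp _ _ _).trans (congrArg (xorVars Bool).comp (funext fun b => by cases b <;> rfl))

protected lemma Term.map_one (g : V → X) : (1 : Term V).map g = 1 :=
  (Term.map_comp _ _ _).trans (congrArg (andVars Empty).comp (funext fun x => x.elim))

protected lemma Term.map_zero (g : V → X) : (0 : Term V).map g = 0 :=
  (Term.map_comp _ _ _).trans (congrArg (xorVars Empty).comp (funext fun x => x.elim))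

lemma andTerms_equiv (e : L ≃ K) (s : K → Term V) :
    andTerms (fun l => s (e l)) = andTerms s := by
  refine character_injective ?_
  rw [character_andTerms, character_andTerms,
    ← hBoxTerms_equiv _ (Equiv.sumCongr e (Equiv.refl Unit))]
  exact hBoxTerms_congr _ (by rintro (_ | _) <;> rfl)

lemma andTerms_of_isEmpty [IsEmpty L] (s : L → Term V) : andTerms s = 1 :=
  (congrArg andTerms (funext isEmptyElim)).trans
    (andTerms_equiv (Equiv.equivOfIsEmpty L Empty) Empty.elim)

protected lemma Term.mul_comm (t s : Term V) : t * s = s * t :=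
  (congrArg andTerms (funext fun b => by cases b <;> rfl)).trans
    (andTerms_equiv Equiv.boolNot fun b => bif b then t else s)

lemma character_mul (t s : Term V) : character (t * s) =
    hBoxTerms (-1) (Sum.elim ![var (Sum.inr ()), s.map Sum.inl] fun _ : Unit => t.map Sum.inl) := by
  let e : Bool ⊕ Unit ≃ Fin 2 ⊕ Unit :=
    { toFun := Sum.elim (fun b => bif b then Sum.inl 1 else Sum.inr ()) fun _ => Sum.inl 0
      invFun := Sum.elim ![Sum.inr (), Sum.inl true] fun _ => Sum.inl false
      left_inv := by decide
      right_inv := by decide }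
  refine (character_andTerms _).trans ?_
  rw [← hBoxTerms_equiv _ e]
  exact hBoxTerms_congr _ (by rintro ((_ | _) | _) <;> rfl)

lemma character_mul_mul (r s t : Term V) : character (r * s * t) =
    hBoxTerms (-1) ![var (Sum.inr ()), t.map Sum.inl, r.map Sum.inl, s.map Sum.inl] := by
  let e : Fin 2 ⊕ Bool ≃ Fin 4 :=
    { toFun := Sum.elim ![0, 1] fun b => bif b then 3 else 2
      invFun := ![Sum.inl 0, Sum.inl 1, Sum.inr false, Sum.inr true]
      left_inv := by decide
      right_inv := by decide }
  rw [character_mul, Term.map_mul]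
  refine (hBoxTerms_elim_andTerms _ _ _).trans ?_
  rw [← hBoxTerms_equiv _ e]
  refine hBoxTerms_congr _ ?_
  rintro (i | (_ | _))
  · fin_cases i <;> rfl
  · rfl
  · rfl

lemma character_one_mul (t : Term V) : character (1 * t) = character t := by
  let e : Fin 2 ⊕ Empty ≃ Bool :=
    { toFun := Sum.elim ![false, true] Empty.elim
      invFun := fun b => bif b then Sum.inl 1 else Sum.inl 0
      left_inv := by decide
      right_inv := by decide }
  rw [character_mul, Term.map_one, character_eq_hBoxTerms, ← hBoxTerms_equiv _ e]
  refine (hBoxTerms_elim_andTerms _ _ _).trans (hBoxTerms_congr _ ?_)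
  rintro (i | x)
  · fin_cases i <;> rfl
  · exact x.elim

lemma character_mul_self (t : Term V) : character t * character t = 1 := by
  rw [character_eq_hBoxTerms, ← hPow_andTerms, hPow_mul_hPow, neg_mul_neg, one_mul, hPow_one_left]

lemma character_add_mul (r s t : Term V) :
    character ((r + s) * t) = character (r * t) * character (s * t) := by
  rw [character_mul, Term.map_add, character_mul, character_mul]
  refine (hBoxTerms_elim_xorTerms _ _).trans ?_
  rw [Fintype.prod_bool, mul_comm]
  rfl

lemma character_zero_mul (t : Term V) : character (0 * t) = 1 := by
  rw [character_mul, Term.map_zero]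
  exact (hBoxTerms_elim_xorTerms _ _).trans Finset.prod_empty

protected lemma Term.mul_assoc (r s t : Term V) : r * s * t = r * (s * t) := by
  let e : Fin 4 ≃ Fin 4 :=
    { toFun := ![0, 2, 3, 1]
      invFun := ![0, 3, 1, 2]
      left_inv := by decide
      right_inv := by decide }
  refine character_injective ?_
  rw [Term.mul_comm r (s * t), character_mul_mul, character_mul_mul, ← hBoxTerms_equiv _ e]
  exact hBoxTerms_congr _ fun i => by fin_cases i <;> rfl

noncomputable instance : CommRing (Term V) where
  add_assoc r s t := character_injective (by simp only [character_add, mul_assoc])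
  zero_add t := character_injective (by rw [character_add, character_zero, one_mul])
  add_zero t := character_injective (by rw [character_add, character_zero, mul_one])
  add_comm r s := character_injective (by rw [character_add, character_add, mul_comm])
  nsmul := nsmulRec
  zsmul := zsmulRec
  neg_add_cancel t := character_injective
    ((character_add t t).trans ((character_mul_self t).trans character_zero.symm))
  mul_assoc := Term.mul_assoc
  one_mul t := character_injective (character_one_mul t)
  mul_one t := (Term.mul_comm t 1).trans (character_injective (character_one_mul t))
  zero_mul t := character_injective ((character_zero_mul t).trans character_zero.symm)
  mul_zero t := (Term.mul_comm t 0).trans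
    (character_injective ((character_zero_mul t).trans character_zero.symm))
  mul_comm := Term.mul_comm
  right_distrib r s t := character_injective (by rw [character_add_mul, character_add])
  left_distrib t r s := by
    rw [Term.mul_comm t, Term.mul_comm t, Term.mul_comm t]
    exact character_injective (by rw [character_add_mul, character_add])

lemma Term.add_self (t : Term V) : t + t = 0 :=
  character_injective ((character_add t t).trans
    ((character_mul_self t).trans character_zero.symm))

lemma character_sum {L : Type} (S : Finset L) (s : L → Term V) :
    character (∑ l ∈ S, s l) = ∏ l ∈ S, character (s l) := by
  classical
  induction S using Finset.induction_on with
  | empty => exact character_zero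
  | insert a S ha ih => rw [Finset.sum_insert ha, Finset.prod_insert ha, character_add, ih]

lemma xorTerms_eq_sum (s : L → Term V) : xorTerms s = ∑ l, s l :=
  character_injective ((character_xorTerms s).trans (character_sum _ s).symm)

lemma andTerms_option (s : Option L → Term V) :
    andTerms s = (andTerms fun l => s (some l)) * s none := by
  let e : Fin 2 ⊕ L ≃ Option L ⊕ Unit :=
    { toFun := Sum.elim ![Sum.inr (), Sum.inl none] fun l => Sum.inl (some l)
      invFun := Sum.elim (fun x => x.elim (Sum.inl 1) Sum.inr) fun _ => Sum.inl 0
      left_inv := by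
        rintro (i | l)
        · fin_cases i <;> rfl
        · rfl
      right_inv := by rintro ((_ | _) | _) <;> rfl }
  have hmap : (andTerms fun l => s (some l)).map (Sum.inl : V → V ⊕ Unit) =
      andTerms fun l => (s (some l)).map Sum.inl := Term.map_comp _ _ _
  refine character_injective ?_
  rw [character_mul, hmap, hBoxTerms_elim_andTerms, character_andTerms, ← hBoxTerms_equiv _ e]
  refine hBoxTerms_congr _ ?_
  rintro (i | l)
  · fin_cases i <;> rfl
  · rfl

lemma andTerms_eq_prod (s : L → Term V) : andTerms s = ∏ l, s l := by
  refine Fintype.induction_empty_option (P := fun L _ => ∀ s : L → Term V, andTerms s = ∏ l, s l)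
    ?_ ?_ ?_ L s
  · intro L K _ e ih s
    let _ : Fintype L := Fintype.ofEquiv K e.symm
    rw [← Equiv.prod_comp e, ← ih, andTerms_equiv]
  · intro s
    rw [andTerms_of_isEmpty, Finset.univ_eq_empty, Finset.prod_empty]
  · intro L _ ih s
    rw [Fintype.prod_option, ← ih, mul_comm, andTerms_option]

lemma hBoxTerms_eq_hPow (a : ℂ) (s : L → Term V) : hBoxTerms a s = hPow a (∏ l, s l) := by
  rw [← hPow_andTerms, andTerms_eq_prod]

lemma hPow_one (a : ℂ) : hPow a (1 : Term V) = scalar a := by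
  rw [← substitute_scalar a (Empty.elim : Empty → Term V), scalar, substitute_hBox,
    hBoxTerms_eq_hPow, Finset.univ_eq_empty, Finset.prod_empty]

lemma character_mul_eq (t s : Term V) :
    character (t * s) = hBoxTerms (-1) ![t.map Sum.inl, s.map Sum.inl, var (Sum.inr ())] := by
  rw [character_mul, hBoxTerms_eq_hPow, hBoxTerms_eq_hPow, Fintype.prod_sum_type, Fin.prod_univ_two,
    Fin.prod_univ_three, Fintype.prod_unique]
  simp only [Sum.elim_inl, Sum.elim_inr, Matrix.cons_val]
  congr 1
  ring

lemma character_one : character (1 : Term V) = hBox (-1) fun _ : Unit => Sum.inr () := by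
  refine (character_andTerms _).trans ?_
  rw [← hBoxTerms_var, hBoxTerms_eq_hPow, hBoxTerms_eq_hPow, Fintype.prod_sum_type,
    Finset.univ_eq_empty, Finset.prod_empty, one_mul]
  rfl

lemma Term.val_eq_hadamard_character (t : Term V) :
    t.val = hadamard (character t) * scalar (1 / 2) := by
  rw [character, hadamard_hadamard, mul_assoc, mul_comm (scalar 2), scalar_half_mul_scalar_two,
    mul_one]

lemma substitute_notEdge (x : K) (s : K → Term V) :
    substitute (notEdge (Sum.inl x) (Sum.inr ())) (liftTerms s) = (s x + 1).val := by
  have hnot : notEdge (Sum.inl x : K ⊕ Unit) (Sum.inr ()) =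
      hadamard (hBox (-1) (fun _ : Unit => Sum.inr ()) * hEdge (Sum.inr ()) (Sum.inl x)) *
        scalar (1 / 2) := by
    rw [notEdge_eq, hadamard, mul_comm, rename_mul, rename_hBox, rename_hEdge,
      hEdge_comm _ (Sum.inl (Sum.inr ())), mul_assoc]
    rfl
  have hedge : substitute (hEdge (Sum.inr ()) (Sum.inl x)) (liftTerms s) = character (s x) := by
    rw [substitute_hEdge, character_eq_hBoxTerms]
    rfl
  rw [hnot, Term.val_eq_hadamard_character, substitute_mul, substitute_scalar, substitute_hadamard,
    substitute_mul, hedge, character_add, character_one, substitute_hBox, mul_comm (character _),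
    ← hBoxTerms_var]
  rfl

lemma substitute_sumOut_mul_notEdge (q : Diagram (K ⊕ Unit)) (x : K) (s : K → Term V) :
    substitute (sumOut Unit (q * notEdge (Sum.inl x) (Sum.inr ()))) s =
      substitute q (Sum.elim s fun _ => s x + 1) := by
  rw [substitute_sumOut, substitute_mul, substitute_notEdge, substitute_elim, equations,
    Fintype.prod_unique, Term.equation_self]

lemma hPow_split (a : ℂ) (t s : Term V) : hPow a t = hPow a (t * s) * hPow a (t * (s + 1)) := by
  have hsubst := congrArg (fun q => substitute q fun b : Bool => bif b then s else t)
    (hBox_intro a false true)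
  rw [substitute_mul, substitute_hBox, substitute_hBox, substitute_sumOut_mul_notEdge,
    substitute_hBox, hBoxTerms_eq_hPow a fun l : Bool => _, hBoxTerms_eq_hPow a fun l : Bool => _,
    Fintype.prod_bool, Fintype.prod_bool] at hsubst
  rw [mul_comm t, mul_comm t]
  exact hsubst

lemma hPow_zero {a : ℂ} (ha : a ≠ 0) : hPow a (0 : Term V) = 1 := by
  have hinv : hPow a (0 : Term V) * hPow a⁻¹ 0 = 1 := by
    rw [hPow_mul_hPow, mul_inv_cancel₀ ha, hPow_one_left]
  have hsq := hPow_split a (0 : Term V) 0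
  rw [zero_mul, zero_mul] at hsq
  rw [← mul_one (hPow a 0), ← hinv, ← mul_assoc, ← hsq]

lemma hadamard_one : hadamard (1 : Diagram (V ⊕ Unit)) = (0 : Term V).val * scalar 2 := by
  rw [← character_zero, character, hadamard_hadamard]

/-- The scalar that tests whether a term vanishes. -/
noncomputable def zeroTest (t : Term V) : Diagram V := sumOut Unit (t.val * (0 : Term V).val)

lemma Term.val_mul_val (t : Term V) : t.val * t.val = t.val := by
  rw [← t.equation_self, t.equation_mul_equation, delta_self, mul_one]

lemma zeroTest_zero : zeroTest (0 : Term V) = 1 := by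
  rw [zeroTest, Term.val_mul_val, Term.discard]

lemma zeroTest_mul_self (t : Term V) : zeroTest t * zeroTest t = zeroTest t := by
  have : Fintype V := Fintype.ofFinite V
  have hzero : zeroTest t = substitute (0 : Term V).val (Sum.elim var fun _ => t) := by
    rw [← sumOut_mul_equations, equations, Fintype.prod_unique, Term.equation_self, mul_comm,
      zeroTest]
  rw [hzero, ← substitute_mul, Term.val_mul_val]

lemma sumOut_character (t : Term V) : sumOut Unit (character t) = zeroTest t * scalar 2 := by
  rw [← mul_one (character t), character, sumOut_hadamard_mul, hadamard_one, ← mul_assoc,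
    ← rename_scalar (X := V) 2 Sum.inl, ← sumOut_mul, zeroTest]

lemma Term.val_mul_sumOut (t s : Term V) :
    t.val * rename Sum.inl (sumOut Unit (t.val * s.val)) = t.val * s.val := by
  have hcopy : rename Sum.inl t.val * rename (Sum.map Sum.inl id) t.val =
      rename Sum.inl t.val * delta (Sum.inl (Sum.inr ())) (Sum.inr ()) := by
    have hcopies := t.equation_mul_equation (fun v => (Sum.inl (Sum.inl v) : (V ⊕ Unit) ⊕ Unit))
      (Sum.inl (Sum.inr ())) (Sum.inr ())
    have hinl : t.equation (fun v => (Sum.inl (Sum.inl v) : (V ⊕ Unit) ⊕ Unit))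
        (Sum.inl (Sum.inr ())) = rename Sum.inl t.val :=
      rename_congr (by rintro (_ | _) <;> rfl) _
    have hinr : t.equation (fun v => (Sum.inl (Sum.inl v) : (V ⊕ Unit) ⊕ Unit)) (Sum.inr ()) =
        rename (Sum.map Sum.inl id) t.val :=
      rename_congr (by rintro (_ | _) <;> rfl) _
    rwa [hinl, hinr] at hcopies
  have hs : rename (fun x => Sum.elim id (fun _ : Unit => (Sum.inr () : V ⊕ Unit))
      (Sum.map Sum.inl id x)) s.val = s.val :=
    (rename_congr (by rintro (_ | _) <;> rfl) _).trans (rename_id' _)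
  have hdelta := sumOut_mul_prod_delta (fun _ : Unit => (Sum.inr () : V ⊕ Unit))
    (rename Sum.inl t.val * rename (Sum.map Sum.inl id) s.val)
  rw [Fintype.prod_unique, rename_mul, rename_rename, rename_rename, hs] at hdelta
  refine Eq.trans ?_ (hdelta.trans (congrArg (· * s.val) (rename_id' _)))
  rw [mul_comm, rename_sumOut, sumOut_mul, rename_mul, mul_right_comm, mul_comm (rename _ t.val),
    hcopy, mul_right_comm]

lemma eq_zero_of_zeroTest_eq_one {t : Term V} (h : zeroTest t = 1) : t = 0 := by
  have ht := t.val_mul_sumOut 0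
  have hzero := (0 : Term V).val_mul_sumOut t
  rw [mul_comm (0 : Term V).val t.val] at hzero
  change _ * rename Sum.inl (zeroTest t) = _ at ht hzero
  rw [h, rename_one, mul_one] at ht hzero
  exact Term.ext (ht.trans hzero.symm)

lemma sumOut_hBox_ortho (x p q : X) :
    sumOut Unit (sumOut Unit (hBox (-1) ![Sum.inl (Sum.inl p), Sum.inl (Sum.inl x), Sum.inr ()] *
      hBox (-1) ![Sum.inl (Sum.inl q), Sum.inl (Sum.inr ()), Sum.inr ()]) *
        notEdge (Sum.inl x) (Sum.inr ())) =
    sumOut Unit (sumOut Unit (hBox (-1) ![Sum.inl (Sum.inl p), Sum.inl (Sum.inl x), Sum.inr ()]) *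
      sumOut Unit (hBox (-1) ![Sum.inl (Sum.inl q), Sum.inl (Sum.inr ()), Sum.inr ()]) *
      notEdge (Sum.inl x) (Sum.inr ())) * scalar (1 / 2) := by
  let e : Fin 3 ≃ Unit ⊕ Bool :=
    { toFun := ![Sum.inl (), Sum.inr false, Sum.inr true]
      invFun := Sum.elim (fun _ => 0) fun b => bif b then 2 else 1
      left_inv := by decide
      right_inv := by decide }
  have hortho := hBox_ortho x p q
  have hprod := prod_sumOut_unit (X := X ⊕ Unit) fun b : Bool => bif b
    then hBox (-1) ![Sum.inl (Sum.inl q), Sum.inl (Sum.inr ()), Sum.inr ()]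
    else hBox (-1) ![Sum.inl (Sum.inl p), Sum.inl (Sum.inl x), Sum.inr ()]
  rw [Fintype.prod_bool, Fintype.prod_bool] at hprod
  simp only [cond_true, cond_false, rename_hBox] at hprod
  rw [sumOut_bool, ← sumOut_equiv e, sumOut_sum] at hortho
  simp only [rename_mul, rename_hBox, rename_notEdge] at hortho
  rw [mul_comm (sumOut Unit (hBox (-1) ![Sum.inl (Sum.inl p), _, _])), hprod,
    sumOut_mul (K := Unit) _ (notEdge _ _), sumOut_mul (K := Bool) _ (notEdge _ _), rename_notEdge,
    rename_notEdge]
  refine Eq.trans ?_ (hortho.trans ?_)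
  · rw [mul_assoc]
    refine congrArg₂ (fun a b : Diagram ((X ⊕ Unit) ⊕ Unit) =>
      sumOut Unit (sumOut Unit (a * (b * _)))) (hBox_congr _ ?_) (hBox_congr _ ?_) <;>
      (intro i; fin_cases i <;> rfl)
  · rw [mul_comm (hBox _ _) (hBox _ _), mul_assoc]
    refine congrArg₂ (fun a b : Diagram ((X ⊕ Unit) ⊕ Bool) =>
      sumOut Unit (sumOut Bool (a * (b * _))) * scalar (1 / 2)) (hBox_congr _ ?_)
      (hBox_congr _ ?_) <;> (intro i; fin_cases i <;> rfl)

lemma substitute_hBox_three (i j : K) (s : K → Term V) :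
    substitute (hBox (-1) ![Sum.inl i, Sum.inl j, Sum.inr ()]) (liftTerms s) =
      character (s i * s j) := by
  rw [substitute_hBox, character_mul_eq]
  exact hBoxTerms_congr _ fun i => by fin_cases i <;> rfl

lemma zeroTest_ortho (x p q : Term V) :
    zeroTest (p * x + q * (x + 1)) = zeroTest (p * x) * zeroTest (q * (x + 1)) := by
  have hortho := congrArg (fun r => substitute r ![x, p, q]) (sumOut_hBox_ortho (0 : Fin 3) 1 2)
  let s : Fin 3 ⊕ Unit → Term V := Sum.elim ![x, p, q] fun _ => ![x, p, q] 0 + 1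
  have hp := substitute_hBox_three (K := Fin 3 ⊕ Unit) (Sum.inl 1) (Sum.inl 0) s
  have hq := substitute_hBox_three (K := Fin 3 ⊕ Unit) (Sum.inl 2) (Sum.inr ()) s
  simp only [substitute_mul, substitute_scalar, substitute_sumOut_mul_notEdge] at hortho
  rw [substitute_sumOut, substitute_sumOut, substitute_sumOut, substitute_mul] at hortho
  change sumOut Unit (substitute _ (liftTerms s) * substitute _ (liftTerms s)) =
    sumOut Unit (substitute _ (liftTerms s)) * sumOut Unit (substitute _ (liftTerms s)) * _
    at hortho
  rw [hp, hq, ← character_add, sumOut_character, sumOut_character, sumOut_character] at hortho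
  have hcancel (a b c u v : Diagram V) (huv : v * u = 1) (h : a * u = b * u * (c * u) * v) :
      a = b * c :=
    calc a = a * u * v := by rw [mul_assoc, mul_comm u, huv, mul_one]
      _ = b * c * (v * u) * (v * u) := by rw [h]; ac_rfl
      _ = b * c := by rw [huv, mul_one, mul_one]
  exact hcancel _ _ _ _ _ scalar_half_mul_scalar_two hortho

lemma Term.mul_add_one_self (t : Term V) : t * (t + 1) = 0 := by
  have hortho := zeroTest_ortho t (t + 1) t
  rw [mul_comm (t + 1) t, Term.add_self, zeroTest_zero, zeroTest_mul_self] at hortho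
  exact eq_zero_of_zeroTest_eq_one hortho.symm

lemma Term.mul_self (t : Term V) : t * t = t := by
  have hself := t.mul_add_one_self
  rw [mul_add, mul_one] at hself
  rw [eq_neg_of_add_eq_zero_left hself]
  rfl

end

/-! ### The two diagrams as products of H-boxes -/

section
variable {L V S : Type} [Finite V] {n : ℕ}

lemma mk_sideBySide {ι : Type} {L : ι → Type} [Fintype ι] [∀ i, Finite (L i)]
    (D : (i : ι) → ZH (L i)) :
    (⟦sideBySide D⟧ : Diagram (Σ i, L i)) = ∏ i, rename (Sigma.mk i) (⟦D i⟧ : Diagram (L i)) := by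
  rw [prod_rename, tensorFamily_mk]
  exact (rename_id' _).symm

lemma mk_strand : (⟦strand⟧ : Diagram Bool) = (var ()).equation (fun _ : Unit => false) true := by
  rw [var_equation, delta]
  conv_lhs => rw [← rename_id (⟦strand⟧ : Diagram Bool)]
  exact rename_congr (by rintro (_ | _) <;> rfl) _

lemma mk_notGate :
    (⟦notGate⟧ : Diagram Bool) = (var () + 1).equation (fun _ : Unit => false) true := by
  have hval : notEdge (Sum.inl () : Unit ⊕ Unit) (Sum.inr ()) = (var () + 1).val := by
    rw [← substitute_notEdge () var, liftTerms_var]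
    exact ((substitute_var _ id).trans (rename_id _)).symm
  rw [Term.equation, ← hval, rename_notEdge, notEdge]
  conv_lhs => rw [← rename_id (⟦notGate⟧ : Diagram Bool)]
  exact rename_congr (by rintro (_ | _) <;> rfl) _

lemma Term.val_zero : (0 : Term V).val = greySpider fun _ : Unit => Sum.inr () := by
  have hhub := hadamard_prod_hEdge (Empty.elim : Empty → V)
  rw [Finset.univ_eq_empty, Finset.prod_empty, hadamard_one, mul_assoc, mul_comm (scalar 2),
    scalar_half_mul_scalar_two, mul_one] at hhub
  rw [hhub, ← greySpider_equiv (Equiv.emptySum Empty Unit).symm]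
  rfl

lemma mk_disconnectPiece :
    (⟦disconnectPiece⟧ : Diagram Bool) = (0 : Term Unit).equation (fun _ => false) true := by
  rw [Term.equation, Term.val_zero, rename_greySpider, disconnectPiece,
    mk_graph_eq_sumOut_prod
      fun t : Bool => bif t then greySpider fun _ : Unit => Sum.inl true else 1]
  · rw [Fintype.prod_bool]
    have hsubst := sumOut_mul_prod_delta (Empty.elim : Empty → Bool)
      (greySpider fun _ : Unit => Sum.inl true)
    rw [Finset.univ_eq_empty, Finset.prod_empty, rename_greySpider] at hsubst
    exact hsubst
  · rintro (_ | _)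
    · refine (rename_zSp_fiber (x := Sum.inl false) (g := (Empty.elim : Empty → _))
        (Sum.inl false) Empty.elim ?_ ?_ ?_ rfl ?_).trans Finset.prod_empty
      · exact fun x => x.elim
      · exact fun x => x.elim
      · rintro ((_ | _) | ⟨⟨⟩, _⟩) <;> simp
      · exact fun x => x.elim
    · refine (xSp_isNatural.rename_fiber (fun _ : Unit => Sum.inl true)
        (Function.injective_of_subsingleton _) ?_ fun _ => rfl).trans (rename_xSp _)
      rintro ((_ | _) | ⟨⟨⟩, _⟩) <;> simp

lemma mk_bangBox_eq_sumOut_prod [Fintype S] (box : S → Fin n → ZH Bool) (top : S → ZH (Fin n)) :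
    (⟦bangBox (fun s => sideBySide (box s)) top⟧ : Diagram (Fin n)) =
      sumOut ((S × Fin n) × Bool)
        ((∏ s, ∏ i, rename (fun t => Sum.inr ((s, i), t)) ⟦box s i⟧) *
          (∏ s, rename (fun i => Sum.inr ((s, i), true)) ⟦top s⟧) *
          ∏ p : S × Fin n, delta (Sum.inl p.2) (Sum.inr (p, false))) := by
  have : ∀ j, Finite (bangLegs n S j) := by
    rintro (_ | _ | _) <;> (simp only [bangLegs]; infer_instance)
  have hwhite (i : Fin n) : rename (fun l : bangLegs n S (Sum.inl i) =>
      Sum.map id Prod.fst (bangWiring n S ⟨Sum.inl i, l⟩)) (⟦Z (Option S)⟧ : Diagram (Option S)) =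
      ∏ s, delta (Sum.inl i) (Sum.inr ((s, i), false)) := rename_Z_option _
  have hbox (s : S) : rename (fun l : bangLegs n S (Sum.inr (Sum.inl s)) =>
      Sum.map id Prod.fst (bangWiring n S ⟨Sum.inr (Sum.inl s), l⟩))
      (⟦sideBySide (box s)⟧ : Diagram (Σ _ : Fin n, Bool)) =
      ∏ i, rename (fun t => Sum.inr ((s, i), t)) (⟦box s i⟧ : Diagram Bool) := by
    rw [mk_sideBySide]
    refine (rename_prod (A := Σ _ : Fin n, Bool) _ _).trans (Finset.prod_congr rfl fun i _ => ?_)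
    exact rename_rename _ _ _
  rw [bangBox, net_eq_sumOut_prod, Fintype.prod_sum_type, Fintype.prod_sum_type, mul_comm,
    Fintype.prod_prod_type_right]
  exact congrArg (sumOut _) (congrArg₂ (· * ·)
    (congrArg (· * _) (Finset.prod_congr rfl fun s _ => hbox s))
    (Finset.prod_congr rfl fun i _ => hwhite i))

lemma mk_bangBox [Fintype S] (box : S → Fin n → ZH Bool) (top : S → ZH (Fin n))
    (τ : S → Fin n → Term Unit)
    (h : ∀ s i, (⟦box s i⟧ : Diagram Bool) = (τ s i).equation (fun _ => false) true) :
    (⟦bangBox (fun s => sideBySide (box s)) top⟧ : Diagram (Fin n)) =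
      ∏ s, substitute ⟦top s⟧ fun i => (τ s i).map fun _ => i := by
  let σ : (S × Fin n) × Bool ≃ (S × Fin n) ⊕ (S × Fin n) :=
    { toFun := fun p => bif p.2 then Sum.inl p.1 else Sum.inr p.1
      invFun := Sum.elim (fun p => (p, true)) fun p => (p, false)
      left_inv := by rintro ⟨_, _ | _⟩ <;> rfl
      right_inv := by rintro (_ | _) <;> rfl }
  have hpieces : ∏ s, ∏ i, (τ s i).equation (fun _ => (Sum.inl i : Fin n ⊕ (S × Fin n)))
      (Sum.inr (s, i)) = equations fun p : S × Fin n => (τ p.1 p.2).map fun _ => p.2 := by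
    simp only [equations, Fintype.prod_prod_type, Term.map_equation]
  have hsubst (s : S) :
      substitute (rename (fun i => (Sum.inr (s, i) : Fin n ⊕ (S × Fin n))) ⟦top s⟧)
        (Sum.elim var fun p => (τ p.1 p.2).map fun _ => p.2) =
      substitute (⟦top s⟧ : Diagram (Fin n)) fun i => (τ s i).map fun _ => i :=
    substitute_rename _ _ _
  rw [mk_bangBox_eq_sumOut_prod]
  refine (sumOut_mul_prod_delta_subst σ
    (fun p : S × Fin n => (Sum.inl p.2 : Fin n ⊕ (S × Fin n))) _).trans ?_
  simp only [h, rename_mul, rename_prod, Term.rename_equation, rename_rename]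
  refine (congrArg (sumOut _) ((congrArg (· * _) hpieces).trans (mul_comm _ _))).trans ?_
  rw [sumOut_mul_equations, substitute_prod]
  exact Finset.prod_congr rfl fun s _ => hsubst s

lemma mk_zPhase (α : ℂ) [Subsingleton L] (l₀ : L) :
    (⟦zPhase α L⟧ : Diagram L) = hBox (Complex.exp (Complex.I * α)) fun _ : Unit => l₀ := by
  rw [zPhase, mk_graph_eq_sumOut_prod
    fun t => bif t then hBox (Complex.exp (Complex.I * α)) fun _ : Unit => Sum.inr ()
    else ∏ _u : Unit, delta (Sum.inl l₀) (Sum.inr ()), Fintype.prod_bool]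
  · refine (sumOut_mul_prod_delta (fun _ : Unit => l₀) _).trans ?_
    rw [cond_true, rename_hBox]
    rfl
  · rintro (_ | _)
    · refine rename_zSp_fiber (Sum.inl l₀) (fun _ : Unit => Sum.inr ((), false))
        (Function.injective_of_subsingleton _) ?_ ?_ rfl fun _ => rfl
      · simp
      · rintro (l | ⟨_, _ | _⟩)
        · simp [Subsingleton.elim l l₀]
        · simp
        · simp
    · refine (hSp_isNatural _).rename_fiber (fun _ : Unit => Sum.inr ((), true))
        (Function.injective_of_subsingleton _) ?_ fun _ => rfl
      rintro (l | ⟨_, _ | _⟩) <;> simp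

lemma mk_phaseGadget (n : ℕ) (α : ℂ) : (⟦phaseGadget n α⟧ : Diagram (Fin n)) =
    sumOut Unit (hBox (Complex.exp (Complex.I * α)) (fun _ : Unit => Sum.inr ()) *
      (xorVars (Fin n)).val) := by
  rw [phaseGadget, mk_graph_eq_sumOut_prod fun t => bif t
    then hBox (Complex.exp (Complex.I * α)) fun _ : Unit => Sum.inr () else (xorVars (Fin n)).val,
    Fintype.prod_bool]
  · rfl
  · rintro (_ | _)
    · refine (xSp_isNatural.rename_fiber (g := Sum.elim Sum.inl Sum.inr)
        (Sum.elim Sum.inl fun _ : Unit => Sum.inr ((), false)) ?_ ?_ ?_).trans (rename_xSp _)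
      · rintro (_ | _) (_ | _) h <;> simp at h <;> simp [h]
      · rintro (_ | ⟨_, _ | _⟩) <;> simp
      · rintro (_ | _) <;> rfl
    · let P := {p : Fin n ⊕ Unit × Bool // Sum.elim (fun _ : Fin n => false)
          (fun p : Unit × Bool => bif p.2 then true else false) p = true}
      have hP (p : P) : p.1 = Sum.inr ((), true) := by
        obtain ⟨_ | ⟨_, _ | _⟩, h⟩ := p <;> simp at h ⊢
      have : Subsingleton P := ⟨fun p q => Subtype.ext ((hP p).trans (hP q).symm)⟩
      refine (congrArg (rename fun l : P => Sum.map id Prod.fst l.1)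
        (mk_zPhase α (⟨Sum.inr ((), true), rfl⟩ : P))).trans ?_
      rw [rename_hBox]
      rfl

lemma substitute_phaseGadget (α : ℂ) (t : Fin n → Term V) :
    substitute ⟦phaseGadget n α⟧ t = hPow (Complex.exp (Complex.I * α)) (∑ i, t i) := by
  have : Fintype V := Fintype.ofFinite V
  have hxor : substitute (xorVars (Fin n)).val (liftTerms t) =
      equations fun _ : Unit => xorTerms t := by
    rw [equations, Fintype.prod_unique, Term.equation_self]
    rfl
  have hphase : substitute (hBox (Complex.exp (Complex.I * α)) fun _ : Unit => Sum.inr ())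
      (liftTerms t) =
      hBox (Complex.exp (Complex.I * α)) fun _ : Unit => (Sum.inr () : V ⊕ Unit) := by
    rw [substitute_hBox, ← hBoxTerms_var]
    rfl
  rw [mk_phaseGadget, substitute_sumOut, substitute_mul, ← xorTerms_eq_sum, hxor, hphase,
    sumOut_mul_equations, substitute_hBox]
  rfl

/-- The minterm of `b`, which is `1` exactly where the terms `x i` take the values `b i`. -/
noncomputable def minterm (b : Fin n → Bool) (x : Fin n → Term V) : Term V :=
  ∏ i, bif b i then x i else x i + 1

/-- The exclusive or of the terms selected by `c`. -/
noncomputable def linearForm (c : Fin n → Bool) (x : Fin n → Term V) : Term V :=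
  ∑ i, bif c i then x i else 0

lemma mk_expNormalForm (α : (Fin n → Bool) → ℂ) : (⟦expNormalForm α⟧ : Diagram (Fin n)) =
    ∏ b : Fin n → Bool,
      hPow (Complex.exp (Complex.I * α b)) (minterm b var) := by
  have hpiece (b : Fin n → Bool) (i : Fin n) : (⟦power notGate (!b i)⟧ : Diagram Bool) =
      (bif b i then var () else var () + 1).equation (fun _ => false) true := by
    cases b i
    exacts [mk_notGate, mk_strand]
  refine (mk_bangBox _ (fun b => expH (α b) (Fin n)) _ hpiece).trans
    (Finset.prod_congr rfl fun b _ => ?_)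
  refine (congrArg (substitute · _) (rename_id _).symm).trans
    ((hBoxTerms_eq_hPow _ _).trans (congrArg _ (Finset.prod_congr rfl fun i _ => ?_)))
  cases b i
  · exact (Term.map_add _ _ _).trans (congrArg₂ _ (Term.map_var _ _) (Term.map_one _))
  · exact Term.map_var _ _

lemma mk_gadgetForm (β : (Fin n → Bool) → ℂ) : (⟦gadgetForm β⟧ : Diagram (Fin n)) =
    ∏ c : Fin n → Bool,
      hPow (Complex.exp (Complex.I * β c)) (linearForm c var) := by
  have hpiece (c : Fin n → Bool) (i : Fin n) : (⟦power disconnectPiece (!c i)⟧ : Diagram Bool) =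
      (bif c i then var () else 0).equation (fun _ => false) true := by
    cases c i
    exacts [mk_disconnectPiece, mk_strand]
  refine (mk_bangBox _ (fun c => phaseGadget n (β c)) _ hpiece).trans
    (Finset.prod_congr rfl fun c _ => (substitute_phaseGadget _ _).trans
      (congrArg _ (Finset.sum_congr rfl fun i _ => ?_)))
  cases c i
  · exact Term.map_zero _
  · exact Term.map_var _ _

end

/-! ### Products over minterms and over linear forms -/

section
variable {V : Type} [Finite V] {n : ℕ}

lemma Omega_succ (b c : Fin (n + 1) → Bool) :
    Omega b c = Bool.xor (b 0 && c 0) (Omega (Fin.tail b) (Fin.tail c)) := by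
  rw [Omega, List.ofFn_succ, List.foldr_cons]
  rfl

lemma minterm_succ (b : Fin (n + 1) → Bool) (x : Fin (n + 1) → Term V) :
    minterm b x = (bif b 0 then x 0 else x 0 + 1) * minterm (Fin.tail b) (Fin.tail x) :=
  Fin.prod_univ_succ _

lemma linearForm_succ (c : Fin (n + 1) → Bool) (x : Fin (n + 1) → Term V) :
    linearForm c x = (bif c 0 then x 0 else 0) + linearForm (Fin.tail c) (Fin.tail x) :=
  Fin.sum_univ_succ _

lemma mul_minterm (b : Fin n → Bool) (x : Fin n → Term V) (i : Fin n) :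
    x i * minterm b x = bif b i then minterm b x else 0 := by
  rw [minterm, ← Finset.mul_prod_erase _ _ (Finset.mem_univ i), ← mul_assoc]
  cases b i
  · rw [cond_false, Term.mul_add_one_self, zero_mul, cond_false]
  · rw [cond_true, Term.mul_self, cond_true]

lemma linearForm_mul (b c : Fin n → Bool) (x : Fin n → Term V) (m : Term V)
    (hm : ∀ i, x i * m = bif b i then m else 0) :
    linearForm c x * m = bif Omega b c then m else 0 := by
  induction n with
  | zero => simp [linearForm, Omega]
  | succ n ih =>
    have hhead : (bif c 0 then x 0 else 0) * m = bif b 0 && c 0 then m else 0 := by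
      cases c 0
      · simp
      · simpa using hm 0
    rw [linearForm_succ, add_mul, Omega_succ, hhead,
      ih (Fin.tail b) (Fin.tail c) (Fin.tail x) fun i => hm i.succ]
    cases b 0 && c 0 <;> cases Omega (Fin.tail b) (Fin.tail c) <;> simp [Term.add_self]

lemma hPow_eq_prod_minterm (a : ℂ) (t : Term V) (x : Fin n → Term V) :
    hPow a t = ∏ b : Fin n → Bool, hPow a (t * minterm b x) := by
  induction n generalizing t with
  | zero => simp [minterm]
  | succ n ih =>
    rw [← Equiv.prod_comp (Fin.consEquiv fun _ => Bool), Fintype.prod_prod_type, Fintype.prod_bool,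
      hPow_split a t (x 0), ih (t * x 0) (Fin.tail x), ih (t * (x 0 + 1)) (Fin.tail x)]
    simp only [minterm_succ, ← mul_assoc]
    rfl

lemma prod_hPow {ι : Type} (S : Finset ι) (a : ι → ℂ) (t : Term V) :
    ∏ i ∈ S, hPow (a i) t = hPow (∏ i ∈ S, a i) t := by
  classical
  induction S using Finset.induction_on with
  | empty => simp [hPow_one_left]
  | insert i S hi ih => rw [Finset.prod_insert hi, Finset.prod_insert hi, ih, hPow_mul_hPow]

lemma hPow_linearForm (β : ℂ) (c : Fin n → Bool) (x : Fin n → Term V) :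
    hPow (Complex.exp (Complex.I * β)) (linearForm c x) = ∏ b : Fin n → Bool,
      hPow (Complex.exp (Complex.I * (β * ((Omega b c).toNat : ℂ)))) (minterm b x) := by
  rw [hPow_eq_prod_minterm _ _ x]
  refine Finset.prod_congr rfl fun b _ => ?_
  rw [linearForm_mul b c x _ fun i => mul_minterm b x i]
  cases Omega b c
  · simp [hPow_zero, hPow_one_left]
  · simp

lemma prod_hPow_linearForm (β : (Fin n → Bool) → ℂ) (x : Fin n → Term V) :
    ∏ c : Fin n → Bool, hPow (Complex.exp (Complex.I * β c)) (linearForm c x) =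
      ∏ b : Fin n → Bool, hPow (Complex.exp (Complex.I * ∑ c, β c * ((Omega b c).toNat : ℂ)))
        (minterm b x) := by
  simp only [hPow_linearForm]
  rw [Finset.prod_comm]
  refine Finset.prod_congr rfl fun b _ => ?_
  rw [prod_hPow, ← Complex.exp_sum, Finset.mul_sum]

lemma zhEqUpToScalar_of_expansion (α β : (Fin n → Bool) → ℂ) (γ : ℂ)
    (h : ∀ b, α b = γ + ∑ c, β c * ((Omega b c).toNat : ℂ)) :
    ZHEqUpToScalar (expNormalForm α) (gadgetForm β) := by
  suffices hscale : (⟦expNormalForm α⟧ : Diagram (Fin n)) =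
      ⟦scale (Complex.exp (Complex.I * γ)) (gadgetForm β)⟧ from
    ⟨_, Complex.exp_ne_zero _, Quotient.exact hscale⟩
  rw [mk_scale, mk_expNormalForm, mk_gadgetForm, prod_hPow_linearForm, ← hPow_one,
    hPow_eq_prod_minterm _ 1 (var : Fin n → Term (Fin n)), ← Finset.prod_mul_distrib]
  refine Finset.prod_congr rfl fun b _ => ?_
  rw [one_mul, hPow_mul_hPow, ← Complex.exp_add, h, mul_add, add_comm]

end

/-! ### The Fourier transform -/

section
variable {n : ℕ}

lemma chi_eq_prod (b c : Fin n → Bool) : chi b c = ∏ i, (-1 : ℂ) ^ ((b i).toNat * (c i).toNat) :=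
  (Finset.prod_pow_eq_pow_sum _ _ _).symm

lemma chi_succ (b c : Fin (n + 1) → Bool) :
    chi b c = (-1) ^ ((b 0).toNat * (c 0).toNat) * chi (Fin.tail b) (Fin.tail c) := by
  rw [chi_eq_prod, chi_eq_prod, Fin.prod_univ_succ]
  rfl

lemma chi_comm (b c : Fin n → Bool) : chi b c = chi c b := by
  simp only [chi, mul_comm]

lemma chi_zero_right (b : Fin n → Bool) : chi b (fun _ => false) = 1 := by
  simp [chi]

lemma chi_eq_one_sub_Omega (b c : Fin n → Bool) : chi b c = 1 - 2 * ((Omega b c).toNat : ℂ) := by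
  induction n with
  | zero => simp [Omega, chi]
  | succ n ih =>
    rw [chi_succ, Omega_succ, ih]
    cases b 0 <;> cases c 0 <;> cases Omega (Fin.tail b) (Fin.tail c) <;> norm_num

lemma Omega_toNat_eq (b c : Fin n → Bool) : ((Omega b c).toNat : ℂ) = (1 - chi b c) / 2 := by
  rw [chi_eq_one_sub_Omega]
  ring

lemma sum_chi_mul_chi (c d : Fin n → Bool) :
    ∑ b, chi b c * chi b d = if c = d then 2 ^ n else 0 := by
  have hfactor : ∑ b, chi b c * chi b d = ∏ i, ∑ t : Bool,
      (-1 : ℂ) ^ (t.toNat * (c i).toNat) * (-1) ^ (t.toNat * (d i).toNat) := by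
    simp only [chi_eq_prod, ← Finset.prod_mul_distrib, Fintype.prod_sum]
  have hbit (i : Fin n) :
      ∑ t : Bool, (-1 : ℂ) ^ (t.toNat * (c i).toNat) * (-1) ^ (t.toNat * (d i).toNat) =
        if c i = d i then 2 else 0 := by
    cases c i <;> cases d i <;> norm_num
  simp only [hfactor, hbit]
  split_ifs with hcd
  · simp [hcd]
  · obtain ⟨i, hi⟩ := Function.ne_iff.1 hcd
    exact Finset.prod_eq_zero (Finset.mem_univ i) (if_neg hi)

lemma sum_Omega_mul_chi (c d : Fin n → Bool) :
    ∑ b, ((Omega b c).toNat : ℂ) * chi b d =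
      ((if d = fun _ => false then 2 ^ n else 0) - if c = d then 2 ^ n else 0) / 2 := by
  have hsum := sum_chi_mul_chi d fun _ => false
  simp only [chi_zero_right, mul_one] at hsum
  simp only [Omega_toNat_eq, div_mul_eq_mul_div, sub_mul, one_mul]
  rw [← Finset.sum_div, Finset.sum_sub_distrib, sum_chi_mul_chi, hsum]

lemma neg_one_div_two_zpow_sub_one (n : ℕ) : -1 / (2 : ℂ) ^ ((n : ℤ) - 1) = -2 / 2 ^ n := by
  rw [zpow_sub_one₀ two_ne_zero, zpow_natCast]
  field_simp

lemma IsFourierExpansion.transform {α β : (Fin n → Bool) → ℂ} (h : IsFourierExpansion α β)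
    (d : Fin n → Bool) (hd : d ≠ fun _ => false) :
    β d = -1 / (2 : ℂ) ^ ((n : ℤ) - 1) * ∑ b, α b * chi b d := by
  have hswap : ∑ b, α b * chi b d = ∑ c, β c * ∑ b, ((Omega b c).toNat : ℂ) * chi b d := by
    simp only [h _, Finset.sum_mul, Finset.mul_sum, mul_assoc]
    exact Finset.sum_comm
  rw [hswap, neg_one_div_two_zpow_sub_one]
  simp only [sum_Omega_mul_chi, hd, if_false]
  rw [Finset.sum_eq_single d]
  · rw [if_pos rfl]
    field_simp
    ring
  · intro c _ hc
    simp [hc]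
  · simp

lemma IsFourierTransform.expansion {α β : (Fin n → Bool) → ℂ} (h : IsFourierTransform α β)
    (b : Fin n → Bool) :
    α b = α (fun _ => false) + ∑ c, β c * ((Omega b c).toNat : ℂ) := by
  have hswap : ∑ c, β c * ((Omega b c).toNat : ℂ) =
      -2 / 2 ^ n * ∑ d, α d * ∑ c, ((Omega c b).toNat : ℂ) * chi c d := by
    simp only [h _, neg_one_div_two_zpow_sub_one, Finset.sum_mul, Finset.mul_sum, Omega_toNat_eq]
    rw [Finset.sum_comm]
    refine Finset.sum_congr rfl fun d _ => Finset.sum_congr rfl fun c _ => ?_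
    rw [chi_comm b c, chi_comm d c]
    ring
  have hinner (d : Fin n → Bool) : α d * ∑ c, ((Omega c b).toNat : ℂ) * chi c d =
      2 ^ n / 2 * ((if d = fun _ => false then α d else 0) - if b = d then α d else 0) := by
    rw [sum_Omega_mul_chi]
    split_ifs <;> ring
  simp only [hswap, hinner]
  rw [← Finset.mul_sum, Finset.sum_sub_distrib, Finset.sum_ite_eq', Finset.sum_ite_eq,
    if_pos (Finset.mem_univ _), if_pos (Finset.mem_univ _)]
  field_simp
  ring

end

end ZHCalculus

theorem mainTheorem1 (n : ℕ) (α αt : (Fin n → Bool) → ℂ) :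
    ((ZHCalculus.IsFourierExpansion α αt ∨ ZHCalculus.IsFourierTransform α αt) →
      ZHCalculus.ZHEqUpToScalar (ZHCalculus.expNormalForm α) (ZHCalculus.gadgetForm αt)) ∧
    (ZHCalculus.IsFourierExpansion α αt →
      ∀ c : Fin n → Bool, c ≠ (fun _ => false) →
        αt c = -1 / (2 : ℂ) ^ ((n : ℤ) - 1) * ∑ b, α b * ZHCalculus.chi b c) ∧
    (ZHCalculus.IsFourierTransform α αt →
      ∀ b : Fin n → Bool,
        α b = α (fun _ => false) + ∑ c, αt c * ((ZHCalculus.Omega b c).toNat : ℂ)) := by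
  refine ⟨?_, ZHCalculus.IsFourierExpansion.transform, ZHCalculus.IsFourierTransform.expansion⟩
  rintro (h | h)
  · exact ZHCalculus.zhEqUpToScalar_of_expansion α αt 0 fun b => by rw [zero_add, h b]
  · exact ZHCalculus.zhEqUpToScalar_of_expansion α αt _ h.expansion
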